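/- Let $k$ be a commutative ring. A *superalgebra* is an associative unital $k$-algebra $A=A_0\oplus A_1$, graded by $\mathbb Z/2$, with $ab=(-1)^{|a||b|}ba$ for homogeneous $a,b$; morphisms are the parity-preserving homomorphisms of unital $k$-algebras, and the category is denoted $(\mathrm{salg})$. A superalgebra is *local* if it has a unique maximal homogeneous two-sided ideal. A *superspace* $X=(|X|,\mathcal O_X)$ is a topological space with a sheaf of superalgebras whose stalks are local; a morphism of superspaces is a continuous map together with a morphism of sheaves of superalgebras whose maps on stalks send the maximal homogeneous ideal into the maximal homogeneous ideal. A *superscheme* is a superspace $X$ such that $(|X|,\mathcal O_{X,0})$ is a scheme and $\mathcal O_{X,1}$ is a quasi-coherent sheaf of $\mathcal O_{X,0}$-modules. For a superalgebra $A$ let $\underline{\mathrm{Spec}}\,A$ be the superspace $(\mathrm{Spec}\,A_0,\mathcal O_A)$, where $\mathcal O_A$ is the sheaf associated with the $A_0$-module $A$: its sections over $U$ are the functions $\mathfrak p\mapsto s(\mathfrak p)\in A_{\mathfrak p}$ on $U$ which are locally of the form $a/f$ with $a\in A$, $f\in A_0$. The *functor of points* of a superspace $X$ is $h_X:(\mathrm{salg})\to(\mathrm{sets})$,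 $h_X(A)=\mathrm{Hom}(\underline{\mathrm{Spec}}\,A,X)$. For an open subspace $V\subset X$, $h_V\subset h_X$ is the subfunctor of the morphisms that factor through $V$. Let $F:(\mathrm{salg})\to(\mathrm{sets})$ be a functor. - $F$ is *local* (a sheaf in the Zariski topology) if for every superalgebra $A$, every family $(f_i)_{i\in I}$ in $A_0$ that generates the unit ideal, and every family $\alpha_i\in F(A_{f_i})$ such that $\alpha_i$ and $\alpha_j$ have the same image in $F(A_{f_if_j})$ for all $i,j$, there is a unique $\alpha\in F(A)$ which maps to $\alpha_i$ for every $i$. - A subfunctor $U\subset F$ is *open* if for every superalgebra $A$ and every natural transformation $f:h_{\underline{\mathrm{Spec}}\,A}\to F$ there is an open $V\subset\underline{\mathrm{Spec}}\,A$ with $f^{-1}(U)=h_V$. It is *open affine* if moreover it is representable, i.e. $U\cong\mathrm{Hom}(B,-)$ for some superalgebra $B$. - A family $(U_i)_{i\in I}$ of open subfunctors, indexed by a set $I$, *covers* $F$ if for every superalgebra $A$ and every $f:h_{\underline{\mathrm{Spec}}\,A}\to F$ one has $h_{\underline{\mathrm{Spec}}\,A}\times_FU_i=f^{-1}(U_i)=h_{V_i}$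 for opens $V_i\subset\underline{\mathrm{Spec}}\,A$ with $\bigcup_iV_i=\mathrm{Spec}\,A_0$. **Theorem.** There is a superscheme $X$ such that $F$ is naturally isomorphic to $h_X$ if and only if 1. $F$ is local, and 2. $F$ admits a cover by open affine subfunctors. -/

import Mathlib

open CategoryTheory Opposite TopologicalSpace AlgebraicGeometry

universe u

noncomputable section

/-- A commutative superalgebra over `k`: an associative unital `k`-algebra with a `ℤ/2`-grading
such that `a * b = (-1) ^ (|a| |b|) b * a` for homogeneous `a`, `b`. -/
structure SuperAlg (k : Type u) [CommRing k] where
  carrier : Type u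
  [isRing : Ring carrier]
  [isAlgebra : Algebra k carrier]
  /-- `part 0` is the even part, `part 1` the odd part. -/
  part : ZMod 2 → Submodule k carrier
  [isGraded : GradedAlgebra part]
  supercomm : ∀ (i j : ZMod 2) (a b : carrier), a ∈ part i → b ∈ part j →
    a * b = (-1) ^ (i.val * j.val) * (b * a)

namespace SuperAlg

variable {k : Type u} [CommRing k]

attribute [instance] isRing isAlgebra isGraded

instance : CoeSort (SuperAlg k) (Type u) := ⟨SuperAlg.carrier⟩

/-- A morphism of superalgebras: a parity preserving homomorphism of `k`-algebras. -/
@[ext]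
structure Hom (A B : SuperAlg k) where
  toGradedAlgHom : A.part →ₐᵍ[k] B.part

instance : Category (SuperAlg k) where
  Hom A B := Hom A B
  id A := ⟨GradedAlgHom.id k A.part⟩
  comp f g := ⟨g.toGradedAlgHom.comp f.toGradedAlgHom⟩

instance : ConcreteCategory (SuperAlg k) (fun A B => A.part →ₐᵍ[k] B.part) where
  hom f := f.toGradedAlgHom
  ofHom f := ⟨f⟩

variable (A B : SuperAlg k)

theorem even_mul_comm {a b : A} (ha : a ∈ A.part 0) : a * b = b * a := by
  induction b using DirectSum.Decomposition.inductionOn A.part with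
  | zero => simp
  | @homogeneous j c => simpa using A.supercomm 0 j a c ha c.2
  | add x y hx hy => rw [mul_add, add_mul, hx, hy]

theorem odd_mul_anticomm {a b : A} (ha : a ∈ A.part 1) (hb : b ∈ A.part 1) :
    a * b = - (b * a) := by
  simpa [ZMod.val_one] using A.supercomm 1 1 a b ha hb

theorem odd_mul_mem {a b : A} (ha : a ∈ A.part 1) (hb : b ∈ A.part 1) : a * b ∈ A.part 0 :=
  SetLike.mul_mem_graded (i := (1 : ZMod 2)) (j := 1) ha hb

/-- The even part `A₀`, as a subalgebra. -/
def evenSub : Subalgebra k A where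
  carrier := A.part 0
  mul_mem' ha hb := by simpa using SetLike.mul_mem_graded ha hb
  add_mem' := (A.part 0).add_mem
  algebraMap_mem' r := SetLike.algebraMap_mem_graded A.part r

/-- The even part `A₀`, a commutative ring. -/
abbrev Even : Type u := A.evenSub

instance : CommRing A.Even where
  mul_comm a _ := Subtype.ext (A.even_mul_comm a.2)

instance : Algebra A.Even A where
  algebraMap := A.evenSub.val.toRingHom
  commutes' a _ := A.even_mul_comm a.2
  smul_def' _ _ := rfl

theorem algebraMap_even (a : A.Even) : algebraMap A.Even A a = a := rfl
theorem even_smul_def (a : A.Even) (b : A) : a • b = (a : A) * b := rfl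

instance : IsScalarTower k A.Even A := ⟨fun r a b => smul_mul_assoc r (a : A) b⟩

/-- The projection of `A` onto its homogeneous component of degree `i`. -/
def proj (i : ZMod 2) : A →ₗ[k] A := GradedAlgebra.proj A.part i

theorem proj_mem (i : ZMod 2) (a : A) : A.proj i a ∈ A.part i := SetLike.coe_mem _

theorem proj_of_mem {i : ZMod 2} {a : A} (ha : a ∈ A.part i) : A.proj i a = a :=
  DirectSum.decompose_of_mem_same _ ha

theorem proj_of_mem_ne {i j : ZMod 2} {a : A} (ha : a ∈ A.part i) (h : i ≠ j) :
    A.proj j a = 0 :=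
  DirectSum.decompose_of_mem_ne _ ha h

theorem proj_add_proj (a : A) : A.proj 0 a + A.proj 1 a = a := by
  induction a using DirectSum.Decomposition.inductionOn A.part with
  | zero => simp
  | @homogeneous j c =>
    obtain rfl | rfl : j = 0 ∨ j = 1 := by clear c; revert j; decide
    · rw [A.proj_of_mem c.2, A.proj_of_mem_ne c.2 (by decide), add_zero]
    · rw [A.proj_of_mem c.2, A.proj_of_mem_ne c.2 (by decide), zero_add]
  | add x y hx hy => rw [map_add, map_add, add_add_add_comm, hx, hy]

/-- A superalgebra from a `k`-algebra which is the direct sum of an even and an odd part. -/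
def mk' (R : Type u) [Ring R] [Algebra k R] (P : ZMod 2 → Submodule k R) (h1 : 1 ∈ P 0)
    (hmul : ∀ i j a b, a ∈ P i → b ∈ P j → a * b ∈ P (i + j)) (hc : IsCompl (P 0) (P 1))
    (hs : ∀ i j a b, a ∈ P i → b ∈ P j → a * b = (-1) ^ (i.val * j.val) * (b * a)) :
    SuperAlg k :=
  letI : GradedAlgebra P :=
    { one_mem := h1
      mul_mem := fun {i j a b} ha hb => hmul i j a b ha hb
      toDecomposition := DirectSum.IsInternal.chooseDecomposition P
        ((DirectSum.isInternal_submodule_iff_isCompl P (i := 0) (j := 1) (by decide)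
          (by ext i; revert i; decide)).2 hc) }
  { carrier := R, part := P, supercomm := hs }

variable {A B}

/-- The morphism of superalgebras given by a parity preserving ring homomorphism which is
compatible with the structure maps of the algebras. -/
def homMk (f : A →ₐ[k] B) (hf : ∀ i a, a ∈ A.part i → f a ∈ B.part i) : A ⟶ B :=
  ⟨{ f with map_mem := fun {i a} h => hf i a h }⟩

@[simp] theorem homMk_apply (f : A →ₐ[k] B) (hf) (a : A) : homMk f hf a = f a := rfl

theorem hom_ext {f g : A ⟶ B} (h : ∀ a, f a = g a) : f = g := ConcreteCategory.hom_ext _ _ h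

theorem map_part (f : A ⟶ B) {i : ZMod 2} {a : A} (ha : a ∈ A.part i) : f a ∈ B.part i :=
  f.toGradedAlgHom.map_mem ha

theorem map_proj (f : A ⟶ B) (i : ZMod 2) (a : A) : f (A.proj i a) = B.proj i (f a) := by
  have h (j : ZMod 2) (c : A) (hc : c ∈ A.part j) : f (A.proj i c) = B.proj i (f c) := by
    by_cases hj : j = i
    · subst hj
      rw [A.proj_of_mem hc, B.proj_of_mem (map_part f hc)]
    · rw [A.proj_of_mem_ne hc hj, B.proj_of_mem_ne (map_part f hc) hj, map_zero]
  conv_lhs => rw [← A.proj_add_proj a]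
  conv_rhs => rw [← A.proj_add_proj a]
  simp only [map_add, h 0 _ (A.proj_mem 0 a), h 1 _ (A.proj_mem 1 a)]

/-- The homomorphism `A₀ → B₀` induced by a morphism of superalgebras. -/
def evenMap (f : A ⟶ B) : A.Even →+* B.Even where
  toFun a := ⟨f a, map_part f a.2⟩
  map_one' := Subtype.ext (map_one f.toGradedAlgHom)
  map_zero' := Subtype.ext (map_zero f.toGradedAlgHom)
  map_mul' a b := Subtype.ext (map_mul f.toGradedAlgHom a.1 b.1)
  map_add' a b := Subtype.ext (map_add f.toGradedAlgHom a.1 b.1)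

@[simp] theorem evenMap_coe (f : A ⟶ B) (a : A.Even) : (evenMap f a : B) = f a := rfl

/-- The functor `A ↦ A₀` to commutative rings. -/
def evenFunctor : SuperAlg k ⥤ CommRingCat.{u} where
  obj A := .of A.Even
  map f := CommRingCat.ofHom (evenMap f)

/-- The functor `A ↦ A₁` to abelian groups. -/
def oddFunctor : SuperAlg k ⥤ Ab.{u} where
  obj A := .of (A.part 1)
  map f := AddCommGrpCat.ofHom
    { toFun := fun a => ⟨f a, map_part f a.2⟩
      map_zero' := Subtype.ext (map_zero f.toGradedAlgHom)
      map_add' := fun a b => Subtype.ext (map_add f.toGradedAlgHom a.1 b.1) }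

/-- The functor to rings which forgets the grading. -/
def ringFunctor : SuperAlg k ⥤ RingCat.{u} where
  obj A := .of A
  map f := RingCat.ofHom (f.toGradedAlgHom.toAlgHom.toRingHom)

/-- The odd part `A₁` is a module over `A₀`. -/
instance : Module A.Even (A.part 1) where
  smul a b := ⟨a * b, by simpa using SetLike.mul_mem_graded a.2 b.2⟩
  one_smul b := Subtype.ext (one_mul _)
  mul_smul a b c := Subtype.ext (mul_assoc _ _ _)
  smul_zero a := Subtype.ext (mul_zero _)
  zero_smul a := Subtype.ext (zero_mul _)
  smul_add a b c := Subtype.ext (mul_add _ _ _)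
  add_smul a b c := Subtype.ext (add_mul _ _ _)

/-! ### Local superalgebras -/

variable (A)

/-- `I` is a maximal homogeneous two-sided ideal, i.e. maximal among the proper homogeneous
two-sided ideals. -/
def IsMaximalHomogeneous (I : Ideal A) : Prop :=
  Maximal (fun J : Ideal A => J.IsTwoSided ∧ J.IsHomogeneous A.part ∧ J ≠ ⊤) I

/-- A superalgebra is local if it has a unique maximal homogeneous two-sided ideal. -/
def IsLocal : Prop := ∃! I : Ideal A, A.IsMaximalHomogeneous I

variable {A} in
/-- The maximal homogeneous ideal of a local superalgebra. -/
def IsLocal.maxIdeal (h : A.IsLocal) : Ideal A := h.choose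

theorem proj_zero_mul (a b : A) :
    A.proj 0 (a * b) = A.proj 0 a * A.proj 0 b + A.proj 1 a * A.proj 1 b := by
  have h (i j : ZMod 2) : A.proj i a * A.proj j b ∈ A.part (i + j) :=
    SetLike.mul_mem_graded (A.proj_mem i a) (A.proj_mem j b)
  conv_lhs => rw [← A.proj_add_proj a, ← A.proj_add_proj b]
  simp only [add_mul, mul_add, map_add]
  rw [A.proj_of_mem (i := 0) (h 0 0), A.proj_of_mem (i := 0) (h 1 1),
    A.proj_of_mem_ne (j := 0) (h 0 1) (by decide), A.proj_of_mem_ne (j := 0) (h 1 0) (by decide)]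
  abel

/-- The component of degree zero, as an element of `A₀`. -/
def evenPart (a : A) : A.Even := ⟨A.proj 0 a, A.proj_mem 0 a⟩

theorem isUnit_even_iff (a : A.Even) : IsUnit a ↔ IsUnit (a : A) := by
  refine ⟨fun h => h.map A.evenSub.val, fun ⟨v, hv⟩ => ?_⟩
  refine IsUnit.of_mul_eq_one (A.evenPart ↑v⁻¹) (Subtype.ext ?_)
  have h1 : (a : A) * ↑v⁻¹ = 1 := by rw [← hv, Units.mul_inv]
  have := A.proj_zero_mul a ↑v⁻¹
  rw [h1, A.proj_of_mem a.2, A.proj_of_mem_ne a.2 (j := 1) (by decide), zero_mul, add_zero,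
    A.proj_of_mem A.evenSub.one_mem] at this
  exact this.symm

/-- For `A₀` local, the set of all `a` such that no `(a b)₀` is a unit. -/
def evenLocalIdeal [IsLocalRing A.Even] : Ideal A where
  carrier := {a | ∀ b, A.evenPart (a * b) ∈ IsLocalRing.maximalIdeal A.Even}
  zero_mem' b := by
    have : A.evenPart (0 * b) = 0 := Subtype.ext (by simp [evenPart])
    rw [this]; exact zero_mem _
  add_mem' {x y} hx hy b := by
    have : A.evenPart ((x + y) * b) = A.evenPart (x * b) + A.evenPart (y * b) :=
      Subtype.ext (by simp [evenPart, add_mul])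
    rw [this]; exact add_mem (hx b) (hy b)
  smul_mem' c x hx b := by
    have h := A.proj_zero_mul c (x * b)
    have h' := A.proj_zero_mul (x * b) (A.proj 1 c)
    rw [A.proj_of_mem (A.proj_mem 1 c), A.proj_of_mem_ne (j := 0) (A.proj_mem 1 c) (by decide),
      mul_zero, zero_add] at h'
    have : A.evenPart (c • x * b) =
        A.evenPart c * A.evenPart (x * b) - A.evenPart (x * (b * A.proj 1 c)) := by
      refine Subtype.ext ?_
      change A.proj 0 (c * x * b) =
        A.proj 0 c * A.proj 0 (x * b) - A.proj 0 (x * (b * A.proj 1 c))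
      rw [mul_assoc, h, ← mul_assoc x, h',
        A.odd_mul_anticomm (A.proj_mem 1 c) (A.proj_mem 1 (x * b)), sub_eq_add_neg]
    rw [this]
    exact sub_mem (Ideal.mul_mem_left _ _ (hx b)) (hx _)

theorem isMaximalHomogeneous_evenLocalIdeal [IsLocalRing A.Even] :
    A.IsMaximalHomogeneous A.evenLocalIdeal ∧
      ∀ J : Ideal A, J.IsTwoSided → J.IsHomogeneous A.part → J ≠ ⊤ → J ≤ A.evenLocalIdeal := by
  have key : ∀ J : Ideal A, J.IsTwoSided → J.IsHomogeneous A.part → J ≠ ⊤ →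
      J ≤ A.evenLocalIdeal := by
    intro J h2 hJ hne a ha b
    rw [IsLocalRing.mem_maximalIdeal, mem_nonunits_iff, A.isUnit_even_iff]
    exact fun hu => hne (Ideal.eq_top_of_isUnit_mem J (hJ 0 (J.mul_mem_right b ha)) hu)
  refine ⟨⟨⟨⟨fun {a} b ha c => ?_⟩, fun i x hx b => ?_, fun h => ?_⟩, fun J hJ _ => ?_⟩, key⟩
  · rw [mul_assoc]; exact ha _
  · have : A.evenPart (A.proj i x * b) = A.evenPart (x * A.proj i b) := by
      refine Subtype.ext ?_
      change A.proj 0 _ = A.proj 0 _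
      rw [A.proj_zero_mul, A.proj_zero_mul]
      obtain rfl | rfl : i = 0 ∨ i = 1 := by clear hx; revert i; decide
      · rw [A.proj_of_mem (A.proj_mem 0 x), A.proj_of_mem (A.proj_mem 0 b),
          A.proj_of_mem_ne (A.proj_mem 0 x) (by decide),
          A.proj_of_mem_ne (A.proj_mem 0 b) (by decide), zero_mul, mul_zero]
      · rw [A.proj_of_mem (A.proj_mem 1 x), A.proj_of_mem (A.proj_mem 1 b),
          A.proj_of_mem_ne (A.proj_mem 1 x) (by decide),
          A.proj_of_mem_ne (A.proj_mem 1 b) (by decide), zero_mul, mul_zero]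
    exact this ▸ hx _
  · have h1 : (1 : A) ∈ A.evenLocalIdeal := h ▸ trivial
    have h2 : A.evenPart (1 * 1) = 1 :=
      Subtype.ext (by rw [mul_one]; exact A.proj_of_mem A.evenSub.one_mem)
    exact (Ideal.ne_top_iff_one _).1 (IsLocalRing.maximalIdeal.isMaximal A.Even).ne_top
      (h2 ▸ h1 1)
  · exact key J hJ.1 hJ.2.1 hJ.2.2

theorem isLocal_of_even [IsLocalRing A.Even] : A.IsLocal :=
  ⟨A.evenLocalIdeal, A.isMaximalHomogeneous_evenLocalIdeal.1, fun J hJ =>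
    hJ.eq_of_le A.isMaximalHomogeneous_evenLocalIdeal.1.prop
      (A.isMaximalHomogeneous_evenLocalIdeal.2 J hJ.prop.1 hJ.prop.2.1 hJ.prop.2.2)⟩

theorem IsLocal.maxIdeal_eq [IsLocalRing A.Even] (h : A.IsLocal) :
    h.maxIdeal = A.evenLocalIdeal :=
  h.unique h.choose_spec.1 A.isMaximalHomogeneous_evenLocalIdeal.1

/-- The two-sided ideal generated by an even element. -/
def evenSpan (a : A.Even) : Ideal A where
  carrier := {x | ∃ c, x = a * c}
  zero_mem' := ⟨0, by simp⟩
  add_mem' := by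
    rintro _ _ ⟨c, rfl⟩ ⟨d, rfl⟩
    exact ⟨c + d, by rw [mul_add]⟩
  smul_mem' := by
    rintro d _ ⟨c, rfl⟩
    exact ⟨d * c, by rw [smul_eq_mul, ← mul_assoc, ← mul_assoc, A.even_mul_comm a.2]⟩

variable {A} in
/-- The even part of a local superalgebra is a local ring. -/
theorem IsLocal.isLocalRing_even (h : A.IsLocal) : IsLocalRing A.Even := by
  have hM := h.choose_spec.1
  have hne : ¬ IsUnit (0 : A) := by
    intro h0
    have : Subsingleton A := by
      have := isUnit_zero_iff.1 h0
      exact subsingleton_of_zero_eq_one this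
    exact hM.prop.2.2 (Subsingleton.elim _ _)
  have : Nontrivial A.Even := by
    refine ⟨0, 1, fun h01 => hne ?_⟩
    have : (0 : A) = 1 := congrArg Subtype.val h01
    rw [this]; exact isUnit_one
  -- every non-unit of `A₀` lies in the maximal homogeneous ideal
  have key (a : A.Even) (ha : ¬ IsUnit a) : (a : A) ∈ h.choose := by
    let P : Ideal A → Prop := fun J => J.IsTwoSided ∧ J.IsHomogeneous A.part ∧ J ≠ ⊤
    have hP : P (A.evenSpan a) := by
      refine ⟨⟨?_⟩, ?_, ?_⟩
      · rintro _ b ⟨c, rfl⟩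
        exact ⟨c * b, by rw [mul_assoc]⟩
      · rintro i _ ⟨c, rfl⟩
        refine ⟨A.proj i c, ?_⟩
        change A.proj i _ = _
        rw [← A.proj_add_proj c, mul_add, map_add, map_add]
        have hm (j : ZMod 2) : (a : A) * A.proj j c ∈ A.part j := by
          simpa using SetLike.mul_mem_graded a.2 (A.proj_mem j c)
        obtain rfl | rfl : i = 0 ∨ i = 1 := by revert i; decide
        · rw [A.proj_of_mem (hm 0), A.proj_of_mem_ne (hm 1) (by decide),
            A.proj_of_mem (A.proj_mem 0 c), A.proj_of_mem_ne (A.proj_mem 1 c) (by decide)]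
          simp
        · rw [A.proj_of_mem (hm 1), A.proj_of_mem_ne (hm 0) (by decide),
            A.proj_of_mem (A.proj_mem 1 c), A.proj_of_mem_ne (A.proj_mem 0 c) (by decide)]
          simp
      · intro ht
        obtain ⟨c, hc⟩ : (1 : A) ∈ A.evenSpan a := ht ▸ trivial
        exact ha ((A.isUnit_even_iff a).2
          ⟨⟨a, c, hc.symm, (A.even_mul_comm a.2).symm.trans hc.symm⟩, rfl⟩)
    obtain ⟨M, hle, hMM⟩ := zorn_le_nonempty₀ {J | P J} (fun c hc hch J hJ => by
      refine ⟨sSup c, ⟨⟨fun {x} b hx => ?_⟩, ?_, ?_⟩, fun K hK => le_sSup hK⟩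
      · rw [Submodule.mem_sSup_of_directed ⟨J, hJ⟩ hch.directedOn] at hx ⊢
        obtain ⟨K, hK, hx⟩ := hx
        have := (hc hK).1
        exact ⟨K, hK, Ideal.mul_mem_right b K hx⟩
      · intro i x hx
        rw [Submodule.mem_sSup_of_directed ⟨J, hJ⟩ hch.directedOn] at hx ⊢
        obtain ⟨K, hK, hx⟩ := hx
        exact ⟨K, hK, (hc hK).2.1 i hx⟩
      · rw [Ideal.ne_top_iff_one, Submodule.mem_sSup_of_directed ⟨J, hJ⟩ hch.directedOn]
        rintro ⟨K, hK, hx⟩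
        exact (Ideal.ne_top_iff_one K).1 (hc hK).2.2 hx) (A.evenSpan a) hP
    have := h.choose_spec.2 M hMM
    exact this ▸ hle ⟨1, (mul_one _).symm⟩
  refine IsLocalRing.of_nonunits_add fun a b ha hb hab => ?_
  exact hM.prop.2.2 (Ideal.eq_top_of_isUnit_mem _ (add_mem (key a ha) (key b hb))
    ((A.isUnit_even_iff (a + b)).1 hab))

variable {A} in
/-- A morphism of local superalgebras is local if it is local on even parts. -/
theorem map_maxIdeal {B : SuperAlg k} (f : A ⟶ B) (hA : A.IsLocal) (hB : B.IsLocal)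
    (hf : IsLocalHom (evenMap f)) {a : A} (ha : a ∈ hA.maxIdeal) : f a ∈ hB.maxIdeal := by
  have := hA.isLocalRing_even
  have := hB.isLocalRing_even
  rw [IsLocal.maxIdeal_eq] at ha ⊢
  intro b
  have hb := B.proj_zero_mul (f a) b
  have e : B.evenPart (f a * b) = evenMap f (A.evenPart a) * B.evenPart b +
      B.evenPart (f (A.proj 1 a) * B.proj 1 b) := by
    refine Subtype.ext ?_
    change B.proj 0 (f a * b) = f (A.proj 0 a) * B.proj 0 b + B.proj 0 _
    rw [hb, map_proj, map_proj, B.proj_of_mem (B.odd_mul_mem (B.proj_mem 1 _) (B.proj_mem 1 b))]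
  rw [e]
  refine add_mem (Ideal.mul_mem_right _ _ ?_) ?_
  · have h1 := ha 1
    rw [mul_one] at h1
    rw [IsLocalRing.mem_maximalIdeal, mem_nonunits_iff] at h1 ⊢
    exact fun hu => h1 (hf.map_nonunit _ hu)
  · -- the square of `f a₁ * b₁` is `- f (a₁ ^ 2) * b₁ ^ 2`
    rw [IsLocalRing.mem_maximalIdeal, mem_nonunits_iff]
    intro hu
    have h1 := ha (A.proj 1 a)
    rw [IsLocalRing.mem_maximalIdeal, mem_nonunits_iff] at h1
    apply h1
    apply hf.map_nonunit
    have o1 : f (A.proj 1 a) ∈ B.part 1 := map_part f (A.proj_mem 1 a)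
    have o2 := B.proj_mem 1 b
    have sq : B.evenPart (f (A.proj 1 a) * B.proj 1 b) *
        B.evenPart (f (A.proj 1 a) * B.proj 1 b) =
        evenMap f (A.evenPart (a * A.proj 1 a)) * - B.evenPart (B.proj 1 b * B.proj 1 b) := by
      refine Subtype.ext ?_
      change B.proj 0 _ * B.proj 0 _ = f (A.proj 0 _) * - B.proj 0 _
      rw [A.proj_zero_mul, A.proj_of_mem (A.proj_mem 1 a),
        A.proj_of_mem_ne (j := 0) (A.proj_mem 1 a) (by decide), mul_zero, zero_add,
        B.proj_of_mem (B.odd_mul_mem o1 o2), B.proj_of_mem (B.odd_mul_mem o2 o2), map_mul]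
      generalize f (A.proj 1 a) = x at *
      generalize B.proj 1 b = y at *
      rw [mul_assoc, ← mul_assoc y, B.odd_mul_anticomm o2 o1]
      noncomm_ring
    exact isUnit_of_mul_isUnit_left (sq ▸ hu.mul hu)


/-! ### Localization -/

section Localization

variable (S : Submonoid A.Even)

theorem neg_one_pow_even_mul {R : Type u} [Ring R] {n : ℕ} (h : _root_.Even n) (x : R) :
    (-1) ^ n * x = x := by rw [h.neg_one_pow, one_mul]

theorem neg_one_pow_odd_mul {R : Type u} [Ring R] {n : ℕ} (h : Odd n) (x : R) :
    (-1) ^ n * x = -x := by rw [h.neg_one_pow, neg_one_mul]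

/-- The localization of a superalgebra at a multiplicative set of even elements is an algebra. -/
instance locAlgebra : Algebra k (LocalizedModule S A) :=
  Algebra.ofModule
    (fun r x y => by
      induction x with | _ a s
      induction y with | _ b t
      rw [LocalizedModule.smul'_mk, LocalizedModule.mk_mul_mk, LocalizedModule.mk_mul_mk,
        LocalizedModule.smul'_mk, smul_mul_assoc])
    (fun r x y => by
      induction x with | _ a s
      induction y with | _ b t
      rw [LocalizedModule.smul'_mk, LocalizedModule.mk_mul_mk, LocalizedModule.mk_mul_mk,
        LocalizedModule.smul'_mk, mul_smul_comm])

theorem loc_mk_mul_cancel (a : A) (s t : S) :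
    LocalizedModule.mk (t • a) (t * s) = LocalizedModule.mk a s :=
  LocalizedModule.mk_eq.2 ⟨1, by simp only [one_smul, Submonoid.smul_def, smul_smul,
    Submonoid.coe_mul, mul_comm]⟩

theorem even_smul_mem (a : A.Even) {i : ZMod 2} {b : A} (hb : b ∈ A.part i) :
    a • b ∈ A.part i := by
  rw [even_smul_def]
  simpa using SetLike.mul_mem_graded a.2 hb

/-- The fractions `a / s` with `a` homogeneous of degree `i`. -/
def locPart (i : ZMod 2) : Submodule k (LocalizedModule S A) where
  carrier := {x | ∃ a ∈ A.part i, ∃ s : S, x = LocalizedModule.mk a s}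
  zero_mem' := ⟨0, zero_mem _, 1, (LocalizedModule.zero_mk 1).symm⟩
  add_mem' := by
    rintro _ _ ⟨a, ha, s, rfl⟩ ⟨b, hb, t, rfl⟩
    exact ⟨t • a + s • b, add_mem (A.even_smul_mem _ ha) (A.even_smul_mem _ hb), s * t,
      LocalizedModule.mk_add_mk⟩
  smul_mem' := by
    rintro r _ ⟨a, ha, s, rfl⟩
    exact ⟨r • a, Submodule.smul_mem _ r ha, s, LocalizedModule.smul'_mk r a s⟩

/-- The localization `A[S⁻¹]` at a multiplicative set `S` of even elements. -/
def loc : SuperAlg k :=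
  mk' (LocalizedModule S A) (A.locPart S)
    ⟨1, A.evenSub.one_mem, 1, OreLocalization.one_def⟩
    (by
      rintro i j _ _ ⟨a, ha, s, rfl⟩ ⟨b, hb, t, rfl⟩
      exact ⟨a * b, SetLike.mul_mem_graded ha hb, s * t, LocalizedModule.mk_mul_mk⟩)
    (by
      constructor
      · rw [Submodule.disjoint_def]
        rintro _ ⟨a, ha, s, rfl⟩ ⟨b, hb, t, h⟩
        obtain ⟨v, hv⟩ := LocalizedModule.mk_eq.1 h
        have h0 : v • t • a ∈ A.part 0 := A.even_smul_mem _ (A.even_smul_mem _ ha)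
        have h1 : v • t • a ∈ A.part 1 := hv ▸ A.even_smul_mem _ (A.even_smul_mem _ hb)
        have : v • t • a = 0 := by
          rw [← A.proj_of_mem h0, A.proj_of_mem_ne h1 (by decide)]
        rw [← A.loc_mk_mul_cancel S a s (v * t), mul_smul, this, LocalizedModule.zero_mk]
      · rw [codisjoint_iff, eq_top_iff]
        rintro x -
        induction x with | _ a s
        refine Submodule.mem_sup.2 ⟨_, ⟨A.proj 0 a, A.proj_mem 0 a, s, rfl⟩, _,
          ⟨A.proj 1 a, A.proj_mem 1 a, s, rfl⟩, ?_⟩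
        rw [LocalizedModule.mk_add_mk, ← smul_add, A.proj_add_proj, A.loc_mk_mul_cancel])
    (by
      rintro i j _ _ ⟨a, ha, s, rfl⟩ ⟨b, hb, t, rfl⟩
      rw [LocalizedModule.mk_mul_mk, LocalizedModule.mk_mul_mk, A.supercomm i j a b ha hb,
        mul_comm s t]
      rcases Nat.even_or_odd (i.val * j.val) with h | h
      · rw [h.neg_one_pow, one_mul]
        exact (neg_one_pow_even_mul h _).symm
      · rw [h.neg_one_pow, neg_one_mul, LocalizedModule.mk_neg]
        exact (neg_one_pow_odd_mul h _).symm)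

/-- The fraction `a / s` in `A[S⁻¹]`. -/
def frac {A : SuperAlg k} {S : Submonoid A.Even} (a : A) (s : S) : A.loc S :=
  LocalizedModule.mk a s

variable {S}

theorem frac_mem {i : ZMod 2} {a : A} (ha : a ∈ A.part i) (s : S) :
    frac a s ∈ (A.loc S).part i := ⟨a, ha, s, rfl⟩

variable {A}

theorem frac_surj (x : A.loc S) : ∃ a s, frac a s = x := by
  induction x using LocalizedModule.induction_on with | _ a s
  exact ⟨a, s, rfl⟩

theorem frac_surj_of_mem {i : ZMod 2} {x : A.loc S} (hx : x ∈ (A.loc S).part i) :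
    ∃ a ∈ A.part i, ∃ s, frac a s = x := by
  obtain ⟨a, ha, s, rfl⟩ := hx
  exact ⟨a, ha, s, rfl⟩

theorem frac_eq_iff {a b : A} {s t : S} :
    frac a s = frac b t ↔ ∃ v : S, (v : A) * ((t : A) * a) = (v : A) * ((s : A) * b) := LocalizedModule.mk_eq

theorem frac_mul_frac (a b : A) (s t : S) : frac a s * frac b t = frac (a * b) (s * t) :=
  LocalizedModule.mk_mul_mk

theorem frac_add_frac (a b : A) (s t : S) :
    frac a s + frac b t = frac ((t : A) * a + (s : A) * b) (s * t) :=
  LocalizedModule.mk_add_mk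

theorem frac_one : frac (1 : A) (1 : S) = 1 := OreLocalization.one_def.symm

theorem smul_frac (r : k) (a : A) (s : S) : r • frac a s = frac (r • a) s :=
  LocalizedModule.smul'_mk r a s

theorem frac_self (s : S) : frac (s : A) s = 1 := by
  rw [← frac_one, frac_eq_iff]
  exact ⟨1, by simp⟩

variable (S) in
/-- The localization map `A ⟶ A[S⁻¹]`. -/
def toLoc : A ⟶ A.loc S :=
  homMk
    { toFun := fun a => frac a 1
      map_one' := frac_one
      map_mul' := fun a b => by rw [frac_mul_frac, one_mul]
      map_zero' := LocalizedModule.zero_mk 1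
      map_add' := fun a b => by rw [frac_add_frac]; simp
      commutes' := fun r => by
        rw [Algebra.algebraMap_eq_smul_one, Algebra.algebraMap_eq_smul_one, ← frac_one,
          smul_frac] }
    (fun _ _ ha => A.frac_mem ha 1)

theorem toLoc_apply (a : A) : toLoc S a = frac a 1 := rfl

theorem isUnit_toLoc (s : S) : IsUnit (evenMap (toLoc S) s) := by
  refine IsUnit.of_mul_eq_one ⟨frac 1 s, A.frac_mem A.evenSub.one_mem s⟩ (Subtype.ext ?_)
  change frac (s : A) 1 * frac 1 s = 1
  rw [frac_mul_frac, one_mul, mul_one, frac_self]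

theorem locInv_mul {f : A ⟶ B} (hf : ∀ s : S, IsUnit (evenMap f s)) (s : S) :
    evenMap f s * ((hf s).unit⁻¹ : B.Evenˣ).1 = 1 := (hf s).mul_val_inv

/-- The map `a / s ↦ f s⁻¹ * f a` on `A[S⁻¹]`. -/
def locLiftFun (f : A ⟶ B) (hf : ∀ s : S, IsUnit (evenMap f s)) (x : A.loc S) : B :=
  LocalizedModule.liftOn x (fun p => ((hf p.2).unit⁻¹ : B.Evenˣ).1 • f p.1) (by
    rintro ⟨a, s⟩ ⟨b, t⟩ ⟨v, hv⟩
    have hv' : (evenMap f v * evenMap f t) • f a = (evenMap f v * evenMap f s) • f b := by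
      rw [mul_smul, mul_smul]
      have := congrArg f hv
      change f ((v : A) * ((t : A) * a)) = f ((v : A) * ((s : A) * b)) at this
      rw [map_mul, map_mul, map_mul, map_mul] at this
      exact this
    have hs := locInv_mul hf s
    have ht := locInv_mul hf t
    have hw := locInv_mul hf v
    set is := ((hf s).unit⁻¹ : B.Evenˣ).1
    set it := ((hf t).unit⁻¹ : B.Evenˣ).1
    set iv := ((hf v).unit⁻¹ : B.Evenˣ).1
    have := congrArg ((is * it * iv) • ·) hv'
    simp only [smul_smul] at this
    convert! this using 2
    · linear_combination (-is) * hw - is * evenMap f v * iv * ht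
    · linear_combination (-it) * hw - it * evenMap f v * iv * hs)

theorem locLiftFun_frac (f : A ⟶ B) (hf : ∀ s : S, IsUnit (evenMap f s)) (a : A) (s : S) :
    locLiftFun f hf (frac a s) = ((hf s).unit⁻¹ : B.Evenˣ).1 • f a :=
  LocalizedModule.liftOn_mk _ a s

/-- The universal property of `A[S⁻¹]`: a morphism which inverts `S` extends to `A[S⁻¹]`. -/
def locLift (f : A ⟶ B) (hf : ∀ s : S, IsUnit (evenMap f s)) : A.loc S ⟶ B :=
  let inv (s : S) : B.Even := ((hf s).unit⁻¹ : B.Evenˣ)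
  have hinv (s : S) : evenMap f s * inv s = 1 := (hf s).mul_val_inv
  have hmul (s t : S) : inv (s * t) = inv s * inv t := by
    have h := hinv (s * t)
    rw [Submonoid.coe_mul, map_mul] at h
    linear_combination (-inv (s * t) * evenMap f t * inv t) * hinv s - inv (s * t) * hinv t
      + inv s * inv t * h
  have hF (a : A) (s : S) : locLiftFun f hf (frac a s) = inv s • f a := locLiftFun_frac f hf a s
  have h1 : inv 1 = 1 := by simpa using hinv 1
  homMk
    { toFun := locLiftFun f hf
      map_one' := by rw [← frac_one, hF, map_one, h1, one_smul]
      map_mul' := fun x y => by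
        obtain ⟨a, s, rfl⟩ := frac_surj x
        obtain ⟨b, t, rfl⟩ := frac_surj y
        rw [frac_mul_frac, hF, hF, hF, hmul, map_mul, smul_mul_smul_comm]
      map_zero' := by
        have : (0 : A.loc S) = frac 0 1 := (LocalizedModule.zero_mk 1).symm
        rw [this, hF, map_zero, smul_zero]
      map_add' := fun x y => by
        obtain ⟨a, s, rfl⟩ := frac_surj x
        obtain ⟨b, t, rfl⟩ := frac_surj y
        rw [frac_add_frac, hF, hF, hF, hmul, map_add, map_mul, map_mul]
        change (inv s * inv t) • (evenMap f t • f a + evenMap f s • f b) = _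
        rw [smul_add, smul_smul, smul_smul]
        congr 2
        · linear_combination inv s * hinv t
        · linear_combination inv t * hinv s
      commutes' := fun r => by
        rw [Algebra.algebraMap_eq_smul_one, ← frac_one, smul_frac, hF, h1, one_smul,
          ← Algebra.algebraMap_eq_smul_one]
        exact f.toGradedAlgHom.commutes r }
    (fun i x hx => by
      obtain ⟨a, ha, s, rfl⟩ := frac_surj_of_mem hx
      change locLiftFun f hf (frac a s) ∈ B.part i
      rw [hF]
      exact B.even_smul_mem _ (map_part f ha))

theorem locLift_frac (f : A ⟶ B) (hf : ∀ s : S, IsUnit (evenMap f s)) (a : A) (s : S) :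
    locLift f hf (frac a s) = ((hf s).unit⁻¹ : B.Evenˣ).1 • f a :=
  locLiftFun_frac f hf a s

theorem locLift_toLoc (f : A ⟶ B) (hf : ∀ s : S, IsUnit (evenMap f s)) :
    toLoc S ≫ locLift f hf = f := by
  refine hom_ext fun a => ?_
  change locLift f hf (frac a 1) = f a
  have h := (hf 1).val_inv_mul
  have h1 : evenMap f ((1 : S) : A.Even) = 1 := map_one (evenMap f)
  have h2 : ((hf 1).unit⁻¹ : B.Evenˣ).1 = 1 := by
    exact (mul_one _).symm.trans ((congrArg (_ * ·) h1.symm).trans h)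
  rw [locLift_frac, h2, one_smul]

theorem loc_hom_ext {f g : A.loc S ⟶ B} (h : toLoc S ≫ f = toLoc S ≫ g) : f = g := by
  refine hom_ext fun x => ?_
  obtain ⟨a, s, rfl⟩ := frac_surj x
  have hs (f : A.loc S ⟶ B) : f (frac (s : A) 1) * f (frac a s) = f (frac a 1) := by
    rw [← map_mul, frac_mul_frac, one_mul]
    congr 1
    rw [frac_eq_iff]
    exact ⟨1, by simp⟩
  have ha (b : A) : f (frac b 1) = g (frac b 1) := ConcreteCategory.congr_hom h b
  have hu : IsUnit (g (frac (s : A) 1)) :=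
    ((isUnit_toLoc s).map (evenMap g)).map B.evenSub.val
  refine hu.mul_left_cancel ?_
  rw [hs g, ← ha, hs f, ha]

end Localization

end SuperAlg

/-! ### Stalks of presheaves of superalgebras -/

namespace SuperStalk

variable {k : Type u} [CommRing k] {X : TopCat.{u}} (F : X.Presheaf (SuperAlg k)) (x : X)

/-- The stalk at `x` of a presheaf of superalgebras, as a ring. -/
abbrev R : RingCat.{u} := TopCat.Presheaf.stalk (F ⋙ SuperAlg.ringFunctor) x

/-- The germ at `x` of a section over `U`. -/
def germ (U : Opens X) (hx : x ∈ U) : F.obj (op U) →+* R F x :=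
  (TopCat.Presheaf.germ (F ⋙ SuperAlg.ringFunctor) U x hx).hom

variable {F x}

theorem exists_germ (s : R F x) : ∃ U, ∃ hx : x ∈ U, ∃ t, germ F x U hx t = s :=
  TopCat.Presheaf.exists_germ_eq (F ⋙ SuperAlg.ringFunctor) s

theorem germ_res {U V : Opens X} (i : U ⟶ V) (hx : x ∈ U) (t : F.obj (op V)) :
    germ F x U hx (F.map i.op t) = germ F x V (i.le hx) t :=
  TopCat.Presheaf.germ_res_apply (F ⋙ SuperAlg.ringFunctor) i x hx t

theorem germ_eq {U V : Opens X} (hU : x ∈ U) (hV : x ∈ V) (s : F.obj (op U)) (t : F.obj (op V))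
    (h : germ F x U hU s = germ F x V hV t) :
    ∃ (W : Opens X) (_ : x ∈ W) (iU : W ⟶ U) (iV : W ⟶ V), F.map iU.op s = F.map iV.op t :=
  TopCat.Presheaf.germ_eq (F ⋙ SuperAlg.ringFunctor) x hU hV s t h

variable (F x)

/-- The `k`-algebra structure on the stalk. -/
instance : Algebra k (R F x) :=
  RingHom.toAlgebra' ((germ F x ⊤ trivial).comp (algebraMap k (F.obj (op ⊤)))) (fun r s => by
    obtain ⟨U, hx, t, rfl⟩ := exists_germ s
    simp only [RingHom.comp_apply]
    rw [← germ_res (homOfLE le_top : U ⟶ ⊤) hx, ← map_mul, ← map_mul]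
    congr 1
    have : (F.map (homOfLE le_top : U ⟶ ⊤).op) (algebraMap k (F.obj (op ⊤)) r) =
      algebraMap k (F.obj (op U)) r := (F.map _).toGradedAlgHom.commutes r
    rw [this, Algebra.commutes])

theorem algebraMap_eq (U : Opens X) (hx : x ∈ U) (r : k) :
    algebraMap k (R F x) r = germ F x U hx (algebraMap k (F.obj (op U)) r) := by
  have : (F.map (homOfLE le_top : U ⟶ ⊤).op) (algebraMap k (F.obj (op ⊤)) r) =
      algebraMap k (F.obj (op U)) r := (F.map _).toGradedAlgHom.commutes r
  rw [← this, germ_res]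
  rfl

theorem germ_smul (U : Opens X) (hx : x ∈ U) (r : k) (t : F.obj (op U)) :
    germ F x U hx (r • t) = r • germ F x U hx t := by
  rw [Algebra.smul_def, Algebra.smul_def, map_mul, algebraMap_eq F x U hx]

/-- The germs of homogeneous sections of degree `i`. -/
def part (i : ZMod 2) : Submodule k (R F x) where
  carrier := {s | ∃ U, ∃ hx : x ∈ U, ∃ t ∈ (F.obj (op U)).part i, s = germ F x U hx t}
  zero_mem' := ⟨⊤, trivial, 0, zero_mem _, (map_zero _).symm⟩
  add_mem' := by
    rintro _ _ ⟨U, hU, s, hs, rfl⟩ ⟨V, hV, t, ht, rfl⟩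
    refine ⟨U ⊓ V, show x ∈ U ⊓ V from ⟨hU, hV⟩, F.map (U.infLELeft V).op s + F.map (U.infLERight V).op t,
      add_mem (SuperAlg.map_part _ hs) (SuperAlg.map_part _ ht), ?_⟩
    rw [map_add, germ_res, germ_res]
  smul_mem' := by
    rintro r _ ⟨U, hU, s, hs, rfl⟩
    exact ⟨U, hU, r • s, Submodule.smul_mem _ r hs, (germ_smul F x U hU r s).symm⟩

variable {F x} in
theorem part_mul {i j : ZMod 2} {a b : R F x} (ha : a ∈ part F x i) (hb : b ∈ part F x j) :
    ∃ W, ∃ hx : x ∈ W, ∃ s ∈ (F.obj (op W)).part i, ∃ t ∈ (F.obj (op W)).part j,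
      a = germ F x W hx s ∧ b = germ F x W hx t := by
  obtain ⟨U, hU, s, hs, rfl⟩ := ha
  obtain ⟨V, hV, t, ht, rfl⟩ := hb
  exact ⟨U ⊓ V, show x ∈ U ⊓ V from ⟨hU, hV⟩, F.map (U.infLELeft V).op s, SuperAlg.map_part _ hs,
    F.map (U.infLERight V).op t, SuperAlg.map_part _ ht, (germ_res _ _ _).symm,
    (germ_res _ _ _).symm⟩

end SuperStalk

open SuperStalk in
/-- The stalk at `x` of a presheaf of superalgebras: the stalk of the underlying presheaf of rings,
graded by the germs of homogeneous sections. -/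
def superStalk {k : Type u} [CommRing k] {X : TopCat.{u}} (F : X.Presheaf (SuperAlg k)) (x : X) :
    SuperAlg k :=
  SuperAlg.mk' (R F x) (part F x)
    ⟨⊤, trivial, 1, (F.obj (op ⊤)).evenSub.one_mem, (map_one _).symm⟩
    (by
      rintro i j a b ha hb
      obtain ⟨W, hx, s, hs, t, ht, rfl, rfl⟩ := part_mul ha hb
      exact ⟨W, hx, s * t, SetLike.mul_mem_graded hs ht, (map_mul _ _ _).symm⟩)
    (by
      constructor
      · rw [Submodule.disjoint_def]
        rintro a h0 h1
        obtain ⟨U, hU, s, hs, rfl⟩ := h0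
        obtain ⟨V, hV, t, ht, h⟩ := h1
        obtain ⟨W, hW, iU, iV, e⟩ := germ_eq hU hV s t h
        rw [← germ_res iU hW]
        have h0 : F.map iU.op s ∈ (F.obj (op W)).part 0 := SuperAlg.map_part _ hs
        have h1 : F.map iU.op s ∈ (F.obj (op W)).part 1 := e ▸ SuperAlg.map_part _ ht
        rw [← SuperAlg.proj_of_mem _ h0, SuperAlg.proj_of_mem_ne _ h1 (by decide), map_zero]
      · rw [codisjoint_iff, eq_top_iff]
        rintro a -
        obtain ⟨U, hx, t, rfl⟩ := exists_germ a
        refine Submodule.mem_sup.2 ⟨_, ⟨U, hx, _, SuperAlg.proj_mem _ 0 t, rfl⟩, _,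
          ⟨U, hx, _, SuperAlg.proj_mem _ 1 t, rfl⟩, ?_⟩
        rw [← map_add, SuperAlg.proj_add_proj])
    (by
      rintro i j a b ha hb
      obtain ⟨W, hx, s, hs, t, ht, rfl, rfl⟩ := part_mul ha hb
      rw [← map_mul, ← map_mul, SuperAlg.supercomm _ i j s t hs ht]
      simp only [map_mul, map_pow, map_neg, map_one])

namespace SuperStalk

variable {k : Type u} [CommRing k] {X : TopCat.{u}} (F : X.Presheaf (SuperAlg k)) (x : X)

/-- The stalk at `x` of the presheaf of even sections. -/
abbrev evenStalk : CommRingCat.{u} := TopCat.Presheaf.stalk (F ⋙ SuperAlg.evenFunctor) x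

/-- The germ at `x` of an even section, in the stalk of the presheaf of even sections. -/
def evenGerm (U : Opens X) (hx : x ∈ U) : (F.obj (op U)).Even →+* evenStalk F x :=
  (TopCat.Presheaf.germ (F ⋙ SuperAlg.evenFunctor) U x hx).hom

/-- The germ at `x` of an even section, in the even part of the stalk. -/
def germEven (U : Opens X) (hx : x ∈ U) : (F.obj (op U)).Even →+* (superStalk F x).Even where
  toFun s := ⟨germ F x U hx s.1, ⟨U, hx, s.1, s.2, rfl⟩⟩
  map_one' := Subtype.ext (map_one (germ F x U hx))
  map_zero' := Subtype.ext (map_zero (germ F x U hx))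
  map_mul' s t := Subtype.ext (map_mul (germ F x U hx) s.1 t.1)
  map_add' s t := Subtype.ext (map_add (germ F x U hx) s.1 t.1)

/-- The canonical map from the stalk of the even part to the even part of the stalk. -/
def evenStalkHom : evenStalk F x →+* (superStalk F x).Even :=
  (Limits.colimit.desc ((OpenNhds.inclusion x).op ⋙ F ⋙ SuperAlg.evenFunctor)
    { pt := CommRingCat.of (superStalk F x).Even
      ι :=
        { app := fun U => CommRingCat.ofHom (germEven F x U.unop.1 U.unop.2)
          naturality := fun U V i => by
            ext s
            exact Subtype.ext (germ_res _ V.unop.2 _) } }).hom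

theorem evenStalkHom_germ (U : Opens X) (hx : x ∈ U) (s : (F.obj (op U)).Even) :
    evenStalkHom F x (evenGerm F x U hx s) = germEven F x U hx s :=
  ConcreteCategory.congr_hom (Limits.colimit.ι_desc
    (F := (OpenNhds.inclusion x).op ⋙ F ⋙ SuperAlg.evenFunctor) _
      (op (⟨U, hx⟩ : OpenNhds x))) s

theorem exists_evenGerm (s : evenStalk F x) :
    ∃ U, ∃ hx : x ∈ U, ∃ t, evenGerm F x U hx t = s :=
  TopCat.Presheaf.exists_germ_eq (F ⋙ SuperAlg.evenFunctor) s

variable {F x} in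
theorem evenGerm_res {U V : Opens X} (i : U ⟶ V) (hx : x ∈ U) (t : (F.obj (op V)).Even) :
    evenGerm F x U hx (SuperAlg.evenMap (F.map i.op) t) = evenGerm F x V (i.le hx) t :=
  TopCat.Presheaf.germ_res_apply (F ⋙ SuperAlg.evenFunctor) i x hx t

theorem evenStalkHom_bijective : Function.Bijective (evenStalkHom F x) := by
  constructor
  · intro a b h
    obtain ⟨U, hU, s, rfl⟩ := exists_evenGerm F x a
    obtain ⟨V, hV, t, rfl⟩ := exists_evenGerm F x b
    rw [evenStalkHom_germ, evenStalkHom_germ] at h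
    obtain ⟨W, hW, iU, iV, e⟩ := germ_eq hU hV s.1 t.1 (congrArg Subtype.val h)
    rw [← evenGerm_res iU hW, ← evenGerm_res iV hW]
    exact congrArg _ (Subtype.ext e)
  · rintro ⟨_, U, hx, t, ht, rfl⟩
    exact ⟨evenGerm F x U hx ⟨t, ht⟩, evenStalkHom_germ F x U hx _⟩

theorem isLocal_superStalk_iff : (superStalk F x).IsLocal ↔ IsLocalRing (evenStalk F x) := by
  let e : evenStalk F x ≃+* (superStalk F x).Even :=
    RingEquiv.ofBijective (evenStalkHom F x) (evenStalkHom_bijective F x)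
  constructor
  · intro h
    have := h.isLocalRing_even
    exact e.symm.isLocalRing
  · intro h
    have := e.isLocalRing
    exact (superStalk F x).isLocal_of_even

end SuperStalk

/-! ### Superspaces -/

section

variable {k : Type u} [CommRing k] {X Y Z : PresheafedSpace.{u} (SuperAlg k)}

/-- The homomorphism of rings induced on stalks. -/
def stalkRingHom (f : X ⟶ Y) (x : X) :
    SuperStalk.R Y.presheaf (f.base x) →+* SuperStalk.R X.presheaf x :=
  ((SuperAlg.ringFunctor.mapPresheaf.map f).stalkMap x).hom

theorem stalkRingHom_germ (f : X ⟶ Y) (x : X) (U : Opens Y) (hx : f.base x ∈ U)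
    (t : Y.presheaf.obj (op U)) :
    stalkRingHom f x (SuperStalk.germ Y.presheaf (f.base x) U hx t) =
      SuperStalk.germ X.presheaf x ((Opens.map f.base).obj U) hx (f.c.app (op U) t) :=
  PresheafedSpace.stalkMap_germ_apply (SuperAlg.ringFunctor.mapPresheaf.map f) U x hx t

/-- The morphism induced on stalks by a morphism of spaces with presheaves of superalgebras. -/
def superStalkMap (f : X ⟶ Y) (x : X) :
    superStalk Y.presheaf (f.base x) ⟶ superStalk X.presheaf x :=
  SuperAlg.homMk
    { __ := stalkRingHom f x
      commutes' := fun r => by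
        refine (stalkRingHom_germ f x ⊤ trivial _).trans ?_
        refine Eq.trans ?_ (SuperStalk.algebraMap_eq X.presheaf x
          ((Opens.map f.base).obj ⊤) trivial r).symm
        exact congrArg _ ((f.c.app (op ⊤)).toGradedAlgHom.commutes r) }
    (by
      rintro i _ ⟨U, hx, t, ht, rfl⟩
      exact ⟨_, hx, _, SuperAlg.map_part _ ht, stalkRingHom_germ f x U hx t⟩)

theorem superStalkMap_germ (f : X ⟶ Y) (x : X) (U : Opens Y) (hx : f.base x ∈ U)
    (t : Y.presheaf.obj (op U)) :
    superStalkMap f x (SuperStalk.germ Y.presheaf (f.base x) U hx t) =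
      SuperStalk.germ X.presheaf x ((Opens.map f.base).obj U) hx (f.c.app (op U) t) :=
  stalkRingHom_germ f x U hx t

theorem superStalkMap_id (x : X) (a : superStalk X.presheaf x) :
    superStalkMap (𝟙 X) x a = a := by
  obtain ⟨U, hx, t, rfl⟩ := SuperStalk.exists_germ a
  exact superStalkMap_germ (𝟙 X) x U hx t

theorem superStalkMap_comp (f : X ⟶ Y) (g : Y ⟶ Z) (x : X)
    (a : superStalk Z.presheaf (g.base (f.base x))) :
    superStalkMap (f ≫ g) x a = superStalkMap f x (superStalkMap g (f.base x) a) := by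
  obtain ⟨U, hx, t, rfl⟩ := SuperStalk.exists_germ a
  refine (superStalkMap_germ (f ≫ g) x U hx t).trans (Eq.symm ?_)
  exact (congrArg _ (superStalkMap_germ g (f.base x) U hx t)).trans
    (superStalkMap_germ f x ((Opens.map g.base).obj U) hx _)

/-- The induced homomorphism on the stalks of the presheaves of even sections. -/
def evenStalkMap (f : X ⟶ Y) (x : X) :
    SuperStalk.evenStalk Y.presheaf (f.base x) →+* SuperStalk.evenStalk X.presheaf x :=
  ((SuperAlg.evenFunctor.mapPresheaf.map f).stalkMap x).hom

theorem evenStalkMap_germ (f : X ⟶ Y) (x : X) (U : Opens Y) (hx : f.base x ∈ U)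
    (t : (Y.presheaf.obj (op U)).Even) :
    evenStalkMap f x (SuperStalk.evenGerm Y.presheaf (f.base x) U hx t) =
      SuperStalk.evenGerm X.presheaf x ((Opens.map f.base).obj U) hx
        (SuperAlg.evenMap (f.c.app (op U)) t) :=
  PresheafedSpace.stalkMap_germ_apply (SuperAlg.evenFunctor.mapPresheaf.map f) U x hx t

theorem isLocalHom_evenMap_superStalkMap (f : X ⟶ Y) (x : X) (h : IsLocalHom (evenStalkMap f x)) :
    IsLocalHom (SuperAlg.evenMap (superStalkMap f x)) := by
  have comm (s : SuperStalk.evenStalk Y.presheaf (f.base x)) :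
      SuperAlg.evenMap (superStalkMap f x) (SuperStalk.evenStalkHom Y.presheaf (f.base x) s) =
        SuperStalk.evenStalkHom X.presheaf x (evenStalkMap f x s) := by
    obtain ⟨U, hx, t, rfl⟩ := SuperStalk.exists_evenGerm _ _ s
    refine (congrArg _ (SuperStalk.evenStalkHom_germ _ _ U hx t)).trans (Eq.symm ?_)
    refine (congrArg _ (evenStalkMap_germ f x U hx t)).trans ?_
    refine (SuperStalk.evenStalkHom_germ _ _ ((Opens.map f.base).obj U) hx _).trans ?_
    exact Subtype.ext (superStalkMap_germ f x U hx t.1).symm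
  refine ⟨fun a ha => ?_⟩
  obtain ⟨s, rfl⟩ := (SuperStalk.evenStalkHom_bijective Y.presheaf (f.base x)).2 a
  rw [comm] at ha
  let e := RingEquiv.ofBijective _ (SuperStalk.evenStalkHom_bijective X.presheaf x)
  have h1 : IsUnit (evenStalkMap f x s) := (MulEquiv.isUnit_map e).1 ha
  exact (h.map_nonunit s h1).map _

end

/-- A superspace over `k`: a topological space with a sheaf of superalgebras all of whose stalks
are local superalgebras. -/
structure SuperSpace (k : Type u) [CommRing k] extends PresheafedSpace.{u} (SuperAlg k) where
  isSheaf : TopCat.Presheaf.IsSheaf (presheaf ⋙ forget (SuperAlg k))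
  isLocal : ∀ x : carrier, (superStalk presheaf x).IsLocal

namespace SuperSpace

variable {k : Type u} [CommRing k]

instance : CoeSort (SuperSpace k) (Type u) := ⟨fun X => X.carrier⟩

/-- A morphism of superspaces: a continuous map with a morphism of sheaves of superalgebras, which
on stalks maps maximal homogeneous ideals into maximal homogeneous ideals. -/
@[ext]
structure Hom (X Y : SuperSpace k) extends
    PresheafedSpace.Hom X.toPresheafedSpace Y.toPresheafedSpace where
  map_maxIdeal : ∀ (x : X) (a : superStalk Y.presheaf (base x)),
    a ∈ (Y.isLocal (base x)).maxIdeal → superStalkMap toHom x a ∈ (X.isLocal x).maxIdeal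

instance : Category (SuperSpace k) where
  Hom := Hom
  id X := ⟨𝟙 X.toPresheafedSpace, fun x a ha => (superStalkMap_id x a).symm ▸ ha⟩
  comp {X Y Z} f g := ⟨(f.toHom ≫ g.toHom : X.toPresheafedSpace ⟶ Z.toPresheafedSpace),
    fun x a ha => (superStalkMap_comp f.toHom g.toHom x a).symm ▸
      f.map_maxIdeal x _ (g.map_maxIdeal (f.base x) a ha)⟩

/-- A morphism of the underlying spaces which is local on the stalks of the even parts is a
morphism of superspaces. -/
def homOfEven {X Y : SuperSpace k} (f : X.toPresheafedSpace ⟶ Y.toPresheafedSpace)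
    (hf : ∀ x, IsLocalHom (evenStalkMap f x)) : X ⟶ Y :=
  ⟨f, fun x _ ha => SuperAlg.map_maxIdeal (superStalkMap f x) (Y.isLocal _) (X.isLocal x)
    (isLocalHom_evenMap_superStalkMap f x (hf x)) ha⟩

/-- The open subspace `(U, 𝒪_X|_U)`. -/
def restrict (X : SuperSpace k) (U : Opens X) : SuperSpace k where
  toPresheafedSpace := X.toPresheafedSpace.restrict U.isOpenEmbedding
  isSheaf := TopCat.Presheaf.isSheaf_of_isOpenEmbedding U.isOpenEmbedding X.isSheaf
  isLocal x := by
    rw [SuperStalk.isLocal_superStalk_iff]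
    have : IsLocalRing ((SuperAlg.evenFunctor.mapPresheaf.obj X.toPresheafedSpace).presheaf.stalk
        (U.inclusion' x)) := (SuperStalk.isLocal_superStalk_iff _ _).1 (X.isLocal x.1)
    exact ((SuperAlg.evenFunctor.mapPresheaf.obj X.toPresheafedSpace).restrictStalkIso
      U.isOpenEmbedding x).symm.commRingCatIsoToRingEquiv.isLocalRing

/-- The inclusion of an open subspace. -/
def ι (X : SuperSpace k) (U : Opens X) : X.restrict U ⟶ X :=
  homOfEven (X.toPresheafedSpace.ofRestrict U.isOpenEmbedding) (fun x => by
    have : IsIso (((SuperAlg.evenFunctor.mapPresheaf.obj X.toPresheafedSpace).ofRestrict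
      U.isOpenEmbedding).stalkMap x) := PresheafedSpace.ofRestrict_stalkMap_isIso _ _ _
    exact isLocalHom_of_isIso (((SuperAlg.evenFunctor.mapPresheaf.obj
      X.toPresheafedSpace).ofRestrict U.isOpenEmbedding).stalkMap x))

/-! ### Superschemes -/

variable (X : SuperSpace k)

theorem isSheaf_part (i : ZMod 2) {I : Type u} (U : I → Opens X)
    (s : ∀ a, X.presheaf.obj (op (U a))) (hs : ∀ a, s a ∈ (X.presheaf.obj (op (U a))).part i)
    (hc : ∀ a b, X.presheaf.map (Opens.infLELeft (U a) (U b)).op (s a) =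
      X.presheaf.map (Opens.infLERight (U a) (U b)).op (s b)) :
    ∃! t : X.presheaf.obj (op (iSup U)), t ∈ (X.presheaf.obj (op (iSup U))).part i ∧
      ∀ a, X.presheaf.map (Opens.leSupr U a).op t = s a := by
  obtain ⟨t, ht, hu⟩ := X.isSheaf.isSheafUniqueGluing_types (U := U) s hc
  refine ⟨t, ⟨?_, ht⟩, fun t' ht' => hu t' ht'.2⟩
  have : (X.presheaf.obj (op (iSup U))).proj i t = t := by
    apply hu
    intro a
    refine (SuperAlg.map_proj (X.presheaf.map (Opens.leSupr U a).op) i t).trans ?_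
    have e : X.presheaf.map (Opens.leSupr U a).op t = s a := ht a
    rw [e, SuperAlg.proj_of_mem _ (hs a)]
  rw [← this]
  exact SuperAlg.proj_mem _ i t

theorem isSheaf_even : TopCat.Presheaf.IsSheaf (X.presheaf ⋙ SuperAlg.evenFunctor) := by
  rw [TopCat.Presheaf.isSheaf_iff_isSheafUniqueGluing]
  intro I U s hs
  obtain ⟨t, ht, hu⟩ := X.isSheaf_part 0 U (fun a => (s a).1) (fun a => (s a).2)
    (fun a b => congrArg Subtype.val (hs a b))
  exact ⟨⟨t, ht.1⟩, fun a => Subtype.ext (ht.2 a), fun t' ht' =>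
    Subtype.ext (hu _ ⟨t'.2, fun a => congrArg Subtype.val (ht' a)⟩)⟩

theorem isSheaf_odd : TopCat.Presheaf.IsSheaf (X.presheaf ⋙ SuperAlg.oddFunctor) := by
  rw [TopCat.Presheaf.isSheaf_iff_isSheafUniqueGluing]
  intro I U s hs
  obtain ⟨t, ht, hu⟩ := X.isSheaf_part 1 U (fun a => (s a).1) (fun a => (s a).2)
    (fun a b => congrArg Subtype.val (hs a b))
  exact ⟨⟨t, ht.1⟩, fun a => Subtype.ext (ht.2 a), fun t' ht' =>
    Subtype.ext (hu _ ⟨t'.2, fun a => congrArg Subtype.val (ht' a)⟩)⟩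

/-- The locally ringed space `(|X|, 𝒪_{X,0})`. -/
def even : LocallyRingedSpace.{u} where
  toPresheafedSpace := SuperAlg.evenFunctor.mapPresheaf.obj X.toPresheafedSpace
  IsSheaf := X.isSheaf_even
  isLocalRing x := (SuperStalk.isLocal_superStalk_iff _ _).1 (X.isLocal x)

/-- `(|X|, 𝒪_{X,0})` is an ordinary scheme. -/
def EvenIsScheme : Prop :=
  ∀ x : X.even, ∃ (U : OpenNhds x) (R : CommRingCat.{u}),
    Nonempty (X.even.restrict U.isOpenEmbedding ≅ Spec.toLocallyRingedSpace.obj (op R))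

variable {X} in
/-- The scheme `(|X|, 𝒪_{X,0})`. -/
def evenScheme (h : X.EvenIsScheme) : Scheme.{u} where
  toLocallyRingedSpace := X.even
  local_affine := h

variable {X} in
/-- The presheaf `𝒪_{X,1}` of abelian groups. -/
def oddPresheaf (h : X.EvenIsScheme) : (Opens (evenScheme h))ᵒᵖ ⥤ Ab.{u} :=
  X.presheaf ⋙ SuperAlg.oddFunctor

instance (h : X.EvenIsScheme) (U : (Opens (evenScheme h))ᵒᵖ) :
    Module ((evenScheme h).ringCatSheaf.obj.obj U) ((oddPresheaf h).obj U) :=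
  inferInstanceAs (Module (X.presheaf.obj U).Even ((X.presheaf.obj U).part 1))

variable {X} in
/-- The sheaf `𝒪_{X,1}` of `𝒪_{X,0}`-modules. -/
def oddModules (h : X.EvenIsScheme) : (evenScheme h).Modules where
  val := PresheafOfModules.ofPresheaf (R := (evenScheme h).ringCatSheaf.obj) (oddPresheaf h)
    (fun U _ f r m => Subtype.ext
      (map_mul (X.presheaf.map f).toGradedAlgHom (Subtype.val (p := (· ∈ (X.presheaf.obj U).evenSub)) r) (Subtype.val (p := (· ∈ (X.presheaf.obj U).part 1)) m)))
  isSheaf := X.isSheaf_odd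

end SuperSpace

/-- A superscheme: a superspace `X` such that `(|X|, 𝒪_{X,0})` is a scheme and `𝒪_{X,1}` is a
quasi-coherent sheaf of `𝒪_{X,0}`-modules. -/
structure SuperScheme (k : Type u) [CommRing k] extends SuperSpace k where
  evenIsScheme : toSuperSpace.EvenIsScheme
  quasicoherent : (SuperSpace.oddModules evenIsScheme).IsQuasicoherent

/-! ### The spectrum of a superalgebra -/

namespace SuperAlg

variable {k : Type u} [CommRing k] (A : SuperAlg k)

/-- The multiplicative set `A₀ \ 𝔭`. -/
abbrev compl (p : PrimeSpectrum A.Even) : Submonoid A.Even := p.asIdeal.primeCompl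

/-- The localization `A_𝔭` at a prime `𝔭` of `A₀`. -/
abbrev atPrime (p : PrimeSpectrum A.Even) : SuperAlg k := A.loc (A.compl p)

theorem frac_congr {S : Submonoid A.Even} {a b : A} {s t : S} (h : (t : A) * a = (s : A) * b) :
    frac a s = frac b t :=
  frac_eq_iff.2 ⟨1, by rw [h]⟩

variable {A} in
theorem isUnit_frac_iff {p : PrimeSpectrum A.Even} (a : A.Even) (s : A.compl p) :
    IsUnit (⟨frac (a : A) s, A.frac_mem a.2 s⟩ : (A.atPrime p).Even) ↔ a ∉ p.asIdeal := by
  constructor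
  · intro h ha
    obtain ⟨⟨x, hx⟩, h⟩ := isUnit_iff_exists_inv.1 h
    obtain ⟨b, hb, t, rfl⟩ := frac_surj_of_mem hx
    have h1 : frac (a : A) s * frac b t = frac (1 : A) (1 : A.compl p) :=
      (congrArg Subtype.val h).trans frac_one.symm
    rw [frac_mul_frac, frac_eq_iff] at h1
    obtain ⟨v, hv⟩ := h1
    have hv' : v.1 * (a * ⟨b, hb⟩) = v.1 * (s.1 * t.1) := Subtype.ext (by simpa using hv)
    have : v.1 * (s.1 * t.1) ∈ p.asIdeal :=
      hv' ▸ Ideal.mul_mem_left _ _ (Ideal.mul_mem_right _ _ ha)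
    exact (v * (s * t)).2 this
  · intro ha
    refine IsUnit.of_mul_eq_one ⟨frac (s : A) ⟨a, ha⟩, A.frac_mem s.1.2 _⟩ (Subtype.ext ?_)
    change frac (a : A) s * frac (s : A) ⟨a, ha⟩ = 1
    rw [frac_mul_frac, ← frac_one]
    refine A.frac_congr ?_
    simpa using A.even_mul_comm a.2

theorem isLocalRing_atPrime (p : PrimeSpectrum A.Even) : IsLocalRing (A.atPrime p).Even := by
  have : Nontrivial (A.atPrime p).Even := by
    refine ⟨0, 1, fun h => ?_⟩
    have h1 := isUnit_frac_iff (p := p) (0 : A.Even) 1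
    have h2 : (⟨frac ((0 : A.Even) : A) 1, A.frac_mem (0 : A.Even).2 1⟩ : (A.atPrime p).Even) = 0 :=
      Subtype.ext (LocalizedModule.zero_mk 1)
    rw [h2, h] at h1
    exact h1.1 isUnit_one (zero_mem _)
  refine IsLocalRing.of_nonunits_add ?_
  rintro ⟨x, hx⟩ ⟨y, hy⟩ h1 h2
  obtain ⟨a, ha, s, rfl⟩ := frac_surj_of_mem hx
  obtain ⟨b, hb, t, rfl⟩ := frac_surj_of_mem hy
  have h1' := (isUnit_frac_iff ⟨a, ha⟩ s).not_left.1 h1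
  have h2' := (isUnit_frac_iff ⟨b, hb⟩ t).not_left.1 h2
  have e : (⟨frac a s, hx⟩ + ⟨frac b t, hy⟩ : (A.atPrime p).Even) =
      ⟨frac ((t.1 * ⟨a, ha⟩ + s.1 * ⟨b, hb⟩ : A.Even) : A) (s * t), A.frac_mem (Subtype.prop _) _⟩ :=
    Subtype.ext (frac_add_frac a b s t)
  rw [e, mem_nonunits_iff, isUnit_frac_iff, not_not]
  exact add_mem (Ideal.mul_mem_left _ _ h1') (Ideal.mul_mem_left _ _ h2')

/-- The functions `𝔭 ↦ s 𝔭 ∈ A_𝔭` on `U` which are locally fractions `a / f` with `a ∈ A`,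
`f ∈ A₀`. -/
def IsLocallyFrac {U : Opens (PrimeSpectrum.Top A.Even)} (s : ∀ p : U, A.atPrime p.1) : Prop :=
  ∀ p : U, ∃ V : Opens (PrimeSpectrum.Top A.Even), p.1 ∈ V ∧ ∃ h : V ≤ U, ∃ (a : A) (f : A.Even),
    ∀ q : V, ∃ hf : f ∈ A.compl q.1, s ⟨q.1, h q.2⟩ = frac a ⟨f, hf⟩

/-- The sections of the structure sheaf over `U`. -/
def sections (U : Opens (PrimeSpectrum.Top A.Even)) : Subalgebra k (∀ p : U, A.atPrime p.1) where
  carrier := {s | A.IsLocallyFrac s}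
  mul_mem' {s t} hs ht x := by
    obtain ⟨V, mV, iV, a, f, hV⟩ := hs x
    obtain ⟨W, mW, iW, b, g, hW⟩ := ht x
    refine ⟨V ⊓ W, ⟨mV, mW⟩, inf_le_left.trans iV, a * b, f * g, fun y => ?_⟩
    obtain ⟨hf, e⟩ := hV ⟨y.1, y.2.1⟩
    obtain ⟨hg, e'⟩ := hW ⟨y.1, y.2.2⟩
    exact ⟨mul_mem hf hg, (congrArg₂ (· * ·) e e').trans (frac_mul_frac a b ⟨f, hf⟩ ⟨g, hg⟩)⟩
  add_mem' {s t} hs ht x := by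
    obtain ⟨V, mV, iV, a, f, hV⟩ := hs x
    obtain ⟨W, mW, iW, b, g, hW⟩ := ht x
    refine ⟨V ⊓ W, ⟨mV, mW⟩, inf_le_left.trans iV, g * a + f * b, f * g, fun y => ?_⟩
    obtain ⟨hf, e⟩ := hV ⟨y.1, y.2.1⟩
    obtain ⟨hg, e'⟩ := hW ⟨y.1, y.2.2⟩
    exact ⟨mul_mem hf hg, (congrArg₂ (· + ·) e e').trans (frac_add_frac a b ⟨f, hf⟩ ⟨g, hg⟩)⟩
  algebraMap_mem' r x := ⟨U, x.2, le_rfl, algebraMap k A r, 1, fun y => ⟨one_mem _,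
    ((toLoc (A.compl y.1)).toGradedAlgHom.commutes r).symm⟩⟩

theorem proj_frac {S : Submonoid A.Even} (i : ZMod 2) (a : A) (s : S) :
    (A.loc S).proj i (frac a s) = frac (A.proj i a) s := by
  have h (j : ZMod 2) (c : A) (hc : c ∈ A.part j) :
      (A.loc S).proj i (frac c s) = frac (A.proj i c) s := by
    by_cases hj : j = i
    · subst hj
      rw [A.proj_of_mem hc, proj_of_mem _ (A.frac_mem hc s)]
    · rw [A.proj_of_mem_ne hc hj, proj_of_mem_ne _ (A.frac_mem hc s) hj]
      exact (LocalizedModule.zero_mk s).symm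
  have e (b c : A) : frac (b + c) s = frac b s + frac c s := by
    rw [frac_add_frac, frac_eq_iff]
    exact ⟨1, by simp [mul_add, mul_assoc]⟩
  conv_lhs => rw [← A.proj_add_proj a, e, map_add, h 0 _ (A.proj_mem 0 a), h 1 _ (A.proj_mem 1 a)]
  conv_rhs => rw [← A.proj_add_proj a, map_add, e]

/-- The sections of the structure sheaf with values in the homogeneous parts of degree `i`. -/
def sectionsPart (U : Opens (PrimeSpectrum.Top A.Even)) (i : ZMod 2) :
    Submodule k (A.sections U) where
  carrier := {s | ∀ p : U, s.1 p ∈ (A.atPrime p.1).part i}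
  zero_mem' _ := zero_mem _
  add_mem' hs ht p := add_mem (hs p) (ht p)
  smul_mem' r _ hs p := Submodule.smul_mem _ r (hs p)

/-- The homogeneous component of degree `i` of a section. -/
def sectionsProj {U : Opens (PrimeSpectrum.Top A.Even)} (i : ZMod 2) (s : A.sections U) :
    A.sections U :=
  ⟨fun p => (A.atPrime p.1).proj i (s.1 p), fun x => by
    obtain ⟨V, mV, iV, a, f, hV⟩ := s.2 x
    refine ⟨V, mV, iV, A.proj i a, f, fun y => ?_⟩
    obtain ⟨hf, e⟩ := hV y
    exact ⟨hf, (congrArg _ e).trans (A.proj_frac i a ⟨f, hf⟩)⟩⟩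

/-- The superalgebra of sections of the structure sheaf over `U`. -/
def sectionsAlg (U : Opens (PrimeSpectrum.Top A.Even)) : SuperAlg k :=
  mk' (A.sections U) (A.sectionsPart U)
    (fun p => (A.atPrime p.1).evenSub.one_mem)
    (fun i j a b ha hb p => SetLike.mul_mem_graded (ha p) (hb p))
    (by
      constructor
      · rw [Submodule.disjoint_def]
        intro s h0 h1
        refine Subtype.ext (funext fun p => ?_)
        exact ((proj_of_mem _ (h0 p)).symm.trans (proj_of_mem_ne _ (h1 p) (by decide)))
      · rw [codisjoint_iff, eq_top_iff]
        rintro s -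
        exact Submodule.mem_sup.2 ⟨A.sectionsProj 0 s, fun p => proj_mem _ 0 _,
          A.sectionsProj 1 s, fun p => proj_mem _ 1 _,
          Subtype.ext (funext fun p => proj_add_proj (A.atPrime p.1) (s.1 p))⟩)
    (fun i j a b ha hb => Subtype.ext (funext fun p => by
      refine ((A.atPrime p.1).supercomm i j _ _ (ha p) (hb p)).trans ?_
      simp))

/-- The restriction of sections of the structure sheaf. -/
def sectionsRes {U V : Opens (PrimeSpectrum.Top A.Even)} (h : V ≤ U) :
    A.sections U →ₐ[k] A.sections V where
  toFun s := ⟨fun p => s.1 ⟨p.1, h p.2⟩, fun x => by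
    obtain ⟨W, mW, iW, a, f, hW⟩ := s.2 ⟨x.1, h x.2⟩
    exact ⟨W ⊓ V, ⟨mW, x.2⟩, inf_le_right, a, f, fun y => hW ⟨y.1, y.2.1⟩⟩⟩
  map_one' := rfl
  map_mul' _ _ := rfl
  map_zero' := rfl
  map_add' _ _ := rfl
  commutes' _ := rfl

/-- The structure sheaf of the spectrum, as a presheaf. -/
def structurePresheaf : (PrimeSpectrum.Top A.Even).Presheaf (SuperAlg k) where
  obj U := A.sectionsAlg U.unop
  map i := homMk (A := A.sectionsAlg _) (B := A.sectionsAlg _) (A.sectionsRes i.unop.le)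
    (fun _ _ hs p => hs ⟨p.1, i.unop.le p.2⟩)

/-- The structure presheaf is the one that Mathlib attaches to the `A₀`-module `A`. -/
def structurePresheafIso : A.structurePresheaf ⋙ forget (SuperAlg k) ≅
    (structureSheafInType A.Even A).obj :=
  NatIso.ofComponents (fun U => Equiv.toIso
    { toFun := fun s => ⟨s.1, fun x => by
        obtain ⟨V, mV, iV, a, f, hV⟩ := s.2 x
        exact ⟨V, mV, homOfLE iV, a, f, hV⟩⟩
      invFun := fun s => ⟨s.1, fun x => by
        obtain ⟨V, mV, iV, a, f, hV⟩ := s.2 x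
        exact ⟨V, mV, iV.le, a, f, hV⟩⟩
      left_inv := fun _ => rfl
      right_inv := fun _ => rfl }) (fun _ => rfl)

theorem isSheaf_structurePresheaf :
    TopCat.Presheaf.IsSheaf (A.structurePresheaf ⋙ forget (SuperAlg k)) :=
  TopCat.Presheaf.isSheaf_of_iso A.structurePresheafIso.symm (structureSheafInType A.Even A).property

end SuperAlg

namespace SuperAlg

variable {k : Type u} [CommRing k] (A : SuperAlg k)

theorem even_section_eq {U : Opens (PrimeSpectrum.Top A.Even)} (s : A.sections U)
    (hs : s ∈ A.sectionsPart U 0) (p : U) :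
    ∃ V : Opens (PrimeSpectrum.Top A.Even), p.1 ∈ V ∧ ∃ h : V ≤ U, ∃ a f : A.Even,
      ∀ q : V, ∃ hf : f ∈ A.compl q.1, s.1 ⟨q.1, h q.2⟩ = frac (a : A) ⟨f, hf⟩ := by
  obtain ⟨V, mV, iV, a, f, hV⟩ := s.2 p
  refine ⟨V, mV, iV, A.evenPart a, f, fun q => ?_⟩
  obtain ⟨hf, e⟩ := hV q
  refine ⟨hf, (proj_of_mem _ (hs ⟨q.1, iV q.2⟩)).symm.trans ?_⟩
  exact (congrArg _ e).trans (A.proj_frac 0 a ⟨f, hf⟩)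

/-- The value at `p` of an even section. -/
def evenEval {U : Opens (PrimeSpectrum.Top A.Even)} (p : PrimeSpectrum A.Even) (hp : p ∈ U) :
    (A.sectionsAlg U).Even →+* (A.atPrime p).Even where
  toFun s := ⟨s.1.1 ⟨p, hp⟩, s.2 ⟨p, hp⟩⟩
  map_one' := rfl
  map_zero' := rfl
  map_mul' _ _ := rfl
  map_add' _ _ := rfl

theorem exists_inv_section {U : Opens (PrimeSpectrum.Top A.Even)} (p : PrimeSpectrum A.Even)
    (hp : p ∈ U) (s : (A.sectionsAlg U).Even) (hs : IsUnit (A.evenEval p hp s)) :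
    ∃ (V : Opens (PrimeSpectrum.Top A.Even)) (_ : p ∈ V) (i : V ⟶ U),
      IsUnit (evenMap (A.structurePresheaf.map i.op) s) := by
  obtain ⟨V, mV, iV, a, f, hV⟩ := A.even_section_eq s.1 s.2 ⟨p, hp⟩
  obtain ⟨hf, e⟩ := hV ⟨p, mV⟩
  have ha : a ∉ p.asIdeal := by
    have e' : A.evenEval p hp s = ⟨frac (a : A) ⟨f, hf⟩, A.frac_mem a.2 _⟩ := Subtype.ext e
    exact (isUnit_frac_iff a ⟨f, hf⟩).1 (e' ▸ hs)
  let W : Opens (PrimeSpectrum.Top A.Even) := V ⊓ PrimeSpectrum.basicOpen a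
  let t : A.sections W := ⟨fun q => frac (f : A) (⟨a, q.2.2⟩ : A.compl q.1), fun q =>
    ⟨W, q.2, le_rfl, f, a, fun q => ⟨q.2.2, rfl⟩⟩⟩
  have ht : t ∈ A.sectionsPart W 0 := fun q => A.frac_mem f.2 _
  refine ⟨W, ⟨mV, ha⟩, homOfLE (inf_le_left.trans iV), IsUnit.of_mul_eq_one
    (⟨t, ht⟩ : (A.sectionsAlg W).Even) (Subtype.ext (Subtype.ext (funext fun q => ?_)))⟩
  obtain ⟨hf, e⟩ := hV ⟨q.1, q.2.1⟩
  have h : frac (a : A) (⟨f, hf⟩ : A.compl q.1) * frac (f : A) (⟨a, q.2.2⟩ : A.compl q.1) = 1 := by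
    rw [frac_mul_frac, ← frac_one]
    refine A.frac_congr ?_
    simpa using A.even_mul_comm a.2
  exact (congrArg (· * _) e).trans h

/-- The value at `p` of a germ of an even section. -/
def evenStalkEval (p : PrimeSpectrum.Top A.Even) :
    SuperStalk.evenStalk A.structurePresheaf p →+* (A.atPrime p).Even :=
  (Limits.colimit.desc ((OpenNhds.inclusion p).op ⋙ A.structurePresheaf ⋙ evenFunctor)
    { pt := CommRingCat.of (A.atPrime p).Even
      ι :=
        { app := fun U => CommRingCat.ofHom (A.evenEval p U.unop.2)
          naturality := fun _ _ _ => rfl } }).hom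

theorem evenStalkEval_germ (p : PrimeSpectrum.Top A.Even) (U : Opens (PrimeSpectrum.Top A.Even))
    (hp : p ∈ U) (s : (A.sectionsAlg U).Even) :
    A.evenStalkEval p (SuperStalk.evenGerm A.structurePresheaf p U hp s) = A.evenEval p hp s :=
  ConcreteCategory.congr_hom (Limits.colimit.ι_desc
    (F := (OpenNhds.inclusion p).op ⋙ A.structurePresheaf ⋙ SuperAlg.evenFunctor) _
      (op (⟨U, hp⟩ : OpenNhds p))) s

theorem isLocalHom_evenStalkEval (p : PrimeSpectrum.Top A.Even) :
    IsLocalHom (A.evenStalkEval p) := by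
  refine ⟨fun a ha => ?_⟩
  obtain ⟨U, hp, s, rfl⟩ := SuperStalk.exists_evenGerm _ _ a
  obtain ⟨V, hV, i, hu⟩ := A.exists_inv_section p hp s (A.evenStalkEval_germ p U hp s ▸ ha)
  rw [← SuperStalk.evenGerm_res i hV]
  exact hu.map (SuperStalk.evenGerm A.structurePresheaf p V hV)

/-- The spectrum of a superalgebra `A`: the space of prime ideals of `A₀`, with the sheaf of
superalgebras whose sections are the functions `𝔭 ↦ s 𝔭 ∈ A_𝔭` that are locally fractions. -/
def spec : SuperSpace k where
  carrier := PrimeSpectrum.Top A.Even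
  presheaf := A.structurePresheaf
  isSheaf := A.isSheaf_structurePresheaf
  isLocal p := by
    rw [SuperStalk.isLocal_superStalk_iff]
    have := A.isLocalHom_evenStalkEval p
    have : IsLocalRing (A.atPrime p).Even := A.isLocalRing_atPrime p
    exact (A.evenStalkEval p).domain_isLocalRing

variable {A} {B C : SuperAlg k}

/-- The continuous map `Spec B₀ → Spec A₀` induced by `φ : A ⟶ B`. -/
def specBase (φ : A ⟶ B) : PrimeSpectrum.Top B.Even ⟶ PrimeSpectrum.Top A.Even :=
  TopCat.ofHom ⟨PrimeSpectrum.comap (evenMap φ), PrimeSpectrum.continuous_comap (evenMap φ)⟩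

/-- The morphism `A_{φ⁻¹ 𝔮} ⟶ B_𝔮` induced by `φ : A ⟶ B`. -/
def atPrimeMap (φ : A ⟶ B) (q : PrimeSpectrum B.Even) :
    A.atPrime (PrimeSpectrum.comap (evenMap φ) q) ⟶ B.atPrime q :=
  locLift (φ ≫ toLoc (B.compl q)) (fun s => isUnit_toLoc (⟨evenMap φ s, s.2⟩ : B.compl q))

theorem atPrimeMap_frac (φ : A ⟶ B) (q : PrimeSpectrum B.Even) (a : A)
    (s : A.compl (PrimeSpectrum.comap (evenMap φ) q)) :
    atPrimeMap φ q (frac a s) = frac (φ a) (⟨evenMap φ s, s.2⟩ : B.compl q) := by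
  have hu : IsUnit (evenMap (φ ≫ toLoc (B.compl q)) s) :=
    isUnit_toLoc (⟨evenMap φ s, s.2⟩ : B.compl q)
  refine (locLift_frac _ _ a s).trans ?_
  have h : ((hu.unit⁻¹ : (B.atPrime q).Evenˣ).1 : B.atPrime q) =
      frac (1 : B) (⟨evenMap φ s, s.2⟩ : B.compl q) := by
    have h1 : (frac (φ (s : A)) (1 : B.compl q)) * ((hu.unit⁻¹ : (B.atPrime q).Evenˣ).1 : B.atPrime q)
      = 1 := congrArg Subtype.val hu.mul_val_inv
    have h2 : frac (1 : B) (⟨evenMap φ s, s.2⟩ : B.compl q) * frac (φ (s : A)) (1 : B.compl q) = 1 := by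
      rw [frac_mul_frac, one_mul, mul_one]
      exact frac_self (⟨evenMap φ s, s.2⟩ : B.compl q)
    rw [← one_mul ((hu.unit⁻¹ : (B.atPrime q).Evenˣ).1 : B.atPrime q), ← h2, mul_assoc, h1, mul_one]
  refine (congrArg (· * _) h).trans ?_
  refine (frac_mul_frac 1 (φ a) _ 1).trans ?_
  rw [one_mul, mul_one]

theorem isLocalHom_atPrimeMap (φ : A ⟶ B) (q : PrimeSpectrum B.Even) :
    IsLocalHom (evenMap (atPrimeMap φ q)) := by
  refine ⟨fun x hx => ?_⟩
  obtain ⟨x, h⟩ := x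
  obtain ⟨a, ha, s, rfl⟩ := frac_surj_of_mem h
  have e : evenMap (atPrimeMap φ q) ⟨frac a s, h⟩ =
      ⟨frac (evenMap φ ⟨a, ha⟩ : B) ⟨evenMap φ s, s.2⟩, B.frac_mem (Subtype.prop _) _⟩ :=
    Subtype.ext (atPrimeMap_frac φ q a s)
  rw [e, isUnit_frac_iff] at hx
  exact (isUnit_frac_iff ⟨a, ha⟩ s).2 hx

/-- The map on sections of the structure sheaves induced by `φ : A ⟶ B`. -/
def sectionsMap (φ : A ⟶ B) (U : Opens (PrimeSpectrum.Top A.Even)) :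
    A.sections U →ₐ[k] B.sections ((Opens.map (specBase φ)).obj U) where
  toFun s := ⟨fun q => atPrimeMap φ q.1 (s.1 ⟨specBase φ q.1, q.2⟩), fun x => by
    obtain ⟨V, mV, iV, a, f, hV⟩ := s.2 ⟨specBase φ x.1, x.2⟩
    refine ⟨(Opens.map (specBase φ)).obj V, mV, fun _ h => iV h, φ a, evenMap φ f, fun q => ?_⟩
    obtain ⟨hf, e⟩ := hV ⟨specBase φ q.1, q.2⟩
    exact ⟨hf, (congrArg _ e).trans (atPrimeMap_frac φ q.1 a ⟨f, hf⟩)⟩⟩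
  map_one' := Subtype.ext (funext fun q => map_one (atPrimeMap φ q.1).toGradedAlgHom)
  map_mul' _ _ := Subtype.ext (funext fun q => map_mul (atPrimeMap φ q.1).toGradedAlgHom _ _)
  map_zero' := Subtype.ext (funext fun q => map_zero (atPrimeMap φ q.1).toGradedAlgHom)
  map_add' _ _ := Subtype.ext (funext fun q => map_add (atPrimeMap φ q.1).toGradedAlgHom _ _)
  commutes' r := Subtype.ext (funext fun q => (atPrimeMap φ q.1).toGradedAlgHom.commutes r)

/-- The morphism of spaces with presheaves of superalgebras induced by `φ : A ⟶ B`. -/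
def specMapAux (φ : A ⟶ B) : B.spec.toPresheafedSpace ⟶ A.spec.toPresheafedSpace where
  base := specBase φ
  c :=
    { app := fun U => homMk (A := A.sectionsAlg _) (B := B.sectionsAlg _) (sectionsMap φ U.unop)
        (fun _ _ hs q => map_part (atPrimeMap φ q.1) (hs ⟨specBase φ q.1, q.2⟩))
      naturality := fun _ _ _ => rfl }

/-- The morphism `Spec B ⟶ Spec A` induced by `φ : A ⟶ B`. -/
def specMap (φ : A ⟶ B) : B.spec ⟶ A.spec :=
  SuperSpace.homOfEven (specMapAux φ) (fun q => by
    have comm (x : SuperStalk.evenStalk A.structurePresheaf (specBase φ q)) :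
        B.evenStalkEval q (evenStalkMap (specMapAux φ) q x) =
          evenMap (atPrimeMap φ q) (A.evenStalkEval (specBase φ q) x) := by
      obtain ⟨U, hx, t, rfl⟩ := SuperStalk.exists_evenGerm _ _ x
      refine (congrArg _ (evenStalkMap_germ (specMapAux φ) q U hx t)).trans ?_
      refine (B.evenStalkEval_germ q ((Opens.map (specBase φ)).obj U) hx _).trans (Eq.symm ?_)
      exact (congrArg _ (A.evenStalkEval_germ (specBase φ q) U hx t)).trans rfl
    refine ⟨fun x hx => ?_⟩
    have h := hx.map (B.evenStalkEval q)
    exact (A.isLocalHom_evenStalkEval _).map_nonunit _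
      ((isLocalHom_atPrimeMap φ q).map_nonunit _ ((congrArg IsUnit (comm x)).mp h)))

theorem specHom_ext {X : SuperSpace k} {f g : X ⟶ A.spec} (h : f.toHom = g.toHom) : f = g := by
  obtain ⟨f, hf⟩ : SuperSpace.Hom X A.spec := f
  obtain ⟨g, hg⟩ : SuperSpace.Hom X A.spec := g
  obtain rfl : f = g := h
  rfl

theorem atPrimeMap_id (q : PrimeSpectrum A.Even) (x : A.atPrime q) :
    atPrimeMap (𝟙 A) q x = x := by
  obtain ⟨a, s, rfl⟩ := frac_surj x
  exact atPrimeMap_frac (𝟙 A) q a s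

theorem atPrimeMap_comp (φ : A ⟶ B) (ψ : B ⟶ C) (q : PrimeSpectrum C.Even)
    (x : A.atPrime (PrimeSpectrum.comap (evenMap φ) (PrimeSpectrum.comap (evenMap ψ) q))) :
    atPrimeMap (φ ≫ ψ) q x =
      atPrimeMap ψ q (atPrimeMap φ (PrimeSpectrum.comap (evenMap ψ) q) x) := by
  obtain ⟨a, s, rfl⟩ := frac_surj x
  refine (atPrimeMap_frac (φ ≫ ψ) q a s).trans (Eq.symm ?_)
  exact (congrArg _ (atPrimeMap_frac φ _ a s)).trans (atPrimeMap_frac ψ q (φ a) _)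

theorem sectionsMap_id (U : Opens (PrimeSpectrum.Top A.Even)) (s : A.sections U) :
    sectionsMap (𝟙 A) U s = s :=
  Subtype.ext (funext fun q => atPrimeMap_id q.1 _)

theorem sectionsMap_comp (φ : A ⟶ B) (ψ : B ⟶ C) (U : Opens (PrimeSpectrum.Top A.Even))
    (s : A.sections U) :
    sectionsMap (φ ≫ ψ) U s = sectionsMap ψ ((Opens.map (specBase φ)).obj U) (sectionsMap φ U s) :=
  Subtype.ext (funext fun q => atPrimeMap_comp φ ψ q.1 _)

theorem specBase_id : specBase (𝟙 A) = 𝟙 (PrimeSpectrum.Top A.Even) := rfl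

theorem specMapAux_id_app (U : (Opens (PrimeSpectrum.Top A.Even))ᵒᵖ) :
    (specMapAux (𝟙 A)).c.app U = 𝟙 (A.structurePresheaf.obj U) :=
  hom_ext fun s => sectionsMap_id U.unop s

theorem specMapAux_id : specMapAux (𝟙 A) = 𝟙 A.spec.toPresheafedSpace :=
  PresheafedSpace.hext _ _ specBase_id (heq_of_eq (NatTrans.ext (funext specMapAux_id_app)))

theorem specMapAux_comp (φ : A ⟶ B) (ψ : B ⟶ C) :
    specMapAux (φ ≫ ψ) = specMapAux ψ ≫ specMapAux φ := by
  refine PresheafedSpace.hext _ _ rfl (heq_of_eq (NatTrans.ext (funext fun U => ?_)))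
  exact hom_ext fun s => sectionsMap_comp φ ψ U.unop s

theorem specMap_id : specMap (𝟙 A) = 𝟙 A.spec := specHom_ext specMapAux_id

theorem specMap_comp (φ : A ⟶ B) (ψ : B ⟶ C) : specMap (φ ≫ ψ) = specMap ψ ≫ specMap φ :=
  specHom_ext (specMapAux_comp φ ψ)

end SuperAlg

/-! ### Functors of points -/

namespace SuperSpace

variable {k : Type u} [CommRing k]

/-- The functor of points `h_X : A ↦ Hom (Spec A, X)`. -/
def functorOfPoints (X : SuperSpace k) : SuperAlg k ⥤ Type u where
  obj A := A.spec ⟶ X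
  map φ := ↾fun f => SuperAlg.specMap φ ≫ f
  map_id A := by ext f; simp [SuperAlg.specMap_id]
  map_comp φ ψ := by ext f; simp [SuperAlg.specMap_comp]

/-- `h_V ⊆ h_X` for an open subspace `V` of `X`: the morphisms `Spec R ⟶ X` which factor through
the inclusion of `V`. -/
def openSubfunctor (X : SuperSpace k) (V : Opens X) : Subfunctor X.functorOfPoints where
  obj R := {φ | ∃ ψ : R.spec ⟶ X.restrict V, ψ ≫ X.ι V = φ}
  map {R S} f := by
    rintro _ ⟨ψ, rfl⟩
    exact ⟨SuperAlg.specMap f ≫ ψ, Category.assoc _ _ _⟩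

end SuperSpace

namespace SuperFunctor

variable {k : Type u} [CommRing k] {F : SuperAlg.{u} k ⥤ Type u}

/-- A subfunctor `U` of `F` is open if for every superalgebra `A` and every natural
transformation `f : h_{Spec A} ⟶ F` the subfunctor `f⁻¹(U)` of `h_{Spec A}` is `h_V` for an
open `V ⊆ Spec A`. -/
def IsOpen (U : Subfunctor F) : Prop :=
  ∀ (A : SuperAlg k) (f : A.spec.functorOfPoints ⟶ F),
    ∃ V : Opens A.spec, U.preimage f = A.spec.openSubfunctor V

/-- An open affine subfunctor: an open subfunctor which is isomorphic to `Hom (A, -)` for some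
superalgebra `A`. -/
def IsOpenAffine (U : Subfunctor F) : Prop := IsOpen U ∧ U.toFunctor.IsCorepresentable

/-- A family of subfunctors `U i` covers `F` if for all `f : h_{Spec A} ⟶ F` the `f⁻¹(U i)` are
`h_{V i}` for an open cover `V i` of `Spec A`. -/
def IsOpenCover {I : Type u} (U : I → Subfunctor F) : Prop :=
  ∀ (A : SuperAlg k) (f : A.spec.functorOfPoints ⟶ F), ∃ V : I → Opens A.spec,
    (∀ i, (U i).preimage f = A.spec.openSubfunctor (V i)) ∧ ⨆ i, V i = ⊤

end SuperFunctor

namespace SuperAlg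

variable {k : Type u} [CommRing k] (A : SuperAlg k)

/-- The localization `A_f` at an even element `f`. -/
abbrev away (f : A.Even) : SuperAlg k := A.loc (Submonoid.powers f)

/-- The localization map `A ⟶ A_f`. -/
def toAway (f : A.Even) : A ⟶ A.away f := toLoc _

variable {A} in
/-- For `f ∣ g` the canonical map `A_f ⟶ A_g`. -/
def awayMap {f g : A.Even} (h : f ∣ g) : A.away f ⟶ A.away g :=
  locLift (A.toAway g) (by
    rintro ⟨_, n, rfl⟩
    have hg : IsUnit (evenMap (A.toAway g) g) := isUnit_toLoc ⟨g, Submonoid.mem_powers g⟩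
    rw [map_pow]
    exact (isUnit_of_dvd_unit (map_dvd _ h) hg).pow n)

end SuperAlg

/-- A functor is local if it is a sheaf for the Zariski topology: for all families `f i` of even
elements of `A` which generate the unit ideal of `A₀`, every family of elements of `F(A_{f i})`
with the same images in `F(A_{f i f j})` comes from a unique element of `F(A)`. -/
def SuperFunctor.IsLocal {k : Type u} [CommRing k] (F : SuperAlg.{u} k ⥤ Type u) : Prop :=
  ∀ (A : SuperAlg k) (I : Type u) (f : I → A.Even), Ideal.span (Set.range f) = ⊤ →
    ∀ α : ∀ i, F.obj (A.away (f i)),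
      (∀ i j, F.map (SuperAlg.awayMap (dvd_mul_right (f i) (f j))) (α i) =
        F.map (SuperAlg.awayMap (dvd_mul_left (f j) (f i))) (α j)) →
      ∃! a : F.obj A, ∀ i, F.map (A.toAway (f i)) a = α i

end

/-! The functor `A ↦ Spec A` is fully faithful (`specMap_injective`, `specMap_ofSpecHom`). A
morphism `g : Spec B ⟶ Spec A` induces `φ : A ⟶ B` on global sections; locality forces `g(𝔮) = φ⁻¹
𝔮`, and since every section is locally a fraction, `g` is the morphism of `φ`. By Yoneda a
transformation `h_{Spec A} ⟶ F` is an element `a` of `F(A)`, and `U ⊆ F` is open iff for every such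
`a` there is an open `V ⊆ Spec A₀` such that `φ(a)` lies in `U` exactly when `Spec φ` lands in `V`
(`isOpen_iff`, `isOpenCover_iff`).

All sheaf arguments are reduced to stalks. Sections over `Spec A` are functions with values in the
`A_𝔭`, so a morphism from `Spec A` is a continuous map together with the values of the pullbacks of
sections (`val_ext'`, `presheafedHomOfVal`). Values on a basic open set are compared with values on
`Spec A` through the bijection `A_𝔭 → (A_f)_𝔮` (`locMap_toLoc_bijective`).

From a superscheme to the two conditions: morphisms from `Spec A` glue along the `D(f_i)`, so `h_X`
is local (`isLocal_functorOfPoints`). For an affine open `U` of the even scheme, quasi-coherence of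
the odd part gives `𝒪(D(f)) = 𝒪(U)_f` (`awayRes_bijective`), so that `Spec 𝒪(U) ⟶ X` is an open
immersion with image `U` (`isOpenImmersion_chartAux`). Therefore `𝒪(U)` represents the subfunctor of
morphisms into `U`, and these subfunctors cover.

From the two conditions to a superscheme: let `gen i ∈ F(B i)` be universal elements of the cover.
Points of `Spec (B i)` and `Spec (B j)` are identified if some `A` with `φ : B i ⟶ A`, `ψ : B j ⟶
A`, `φ(gen i) = ψ(gen j)` has a point above both. Openness of the `j`-th subfunctor gives, near such
a point, a transition map from `B j` to a localization of `B i` (`Rel.exists_transition`). Hence the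
relation is transitive, charts embed as open subsets, and stalks are identified. Sections of the
glued sheaf are families of sections over the charts with compatible values. The charts are open
immersions, so the even part is a scheme (`evenIsScheme_of_charts`) and the odd part is
quasi-coherent (`isQuasicoherent_oddModules_of_charts`).

Finally `F` and `h_X` are local functors which are locally generated by the `gen i` and by the
charts respectively, and these families satisfy the same relations (`specMap_comp_chart`,
`map_gen_eq_of_specMap_comp_chart`). This determines such a functor up to isomorphism
(`nonempty_iso`). -/

noncomputable section

/-! ### Stalks of localizations -/

namespace SuperAlg

variable {k : Type u} [CommRing k] {A B C : SuperAlg k}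

/-- The map on prime spectra induced by a morphism of superalgebras. -/
abbrev comap (φ : A ⟶ B) (q : PrimeSpectrum B.Even) : PrimeSpectrum A.Even :=
  PrimeSpectrum.comap (evenMap φ) q

/-- The morphism `A_𝔭 ⟶ B_𝔮` induced by `φ : A ⟶ B` when `𝔭 = φ⁻¹ 𝔮`. -/
def locMap (φ : A ⟶ B) {p : PrimeSpectrum A.Even} {q : PrimeSpectrum B.Even}
    (h : comap φ q = p) : A.atPrime p ⟶ B.atPrime q := by
  subst h
  exact atPrimeMap φ q

theorem locMap_frac (φ : A ⟶ B) {p : PrimeSpectrum A.Even} {q : PrimeSpectrum B.Even}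
    (h : comap φ q = p) (a : A) (f : A.Even) (hf : f ∈ A.compl p)
    (hf' : evenMap φ f ∈ B.compl q) :
    locMap φ h (frac a ⟨f, hf⟩) = frac (φ a) ⟨evenMap φ f, hf'⟩ := by
  subst h
  exact atPrimeMap_frac φ q a ⟨f, hf⟩

theorem evenMap_mem_compl (φ : A ⟶ B) {p : PrimeSpectrum A.Even} {q : PrimeSpectrum B.Even}
    (h : comap φ q = p) {f : A.Even} (hf : f ∈ A.compl p) : evenMap φ f ∈ B.compl q := by
  subst h
  exact hf

theorem atPrime_surj {p : PrimeSpectrum A.Even} (x : A.atPrime p) :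
    ∃ (a : A) (f : A.Even) (hf : f ∈ A.compl p), frac a ⟨f, hf⟩ = x := by
  obtain ⟨a, ⟨f, hf⟩, rfl⟩ := frac_surj x
  exact ⟨a, f, hf, rfl⟩

/-- Keeping the equalities of primes as hypotheses allows stalk maps to be composed and compared
without transport; identities between them are then checked on fractions by `locMap_frac`. -/
theorem locMap_comp (φ : A ⟶ B) (ψ : B ⟶ C) {p : PrimeSpectrum A.Even} {q : PrimeSpectrum B.Even}
    {r : PrimeSpectrum C.Even} (h : comap φ q = p) (h' : comap ψ r = q)
    (h'' : comap (φ ≫ ψ) r = p) (x : A.atPrime p) :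
    locMap (φ ≫ ψ) h'' x = locMap ψ h' (locMap φ h x) := by
  obtain ⟨a, f, hf, rfl⟩ := atPrime_surj x
  rw [locMap_frac φ h a f hf (evenMap_mem_compl φ h hf),
    locMap_frac ψ h' _ _ _ (evenMap_mem_compl ψ h' (evenMap_mem_compl φ h hf))]
  exact locMap_frac (φ ≫ ψ) h'' a f hf (evenMap_mem_compl _ h'' hf)

theorem locMap_id {p : PrimeSpectrum A.Even} (h : comap (𝟙 A) p = p) (x : A.atPrime p) :
    locMap (𝟙 A) h x = x := by
  obtain ⟨a, f, hf, rfl⟩ := atPrime_surj x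
  exact locMap_frac (𝟙 A) h a f hf hf

theorem frac_zero {S : Submonoid A.Even} (s : S) : frac (0 : A) s = 0 :=
  LocalizedModule.zero_mk s

theorem frac_eq_zero_iff {S : Submonoid A.Even} {a : A} {s : S} :
    frac a s = 0 ↔ ∃ v : S, (v : A) * a = 0 := by
  rw [← frac_zero (1 : S), frac_eq_iff]
  constructor
  · rintro ⟨v, hv⟩
    exact ⟨v, by simpa using hv⟩
  · rintro ⟨v, hv⟩
    exact ⟨v, by simpa using hv⟩

/-- The even part of `A[S⁻¹]` is the localization of `A₀` at `S`. -/
theorem isLocalization_even (S : Submonoid A.Even) :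
    letI := (evenMap (toLoc S)).toAlgebra
    IsLocalization S (A.loc S).Even := by
  let := (evenMap (toLoc S)).toAlgebra
  refine ⟨⟨fun s => isUnit_toLoc s, fun ⟨x, hx⟩ => ?_, fun {a b} h => ?_⟩⟩
  · obtain ⟨a, ha, s, rfl⟩ := frac_surj_of_mem hx
    refine ⟨⟨⟨a, ha⟩, s⟩, Subtype.ext ?_⟩
    change frac a s * frac (s : A) 1 = frac a 1
    rw [frac_mul_frac, frac_eq_iff]
    exact ⟨1, by simpa using (A.even_mul_comm s.1.2).symm⟩
  · have h' : frac (a : A) (1 : S) = frac (b : A) 1 := congrArg Subtype.val h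
    obtain ⟨v, hv⟩ := frac_eq_iff.1 h'
    exact ⟨v, Subtype.ext (by simpa using hv)⟩

variable {S : Submonoid A.Even}

theorem mem_compl_of_mem (q : PrimeSpectrum (A.loc S).Even) {f : A.Even} (hf : f ∈ S) :
    f ∈ A.compl (comap (toLoc S) q) := fun h =>
  q.2.ne_top (Ideal.eq_top_of_isUnit_mem _ h (isUnit_toLoc ⟨f, hf⟩))

/-- The elements `b / s` and `b / 1` differ by the factor `s / 1`, which lies outside `𝔮`. -/
theorem frac_mem_compl_iff (q : PrimeSpectrum (A.loc S).Even) (b : A.Even) (s : S) :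
    (⟨frac (b : A) s, A.frac_mem b.2 s⟩ : (A.loc S).Even) ∈ (A.loc S).compl q ↔
      b ∈ A.compl (comap (toLoc S) q) := by
  have h : (⟨frac (b : A) s, A.frac_mem b.2 s⟩ : (A.loc S).Even) * evenMap (toLoc S) s =
      evenMap (toLoc S) b := by
    refine Subtype.ext ?_
    change frac (b : A) s * frac (s : A) 1 = frac (b : A) 1
    rw [frac_mul_frac, frac_eq_iff]
    exact ⟨1, by simpa using (A.even_mul_comm s.1.2).symm⟩
  have hs : evenMap (toLoc S) s ∈ (A.loc S).compl q := mem_compl_of_mem q s.2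
  constructor
  · intro hb
    have := mul_mem hb hs
    rwa [h] at this
  · intro hb hb'
    exact hb (show evenMap (toLoc S) b ∈ q.asIdeal from h ▸ Ideal.mul_mem_right _ _ hb')

/-- If `a / f` dies in the second localization, it is killed by some `b / t` outside `𝔮`; then `w b
a = 0` in `A` for some `w ∈ S`, and `w b` lies outside `𝔭`. -/
theorem locMap_toLoc_injective {p : PrimeSpectrum A.Even} {q : PrimeSpectrum (A.loc S).Even}
    (h : comap (toLoc S) q = p) : Function.Injective (locMap (toLoc S) h) := by
  rw [injective_iff_map_eq_zero]
  intro x hx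
  obtain ⟨a, f, hf, rfl⟩ := atPrime_surj x
  rw [locMap_frac _ h a f hf (evenMap_mem_compl _ h hf)] at hx
  obtain ⟨⟨⟨v, hv⟩, hvq⟩, e⟩ := frac_eq_zero_iff.1 hx
  obtain ⟨b, hb, t, rfl⟩ := frac_surj_of_mem hv
  have e' : frac (b * a) (t * 1) = 0 := (frac_mul_frac b a t 1).symm.trans e
  obtain ⟨w, hw⟩ := frac_eq_zero_iff.1 e'
  subst h
  refine frac_eq_zero_iff.2 ⟨⟨w.1 * ⟨b, hb⟩, mul_mem (mem_compl_of_mem q w.2)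
    ((frac_mem_compl_iff q ⟨b, hb⟩ t).1 hvq)⟩, ?_⟩
  exact (mul_assoc _ _ _).trans hw

/-- The double fraction `(a / s) / (b / t)` is `t a / (s b)`. As `A` is not commutative, the even
factors have to be moved past each other by hand. -/
theorem frac_frac_eq {q : PrimeSpectrum (A.loc S).Even} (a : A) (s : S) (b : A.Even) (t : S)
    (hq : (⟨frac (b : A) t, A.frac_mem b.2 t⟩ : (A.loc S).Even) ∈ (A.loc S).compl q)
    (hs : s.1 * b ∈ A.compl (comap (toLoc S) q)) :
    locMap (toLoc S) rfl (frac ((t : A) * a) ⟨s.1 * b, hs⟩) =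
      frac (frac a s) (⟨⟨frac (b : A) t, A.frac_mem b.2 t⟩, hq⟩ : (A.loc S).compl q) := by
  refine (locMap_frac (toLoc S) (q := q) rfl _ _ hs hs).trans ?_
  refine frac_congr _ ?_
  change frac (b : A) t * frac ((t : A) * a) 1 = frac ((s : A) * (b : A)) 1 * frac a s
  rw [frac_mul_frac, frac_mul_frac, frac_eq_iff]
  refine ⟨1, ?_⟩
  have e1 : (s : A) * ((b : A) * ((t : A) * a)) = (t : A) * ((s : A) * ((b : A) * a)) := by
    rw [← mul_assoc (b : A), A.even_mul_comm (b := (t : A)) b.2, mul_assoc, ← mul_assoc (s : A),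
      ← mul_assoc (t : A), A.even_mul_comm (b := (t : A)) s.1.2]
  simpa [mul_assoc] using e1

/-- Surjectivity is the clearing of double fractions. This identification of stalks is what moves
values between a spectrum and its basic open subsets in both gluing constructions below. -/
theorem locMap_toLoc_bijective {p : PrimeSpectrum A.Even} {q : PrimeSpectrum (A.loc S).Even}
    (h : comap (toLoc S) q = p) : Function.Bijective (locMap (toLoc S) h) := by
  refine ⟨locMap_toLoc_injective h, fun x => ?_⟩
  obtain ⟨y, ⟨z, hz⟩, hzq, rfl⟩ := atPrime_surj x
  obtain ⟨a, s, rfl⟩ := frac_surj y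
  obtain ⟨b, hb, t, rfl⟩ := frac_surj_of_mem hz
  subst h
  exact ⟨_, frac_frac_eq a s ⟨b, hb⟩ t hzq
    (mul_mem (mem_compl_of_mem q s.2) ((frac_mem_compl_iff q ⟨b, hb⟩ t).1 hzq))⟩

/-- A section of the structure sheaf of `A[S⁻¹]` is locally a fraction of elements of `A`. -/
theorem exists_frac_of_loc {V : Opens (PrimeSpectrum.Top (A.loc S).Even)}
    {t : ∀ q : V, (A.loc S).atPrime q.1} (ht : (A.loc S).IsLocallyFrac t) (q₀ : V) :
    ∃ (W : Opens (PrimeSpectrum.Top (A.loc S).Even)) (_ : q₀.1 ∈ W) (hW : W ≤ V) (a : A)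
      (g : A.Even), ∀ q : W, ∃ hg : g ∈ A.compl (comap (toLoc S) q.1),
        t ⟨q.1, hW q.2⟩ = locMap (toLoc S) rfl (frac a ⟨g, hg⟩) := by
  obtain ⟨W, hq, hW, y, ⟨z, hz⟩, e⟩ := ht q₀
  obtain ⟨a, s, rfl⟩ := frac_surj y
  obtain ⟨b, hb, r, rfl⟩ := frac_surj_of_mem hz
  refine ⟨W, hq, hW, r * a, s.1 * ⟨b, hb⟩, fun q => ?_⟩
  obtain ⟨h1, h2⟩ := e q
  have hs : s.1 * ⟨b, hb⟩ ∈ A.compl (comap (toLoc S) q.1) :=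
    mul_mem (mem_compl_of_mem q.1 s.2) ((frac_mem_compl_iff q.1 ⟨b, hb⟩ r).1 h1)
  exact ⟨hs, h2.trans (frac_frac_eq a s ⟨b, hb⟩ r h1 hs).symm⟩

/-! ### Localization at an element -/

variable (f : A.Even)

theorem isOpenEmbedding_comap_toAway : Topology.IsOpenEmbedding (comap (A.toAway f)) := by
  let := (evenMap (A.toAway f)).toAlgebra
  have : IsLocalization.Away f (A.away f).Even := isLocalization_even _
  exact PrimeSpectrum.localization_away_isOpenEmbedding (A.away f).Even f

theorem range_comap_toAway : Set.range (comap (A.toAway f)) = PrimeSpectrum.basicOpen f := by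
  let := (evenMap (A.toAway f)).toAlgebra
  have : IsLocalization.Away f (A.away f).Even := isLocalization_even _
  exact PrimeSpectrum.localization_away_comap_range (A.away f).Even f

variable {f}

theorem exists_comap_toAway {p : PrimeSpectrum A.Even} (h : f ∉ p.asIdeal) :
    ∃ q, comap (A.toAway f) q = p :=
  (range_comap_toAway f).ge h

theorem notMem_comap_toAway (q : PrimeSpectrum (A.away f).Even) :
    f ∉ (comap (A.toAway f) q).asIdeal :=
  (range_comap_toAway f).le ⟨q, rfl⟩

theorem toAway_awayMap {g : A.Even} (h : f ∣ g) : A.toAway f ≫ awayMap h = A.toAway g :=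
  locLift_toLoc _ _

/-- The morphism `A_f ⟶ B` induced by a morphism `A ⟶ B` which maps `f` to a unit. -/
def awayLift (φ : A ⟶ B) (h : IsUnit (evenMap φ f)) : A.away f ⟶ B :=
  locLift φ (by
    rintro ⟨_, n, rfl⟩
    rw [map_pow]
    exact h.pow n)

theorem toAway_awayLift (φ : A ⟶ B) (h : IsUnit (evenMap φ f)) :
    A.toAway f ≫ awayLift φ h = φ := locLift_toLoc _ _

theorem isUnit_toAway : IsUnit (evenMap (A.toAway f) f) :=
  isUnit_toLoc ⟨f, Submonoid.mem_powers f⟩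

variable (f) in
/-- The morphism `A_f ⟶ B_{φ f}` induced by `φ : A ⟶ B`. -/
def awayFunctoriality (φ : A ⟶ B) : A.away f ⟶ B.away (evenMap φ f) :=
  awayLift (φ ≫ B.toAway _) isUnit_toAway

theorem toAway_awayFunctoriality (φ : A ⟶ B) :
    A.toAway f ≫ awayFunctoriality f φ = φ ≫ B.toAway _ := toAway_awayLift _ _

end SuperAlg

namespace SuperSpace

variable {k : Type u} [CommRing k]

theorem hom_ext {X Y : SuperSpace k} {f g : X ⟶ Y} (h : f.toHom = g.toHom) : f = g := by
  obtain ⟨f, hf⟩ : SuperSpace.Hom X Y := f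
  obtain ⟨g, hg⟩ : SuperSpace.Hom X Y := g
  obtain rfl : f = g := h
  rfl

end SuperSpace

/-! ### Sections and pullbacks in terms of their values in the stalks -/

namespace SuperAlg

variable {k : Type u} [CommRing k] {A B C : SuperAlg k}

/-- The inverse algebra isomorphism preserves parity because `f` is injective and commutes with the
projections to the homogeneous components. -/
theorem isIso_of_bijective (f : A ⟶ B) (h : Function.Bijective f) : IsIso f := by
  let e : A ≃ₐ[k] B := AlgEquiv.ofBijective f.toGradedAlgHom.toAlgHom h
  have he (b : B) : f (e.symm b) = b := e.apply_symm_apply b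
  let g : B ⟶ A := homMk e.symm.toAlgHom (fun i b hb => by
    have : A.proj i (e.symm b) = e.symm b := h.1 (by
      rw [map_proj, he, B.proj_of_mem hb])
    exact this ▸ A.proj_mem i _)
  refine ⟨g, hom_ext fun a => ?_, hom_ext fun b => he b⟩
  exact e.symm_apply_apply a

theorem bijective_of_isIso (f : A ⟶ B) [IsIso f] : Function.Bijective f := by
  refine Function.bijective_iff_has_inverse.2 ⟨inv f, fun a => ?_, fun b => ?_⟩
  · exact ConcreteCategory.congr_hom (IsIso.hom_inv_id f) a
  · exact ConcreteCategory.congr_hom (IsIso.inv_hom_id f) b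

/-- The value at a prime of a section of the structure sheaf. -/
def eval (A : SuperAlg k) {U : Opens (PrimeSpectrum.Top A.Even)} (p : PrimeSpectrum A.Even)
    (hp : p ∈ U) : A.sectionsAlg U ⟶ A.atPrime p :=
  homMk (A := A.sectionsAlg U) (B := A.atPrime p)
    { toFun := fun s => s.1 ⟨p, hp⟩
      map_one' := rfl
      map_mul' := fun _ _ => rfl
      map_zero' := rfl
      map_add' := fun _ _ => rfl
      commutes' := fun _ => rfl }
    (fun _ _ hs => hs ⟨p, hp⟩)

theorem sections_ext {U : Opens (PrimeSpectrum.Top A.Even)} {s t : A.sectionsAlg U}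
    (h : ∀ p (hp : p ∈ U), A.eval p hp s = A.eval p hp t) : s = t :=
  Subtype.ext (funext fun p => h p.1 p.2)

/-- The sections `a / 1`. -/
def toSections (A : SuperAlg k) (U : Opens (PrimeSpectrum.Top A.Even)) : A ⟶ A.sectionsAlg U :=
  homMk (B := A.sectionsAlg U)
    { toFun := fun a => ⟨fun p => toLoc (A.compl p.1) a, fun p =>
        ⟨U, p.2, le_rfl, a, 1, fun _ => ⟨one_mem _, rfl⟩⟩⟩
      map_one' := Subtype.ext (funext fun p => map_one (toLoc (A.compl p.1)).toGradedAlgHom)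
      map_mul' := fun a b =>
        Subtype.ext (funext fun p => map_mul (toLoc (A.compl p.1)).toGradedAlgHom a b)
      map_zero' := Subtype.ext (funext fun p => map_zero (toLoc (A.compl p.1)).toGradedAlgHom)
      map_add' := fun a b =>
        Subtype.ext (funext fun p => map_add (toLoc (A.compl p.1)).toGradedAlgHom a b)
      commutes' := fun r =>
        Subtype.ext (funext fun p => (toLoc (A.compl p.1)).toGradedAlgHom.commutes r) }
    (fun _ _ ha p => map_part (toLoc (A.compl p.1)) ha)

/-- A section, as a section of the sheaf which Mathlib attaches to the `A₀`-module `A`. -/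
def toInType {U : Opens (PrimeSpectrum.Top A.Even)} (s : A.sectionsAlg U) :
    (structureSheafInType A.Even A).obj.obj (op U) :=
  ⟨s.1, fun x => by
    obtain ⟨V, mV, iV, a, f, hV⟩ := s.2 x
    exact ⟨V, mV, homOfLE iV, a, f, hV⟩⟩

theorem toInType_injective {U : Opens (PrimeSpectrum.Top A.Even)} {s t : A.sectionsAlg U}
    (h : toInType s = toInType t) : s = t :=
  Subtype.ext (by
    have h' : (toInType s).1 = (toInType t).1 := by rw [h]
    exact h')

theorem toInType_toSections {U : Opens (PrimeSpectrum.Top A.Even)} (a : A) :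
    toInType (A.toSections U a) = StructureSheaf.toOpenₗ A.Even A U a := rfl

/-- Bijectivity concerns the underlying `A₀`-module only, so it follows from the description of the
global sections of the sheaf of an `A₀`-module. -/
theorem toSections_top_bijective : Function.Bijective (A.toSections ⊤) := by
  have h := StructureSheaf.toOpenₗ_top_bijective (R := A.Even) (M := A)
  constructor
  · intro a b hab
    exact h.1 (congrArg toInType hab)
  · intro s
    obtain ⟨a, ha⟩ := h.2 (toInType s)
    exact ⟨a, toInType_injective ((toInType_toSections a).trans ha)⟩

instance : IsIso (A.toSections ⊤) := isIso_of_bijective _ toSections_top_bijective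

/-- The value at a prime `p` of the pullback of a section along a morphism from a spectrum. -/
def val {X : PresheafedSpace.{u, u + 1, u} (SuperAlg k)} (h : A.spec.toPresheafedSpace ⟶ X)
    {U : Opens X} (p : PrimeSpectrum A.Even) (hp : h.base p ∈ U) :
    X.presheaf.obj (op U) ⟶ A.atPrime p :=
  h.c.app (op U) ≫ A.eval (U := (Opens.map h.base).obj U) p hp

section

variable {X : PresheafedSpace.{u, u + 1, u} (SuperAlg k)}

theorem val_res (h : A.spec.toPresheafedSpace ⟶ X) {U V : Opens X} (i : U ⟶ V)
    (p : PrimeSpectrum A.Even) (hp : h.base p ∈ U) (s : X.presheaf.obj (op V)) :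
    val h p hp (X.presheaf.map i.op s) = val h p (i.le hp) s :=
  congrArg (A.eval (U := (Opens.map h.base).obj U) p hp)
    (ConcreteCategory.congr_hom (h.c.naturality i.op) s)

/-- A section over a spectrum is a function to the stalks, so the pullback on sections is known once
its values are. Testing values avoids comparing sections over preimages under two different maps. -/
theorem val_ext' {f g : A.spec.toPresheafedSpace ⟶ X} (hb : ∀ p, f.base p = g.base p)
    (hv : ∀ (U : Opens X) (s : X.presheaf.obj (op U)) (p : PrimeSpectrum A.Even)
      (hf : f.base p ∈ U) (hg : g.base p ∈ U), val f p hf s = val g p hg s) : f = g := by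
  obtain ⟨fb, fc⟩ : PresheafedSpace.Hom _ _ := f
  obtain ⟨gb, gc⟩ : PresheafedSpace.Hom _ _ := g
  obtain rfl : fb = gb := TopCat.hom_ext (ContinuousMap.ext hb)
  congr 1
  refine NatTrans.ext (funext fun U => hom_ext fun s => ?_)
  exact sections_ext (A := A) fun p hp => hv U.unop s p hp hp

theorem val_congr {f g : A.spec.toPresheafedSpace ⟶ X} (h : f = g) {U : Opens X}
    (p : PrimeSpectrum A.Even) (hf : f.base p ∈ U) (hg : g.base p ∈ U)
    (s : X.presheaf.obj (op U)) : val f p hf s = val g p hg s := by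
  subst h
  rfl

end

theorem val_ext {X : SuperSpace k} {f g : A.spec ⟶ X} (hb : ∀ p, f.base p = g.base p)
    (hv : ∀ (U : Opens X) (s : X.presheaf.obj (op U)) (p : PrimeSpectrum A.Even)
      (hf : f.base p ∈ U) (hg : g.base p ∈ U), val f.toHom p hf s = val g.toHom p hg s) :
    f = g :=
  SuperSpace.hom_ext (val_ext' hb hv)

end SuperAlg

/-! ### Locality of morphisms, tested on even stalks -/

namespace SuperSpace

variable {k : Type u} [CommRing k] {X Y Z : SuperSpace k}

/-- For even `a` one has `(a b)₀ = a b₀`, so the condition defining `evenLocalIdeal` reduces to `a`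
being a non-unit of `A₀`. -/
theorem maxIdeal_mem_iff {A : SuperAlg k} [IsLocalRing A.Even] (h : A.IsLocal) (a : A.Even) :
    (a : A) ∈ h.maxIdeal ↔ ¬ IsUnit a := by
  have e (b : A) : A.evenPart (a * b) = a * A.evenPart b := by
    refine Subtype.ext ?_
    change A.proj 0 (a * b) = a * A.proj 0 b
    rw [A.proj_zero_mul, A.proj_of_mem a.2, A.proj_of_mem_ne a.2 (j := 1) (by decide), zero_mul,
      add_zero]
  rw [SuperAlg.IsLocal.maxIdeal_eq, ← mem_nonunits_iff, ← IsLocalRing.mem_maximalIdeal]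
  constructor
  · intro ha
    have h1 := ha 1
    rw [e] at h1
    have : A.evenPart 1 = 1 := Subtype.ext (A.proj_of_mem A.evenSub.one_mem)
    rwa [this, mul_one] at h1
  · intro ha b
    rw [e]
    exact Ideal.mul_mem_right _ _ ha

theorem evenMap_superStalkMap {X Y : PresheafedSpace.{u, u + 1, u} (SuperAlg k)} (f : X ⟶ Y) (x : X)
    (s : SuperStalk.evenStalk Y.presheaf (f.base x)) :
    SuperAlg.evenMap (superStalkMap f x) (SuperStalk.evenStalkHom Y.presheaf (f.base x) s) =
      SuperStalk.evenStalkHom X.presheaf x (evenStalkMap f x s) := by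
  obtain ⟨U, hx, t, rfl⟩ := SuperStalk.exists_evenGerm _ _ s
  refine (congrArg _ (SuperStalk.evenStalkHom_germ _ _ U hx t)).trans (Eq.symm ?_)
  refine (congrArg _ (evenStalkMap_germ f x U hx t)).trans ?_
  refine (SuperStalk.evenStalkHom_germ _ _ ((Opens.map f.base).obj U) hx _).trans ?_
  exact Subtype.ext (superStalkMap_germ f x U hx t.1).symm

/-- Even non-units of a stalk are the even elements of its maximal homogeneous ideal, and the even
part of the stalk is the stalk of the even part. Together with `homOfEven` this makes locality of a
superspace morphism a condition on even stalks alone. -/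
theorem isLocalHom_evenStalkMap (f : X ⟶ Y) (x : X) : IsLocalHom (evenStalkMap f.toHom x) := by
  refine ⟨fun a ha => ?_⟩
  have := (X.isLocal x).isLocalRing_even
  have := (Y.isLocal (f.base x)).isLocalRing_even
  let e := RingEquiv.ofBijective _ (SuperStalk.evenStalkHom_bijective Y.presheaf (f.base x))
  by_contra hn
  have h1 : ¬ IsUnit (e a) := fun h => hn ((MulEquiv.isUnit_map e).1 h)
  have h2 := f.map_maxIdeal x _ ((maxIdeal_mem_iff (Y.isLocal (f.base x)) (e a)).2 h1)
  refine (maxIdeal_mem_iff (X.isLocal x) (SuperAlg.evenMap (superStalkMap f.toHom x) (e a))).1 h2 ?_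
  exact (evenMap_superStalkMap f.toHom x a) ▸ ha.map (SuperStalk.evenStalkHom X.presheaf x)

end SuperSpace

/-! ### Full faithfulness of the spectrum -/

namespace SuperAlg

variable {k : Type u} [CommRing k] {A B C : SuperAlg k}

/-- Evaluation at `p` is a local homomorphism on the stalk of even sections. -/
theorem isUnit_evenGerm_iff_eval {U : Opens (PrimeSpectrum.Top A.Even)} (p : PrimeSpectrum A.Even)
    (hp : p ∈ U) (s : (A.sectionsAlg U).Even) :
    IsUnit (SuperStalk.evenGerm A.structurePresheaf p U hp s) ↔
      IsUnit (evenMap (A.eval p hp) s) := by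
  have e : A.evenStalkEval p (SuperStalk.evenGerm A.structurePresheaf p U hp s) =
    evenMap (A.eval p hp) s := A.evenStalkEval_germ p U hp s
  constructor
  · intro h
    exact e ▸ h.map (A.evenStalkEval p)
  · intro h
    exact (A.isLocalHom_evenStalkEval p).map_nonunit _ (e ▸ h)

/-- A local morphism preserves and reflects units of even stalks. In this form locality determines
where `h` sends points. -/
theorem isUnit_evenGerm_iff_val {X : SuperSpace k} (h : A.spec ⟶ X) {U : Opens X}
    (p : PrimeSpectrum A.Even) (hp : h.base p ∈ U) (s : (X.presheaf.obj (op U)).Even) :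
    IsUnit (SuperStalk.evenGerm X.presheaf (h.base p) U hp s) ↔
      IsUnit (evenMap (val h.toHom p hp) s) := by
  have e := evenStalkMap_germ h.toHom p U hp s
  have e2 := isUnit_evenGerm_iff_eval (U := (Opens.map h.base).obj U) p hp
    (evenMap (h.c.app (op U)) s)
  refine Iff.trans ⟨fun hu => ?_, fun hu => ?_⟩ e2
  · exact e ▸ hu.map (evenStalkMap h.toHom p)
  · exact (SuperSpace.isLocalHom_evenStalkMap h p).map_nonunit _ (e ▸ hu)

theorem isUnit_evenMap_toLoc_compl_iff (p : PrimeSpectrum A.Even) (f : A.Even) :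
    IsUnit (evenMap (toLoc (A.compl p)) f) ↔ f ∉ p.asIdeal :=
  isUnit_frac_iff f 1

/-- The section `a / 1` pulls back to `φ(a) / 1`, and global sections of `Spec B` are elements of
`B`. -/
theorem specMap_injective {φ ψ : A ⟶ B} (h : specMap φ = specMap ψ) : φ = ψ := by
  refine hom_ext fun a => toSections_top_bijective.1 (sections_ext fun p hp => ?_)
  have h' := val_congr (congrArg SuperSpace.Hom.toHom h) (U := ⊤) p trivial trivial
    (A.toSections ⊤ a)
  have e (χ : A ⟶ B) : val (specMap χ).toHom (U := ⊤) p trivial (A.toSections ⊤ a) =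
      frac (χ a) 1 := by
    have h1 : (1 : B.compl p) = ⟨evenMap χ 1, by simp⟩ := Subtype.ext (map_one (evenMap χ)).symm
    rw [h1]
    exact locMap_frac χ (q := p) rfl a 1 (one_mem _) (by simp)
  exact (e φ).symm.trans (h'.trans (e ψ))

/-- The morphism on global sections induced by a morphism of spectra. -/
def globalMap (g : B.spec ⟶ A.spec) : A.sectionsAlg ⊤ ⟶ B.sectionsAlg ⊤ := g.c.app (op ⊤)

/-- The morphism of superalgebras induced by a morphism of spectra. -/
def ofSpecHom (g : B.spec ⟶ A.spec) : A ⟶ B :=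
  A.toSections ⊤ ≫ globalMap g ≫ inv (B.toSections ⊤)

theorem val_toSections (g : B.spec ⟶ A.spec) (q : PrimeSpectrum B.Even) (a : A) :
    val g.toHom (U := ⊤) q (Opens.mem_top (g.base q)) (A.toSections ⊤ a) =
      toLoc (B.compl q) (ofSpecHom g a) := by
  have : B.toSections ⊤ (ofSpecHom g a) = globalMap g (A.toSections ⊤ a) :=
    ConcreteCategory.congr_hom (show ofSpecHom g ≫ B.toSections ⊤ = A.toSections ⊤ ≫ globalMap g
      by simp [ofSpecHom]) a
  exact (congrArg (B.eval q (Opens.mem_top q)) this).symm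

/-- On points: `f ∉ g(𝔮)` iff `f` is a unit near `g(𝔮)`, iff its pullback is a unit near `𝔮`, which
by locality holds iff `φ f ∉ 𝔮`. On sections: an equation `f s = a` near `g(𝔮)` pulls back, and `φ
f` is invertible at `𝔮`. -/
theorem specMap_ofSpecHom (g : B.spec ⟶ A.spec) : specMap (ofSpecHom g) = g := by
  have hb (q : PrimeSpectrum B.Even) : comap (ofSpecHom g) q = g.base q := by
    refine PrimeSpectrum.ext (Ideal.ext fun f => not_iff_not.1 ?_)
    refine (isUnit_evenMap_toLoc_compl_iff q (evenMap (ofSpecHom g) f)).symm.trans ?_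
    have e : evenMap (toLoc (B.compl q)) (evenMap (ofSpecHom g) f) =
        evenMap (val g.toHom (U := ⊤) q (Opens.mem_top (g.base q))) (evenMap (A.toSections ⊤) f) :=
      Subtype.ext (val_toSections g q f).symm
    rw [e]
    refine (isUnit_evenGerm_iff_val g q _ _).symm.trans ?_
    exact (isUnit_evenGerm_iff_eval (A := A) (U := ⊤) (g.base q) trivial _).trans
      (isUnit_evenMap_toLoc_compl_iff _ f)
  refine val_ext hb fun U s q hf hg => ?_
  obtain ⟨V, mV, iV, a, f, e⟩ := s.2 ⟨g.base q, hg⟩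
  have hfq : f ∈ A.compl (g.base q) := (e ⟨g.base q, mV⟩).1
  have hfq' : evenMap (ofSpecHom g) f ∈ B.compl q := evenMap_mem_compl _ (hb q) hfq
  let s' : A.sectionsAlg V := A.structurePresheaf.map (homOfLE iV).op s
  -- The local form `s = a / f` is rewritten without division, so that a ring homomorphism can be
  -- applied to it.
  have hsV : A.toSections V f * s' = A.toSections V a := by
    refine sections_ext fun p hp => ?_
    rw [map_mul]
    obtain ⟨hf, e⟩ := e ⟨p, hp⟩
    refine (congrArg (_ * ·) e).trans ?_
    refine (frac_mul_frac _ _ _ _).trans ?_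
    refine frac_congr _ ?_
    simp
  have hr (c : A) : val g.toHom q mV (A.toSections V c) = toLoc (B.compl q) (ofSpecHom g c) :=
    (val_res g.toHom (homOfLE (le_top : V ≤ ⊤)) q mV (A.toSections ⊤ c)).trans
      (val_toSections g q c)
  have h2 : toLoc (B.compl q) (ofSpecHom g f) * val g.toHom q hg s =
      toLoc (B.compl q) (ofSpecHom g a) := by
    have h := congrArg (val g.toHom q mV) hsV
    refine (congrArg₂ (· * ·) (hr f).symm (val_res g.toHom (homOfLE iV) q mV s).symm).trans
      (Eq.trans ?_ (h.trans (hr a)))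
    exact (map_mul (val g.toHom q mV).toGradedAlgHom _ _).symm
  have h3 : val (specMap (ofSpecHom g)).toHom q hf s =
      frac (ofSpecHom g a) ⟨evenMap (ofSpecHom g) f, hfq'⟩ := by
    have e1 := e ⟨comap (ofSpecHom g) q, (hb q).symm ▸ mV⟩
    exact (congrArg (atPrimeMap (ofSpecHom g) q) e1.2).trans
      (atPrimeMap_frac (ofSpecHom g) q a ⟨f, e1.1⟩)
  rw [h3]
  -- The denominator becomes a unit at `q`, so the pulled back equation determines the value.
  have hu : IsUnit (toLoc (B.compl q) (ofSpecHom g f)) :=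
    (isUnit_toLoc (⟨_, hfq'⟩ : B.compl q)).map (B.atPrime q).evenSub.val
  refine hu.mul_left_cancel (Eq.trans ?_ h2.symm)
  refine (frac_mul_frac _ _ _ _).trans (frac_congr _ ?_)
  simp

theorem ofSpecHom_specMap (φ : A ⟶ B) : ofSpecHom (specMap φ) = φ :=
  specMap_injective (specMap_ofSpecHom _)

theorem ofSpecHom_comp (f : C.spec ⟶ B.spec) (g : B.spec ⟶ A.spec) :
    ofSpecHom (f ≫ g) = ofSpecHom g ≫ ofSpecHom f :=
  specMap_injective (by rw [specMap_comp, specMap_ofSpecHom, specMap_ofSpecHom, specMap_ofSpecHom])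

end SuperAlg

/-! ### Open immersions of superspaces -/

namespace SuperSpace

variable {k : Type u} [CommRing k]

theorem evenStalkMap_comp {X Y Z : PresheafedSpace.{u, u + 1, u} (SuperAlg k)} (l : X ⟶ Y)
    (f : Y ⟶ Z)
    (x : X) (a : SuperStalk.evenStalk Z.presheaf (f.base (l.base x))) :
    evenStalkMap (l ≫ f) x a = evenStalkMap l x (evenStalkMap f (l.base x) a) := by
  obtain ⟨U, hx, t, rfl⟩ := SuperStalk.exists_evenGerm _ _ a
  refine (evenStalkMap_germ (l ≫ f) x U hx t).trans (Eq.symm ?_)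
  exact (congrArg _ (evenStalkMap_germ f (l.base x) U hx t)).trans
    (evenStalkMap_germ l x ((Opens.map f.base).obj U) hx _)

instance isOpenImmersion_mapPresheaf {X Y : PresheafedSpace.{u, u + 1, u} (SuperAlg k)} (f : X ⟶ Y)
    [H : PresheafedSpace.IsOpenImmersion f] :
    PresheafedSpace.IsOpenImmersion (SuperAlg.evenFunctor.mapPresheaf.map f) where
  base_open := H.base_open
  c_iso U := by
    have := H.c_iso U
    exact inferInstanceAs
      (IsIso (SuperAlg.evenFunctor.map (f.c.app (op (H.base_open.functor.obj U)))))

theorem evenStalkMap_bijective {X Y : PresheafedSpace.{u, u + 1, u} (SuperAlg k)} (f : X ⟶ Y)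
    [PresheafedSpace.IsOpenImmersion f] (x : X) : Function.Bijective (evenStalkMap f x) := by
  have := isOpenImmersion_mapPresheaf f
  have : IsIso ((SuperAlg.evenFunctor.mapPresheaf.map f).stalkMap x) :=
    PresheafedSpace.IsOpenImmersion.stalk_iso (SuperAlg.evenFunctor.mapPresheaf.map f) x
  exact ConcreteCategory.bijective_of_isIso ((SuperAlg.evenFunctor.mapPresheaf.map f).stalkMap x)

/-- An open immersion is bijective on even stalks, so each element of the stalk of `Y` comes from
`Z`, where locality of the composite applies. -/
theorem isLocalHom_of_comp {X Y Z : PresheafedSpace.{u, u + 1, u} (SuperAlg k)} (l : X ⟶ Y)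
    (f : Y ⟶ Z)
    [PresheafedSpace.IsOpenImmersion f] (x : X) (h : IsLocalHom (evenStalkMap (l ≫ f) x)) :
    IsLocalHom (evenStalkMap l x) := by
  refine ⟨fun a ha => ?_⟩
  obtain ⟨b, rfl⟩ := (evenStalkMap_bijective f (l.base x)).2 a
  rw [← evenStalkMap_comp] at ha
  exact (h.map_nonunit b ha).map _

/-- A morphism of superspaces is an open immersion if it is a homeomorphism onto an open subset
which identifies the structure sheaves. -/
abbrev IsOpenImmersion {X Y : SuperSpace k} (f : X ⟶ Y) : Prop :=
  PresheafedSpace.IsOpenImmersion f.toHom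

variable {X Y Z : SuperSpace k}

/-- An open immersion of underlying spaces is a morphism of superspaces. -/
def homOfOpenImmersion (f : X.toPresheafedSpace ⟶ Y.toPresheafedSpace)
    [PresheafedSpace.IsOpenImmersion f] : X ⟶ Y :=
  homOfEven f fun x => by
    have h := evenStalkMap_bijective f x
    refine ⟨fun a ha => ?_⟩
    let e := RingEquiv.ofBijective _ h
    exact (MulEquiv.isUnit_map e).1 ha

/-- The lift exists for the underlying presheafed spaces; its locality is inherited from `g` by
`isLocalHom_of_comp`. -/
theorem exists_lift (f : X ⟶ Z) [IsOpenImmersion f] (g : Y ⟶ Z)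
    (H : ∀ y, g.base y ∈ Set.range f.base) : ∃ l : Y ⟶ X, l ≫ f = g := by
  have H' : Set.range g.toHom.base ⊆ Set.range f.toHom.base := by
    rintro _ ⟨y, rfl⟩
    exact H y
  have e := PresheafedSpace.IsOpenImmersion.lift_fac f.toHom g.toHom H'
  refine ⟨homOfEven (PresheafedSpace.IsOpenImmersion.lift f.toHom g.toHom H') fun x => ?_,
    hom_ext e⟩
  refine isLocalHom_of_comp _ f.toHom x ?_
  rw [e]
  exact isLocalHom_evenStalkMap g x

theorem cancel_openImmersion (f : X ⟶ Z) [IsOpenImmersion f] {g h : Y ⟶ X}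
    (e : g ≫ f = h ≫ f) : g = h := by
  let f' : X.toPresheafedSpace ⟶ Z.toPresheafedSpace := f.toHom
  let g' : Y.toPresheafedSpace ⟶ X.toPresheafedSpace := g.toHom
  let h' : Y.toPresheafedSpace ⟶ X.toPresheafedSpace := h.toHom
  have : PresheafedSpace.IsOpenImmersion f' := ‹IsOpenImmersion f›
  have e' : g' ≫ f' = h' ≫ f' := congrArg SuperSpace.Hom.toHom e
  exact hom_ext ((cancel_mono f').1 e')

instance (X : SuperSpace k) (U : Opens X) : IsOpenImmersion (X.ι U) :=
  PresheafedSpace.IsOpenImmersion.ofRestrict X.toPresheafedSpace U.isOpenEmbedding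

/-- Since the inclusion of `V` is an open immersion, membership in `h_V` is a condition on points
only. -/
theorem factors_iff (X : SuperSpace k) (V : Opens X) (g : Y ⟶ X) :
    (∃ ψ : Y ⟶ X.restrict V, ψ ≫ X.ι V = g) ↔ ∀ y, g.base y ∈ V := by
  constructor
  · rintro ⟨ψ, rfl⟩ y
    exact (ψ.base y).2
  · intro h
    exact exists_lift (X.ι V) g fun y => ⟨⟨_, h y⟩, rfl⟩

end SuperSpace

/-! ### The Yoneda lemma for spectra -/

namespace SuperFunctor

open SuperAlg

variable {k : Type u} [CommRing k] {F G : SuperAlg.{u} k ⥤ Type u}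

/-- The natural transformation `h_{Spec A} ⟶ F` given by an element of `F(A)`. -/
def ofElement {A : SuperAlg k} (a : F.obj A) : A.spec.functorOfPoints ⟶ F where
  app R := ↾fun g => F.map (ofSpecHom g) a
  naturality R S f := by
    ext g
    have e : ofSpecHom (specMap f ≫ (g : R.spec ⟶ A.spec)) = ofSpecHom g ≫ f :=
      (ofSpecHom_comp _ _).trans (congrArg _ (ofSpecHom_specMap f))
    exact (congrArg (fun t => F.map t a) e).trans (F.map_comp_apply _ _ a)

theorem ofElement_app_id {A : SuperAlg k} (a : F.obj A) : (ofElement a).app A (𝟙 A.spec) = a := by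
  change F.map (ofSpecHom (𝟙 A.spec)) a = a
  rw [← specMap_id, ofSpecHom_specMap, Functor.map_id_apply]

/-- `V` is the open subset of `Spec A` on which `a : F(A)` lies in the subfunctor `U`. -/
def IsLocus (U : Subfunctor F) {A : SuperAlg k} (a : F.obj A)
    (V : Opens (PrimeSpectrum.Top A.Even)) : Prop :=
  ∀ (R : SuperAlg k) (φ : A ⟶ R), F.map φ a ∈ U.obj R ↔ ∀ q, comap φ q ∈ V

/-- By full faithfulness every point of `h_{Spec A}` over `R` is some `specMap φ`, and naturality
computes `f` there from its value at the identity. -/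
theorem preimage_eq_iff (U : Subfunctor F) {A : SuperAlg k} (f : A.spec.functorOfPoints ⟶ F)
    (V : Opens A.spec) :
    U.preimage f = A.spec.openSubfunctor V ↔ IsLocus U (f.app A (𝟙 A.spec)) V := by
  have key (R : SuperAlg k) (φ : A ⟶ R) :
      F.map φ (f.app A (𝟙 A.spec)) = f.app R (specMap φ) := by
    have : A.spec.functorOfPoints.map φ (𝟙 A.spec) =
        specMap φ := Category.comp_id (specMap φ)
    exact (NatTrans.naturality_apply f φ (𝟙 A.spec)).symm.trans (congrArg (f.app R) this)
  have h2 (R : SuperAlg k) (φ : A ⟶ R) :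
      specMap φ ∈ (A.spec.openSubfunctor V).obj R ↔ ∀ q, comap φ q ∈ V :=
    SuperSpace.factors_iff A.spec V (specMap φ)
  constructor
  · intro h R φ
    rw [key]
    refine Iff.trans ?_ (h2 R φ)
    rw [← h]
    rfl
  · intro h
    ext R g
    obtain ⟨φ, rfl⟩ : ∃ φ, specMap φ = g := ⟨_, specMap_ofSpecHom g⟩
    refine Iff.trans ?_ (h2 R φ).symm
    refine Iff.trans ?_ (h R φ)
    rw [key]
    rfl

theorem isOpen_iff (U : Subfunctor F) :
    IsOpen U ↔ ∀ (A : SuperAlg k) (a : F.obj A), ∃ V, IsLocus U a V := by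
  constructor
  · intro h A a
    obtain ⟨V, hV⟩ := h A (ofElement a)
    exact ⟨V, ofElement_app_id a ▸ (preimage_eq_iff U _ V).1 hV⟩
  · intro h A f
    obtain ⟨V, hV⟩ := h A (f.app A (𝟙 A.spec))
    exact ⟨V, (preimage_eq_iff U f V).2 hV⟩

theorem isOpenCover_iff {I : Type u} (U : I → Subfunctor F) :
    IsOpenCover U ↔ ∀ (A : SuperAlg k) (a : F.obj A), ∃ V : I → Opens (PrimeSpectrum.Top A.Even),
      (∀ i, IsLocus (U i) a (V i)) ∧ ⨆ i, V i = ⊤ := by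
  constructor
  · intro h A a
    obtain ⟨V, hV, hc⟩ := h A (ofElement a)
    exact ⟨V, fun i => ofElement_app_id a ▸ (preimage_eq_iff (U i) _ (V i)).1 (hV i), hc⟩
  · intro h A f
    obtain ⟨V, hV, hc⟩ := h A (f.app A (𝟙 A.spec))
    exact ⟨V, fun i => (preimage_eq_iff (U i) f (V i)).2 (hV i), hc⟩

/-- The representing isomorphism is encoded by its value `u` at `𝟙 B`, viewed as an element of `F`
so that no subtype of `U` has to be carried along. -/
theorem isCorepresentable_iff (U : Subfunctor F) :
    U.toFunctor.IsCorepresentable ↔ ∃ (B : SuperAlg k) (u : F.obj B), u ∈ U.obj B ∧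
      ∀ (R : SuperAlg k) (y : F.obj R), y ∈ U.obj R → ∃! φ : B ⟶ R, F.map φ u = y := by
  constructor
  · rintro ⟨B, ⟨e⟩⟩
    let u := e.homEquiv (𝟙 B)
    have hu (R : SuperAlg k) (φ : B ⟶ R) : F.map φ u.1 = (e.homEquiv φ).1 := by
      have := e.homEquiv_comp φ (𝟙 B)
      rw [Category.id_comp] at this
      exact congrArg Subtype.val this.symm
    refine ⟨B, u.1, u.2, fun R y hy => ⟨e.homEquiv.symm ⟨y, hy⟩, ?_, fun φ hφ => ?_⟩⟩
    · change F.map _ u.1 = y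
      exact (hu R _).trans (congrArg Subtype.val (e.homEquiv.apply_symm_apply _))
    · exact e.homEquiv.eq_symm_apply.2 (Subtype.ext ((hu R φ).symm.trans hφ))
  · rintro ⟨B, u, hu, h⟩
    refine Functor.CorepresentableBy.isCorepresentable (X := B)
      { homEquiv := fun {R} => Equiv.ofBijective (fun φ => ⟨F.map φ u, U.map φ hu⟩) ⟨?_, ?_⟩
        homEquiv_comp := fun g f => Subtype.ext (by
          change F.map (f ≫ g) u = F.map g (F.map f u)
          exact F.map_comp_apply f g u) }
    · intro φ ψ e
      exact (h R _ (U.map ψ hu)).unique (congrArg Subtype.val e) rfl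
    · rintro ⟨y, hy⟩
      obtain ⟨φ, hφ, -⟩ := h R y hy
      exact ⟨φ, Subtype.ext hφ⟩

/-! ### Comparison of local functors -/

/-- The restrictions of `b` form a compatible family, and the sheaf condition says that only one
element restricts to it. -/
theorem IsLocal.ext (hF : IsLocal F) {A : SuperAlg k} {I : Type u} (f : I → A.Even)
    (hf : Ideal.span (Set.range f) = ⊤) {a b : F.obj A}
    (h : ∀ i, F.map (A.toAway (f i)) a = F.map (A.toAway (f i)) b) : a = b := by
  refine (hF A I f hf (fun i => F.map (A.toAway (f i)) b) fun i j => ?_).unique h fun _ => rfl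
  rw [← Functor.map_comp_apply, ← Functor.map_comp_apply, toAway_awayMap,
    toAway_awayMap]

/-- Locally on spectra every element comes from one of the `u i`. -/
def IsLocallyGenerated {I : Type u} {B : I → SuperAlg k} (u : ∀ i, F.obj (B i)) : Prop :=
  ∀ (A : SuperAlg k) (a : F.obj A), ∃ (J : Type u) (f : J → A.Even),
    Ideal.span (Set.range f) = ⊤ ∧ ∀ j, ∃ (i : I) (ψ : B i ⟶ A.away (f j)),
      F.map (A.toAway (f j)) a = F.map ψ (u i)

theorem span_range_evenMap {A R : SuperAlg k} (χ : A ⟶ R) {J : Type u} (f : J → A.Even)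
    (hf : Ideal.span (Set.range f) = ⊤) :
    Ideal.span (Set.range fun j => evenMap χ (f j)) = ⊤ := by
  have := congrArg (Ideal.map (evenMap χ)) hf
  rw [Ideal.map_span, Ideal.map_top, ← Set.range_comp] at this
  exact this

/-- On pieces where `a` is `ψ(u i)` the element `ψ(v i)` is prescribed; the implication `h` makes
these agree on overlaps, so they glue. Quantifying over all `χ` frees the characterization of `b`
from the chosen cover, which gives naturality at once. -/
theorem existsUnique_match {I : Type u} {B : I → SuperAlg k} {u : ∀ i, F.obj (B i)}
    {v : ∀ i, G.obj (B i)} (hu : IsLocallyGenerated u) (hG : IsLocal G)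
    (h : ∀ (i j : I) (A : SuperAlg k) (φ : B i ⟶ A) (ψ : B j ⟶ A),
      F.map φ (u i) = F.map ψ (u j) → G.map φ (v i) = G.map ψ (v j))
    {A : SuperAlg k} (a : F.obj A) :
    ∃! b : G.obj A, ∀ (R : SuperAlg k) (χ : A ⟶ R) (i : I) (ψ : B i ⟶ R),
      F.map χ a = F.map ψ (u i) → G.map χ b = G.map ψ (v i) := by
  obtain ⟨J, f, hf, hJ⟩ := hu A a
  choose i ψ hψ using hJ
  obtain ⟨b, hb, hbu⟩ := hG A J f hf (fun j => G.map (ψ j) (v (i j))) (fun j l => by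
    rw [← Functor.map_comp_apply, ← Functor.map_comp_apply]
    apply h
    rw [Functor.map_comp_apply, Functor.map_comp_apply, ← hψ, ← hψ,
      ← Functor.map_comp_apply, ← Functor.map_comp_apply, toAway_awayMap,
      toAway_awayMap])
  refine ⟨b, fun R χ l ρ e => ?_, fun b' hb' => hbu b' fun j => hb' _ _ _ _ (hψ j)⟩
  -- For arbitrary `χ` the equality is tested on the pulled back cover of `R`, where both elements
  -- come from generators and `h` applies.
  refine hG.ext _ (span_range_evenMap χ f hf) fun j => ?_
  have e1 := toAway_awayFunctoriality (f := f j) χ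
  have e2 : F.map (ρ ≫ R.toAway (evenMap χ (f j))) (u l) =
      F.map (ψ j ≫ awayFunctoriality (f j) χ) (u (i j)) := by
    rw [Functor.map_comp_apply, ← e, ← Functor.map_comp_apply, ← e1,
      Functor.map_comp_apply, hψ, Functor.map_comp_apply]
  have e3 := h _ _ _ _ _ e2
  rw [← Functor.map_comp_apply, ← Functor.map_comp_apply, e3, ← e1,
    Functor.map_comp_apply, Functor.map_comp_apply, hb]

/-- Two local functors which are locally generated by families of elements that satisfy the same
relations are isomorphic. -/
theorem nonempty_iso {I : Type u} {B : I → SuperAlg k} {u : ∀ i, F.obj (B i)}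
    {v : ∀ i, G.obj (B i)} (hF : IsLocal F) (hG : IsLocal G) (hu : IsLocallyGenerated u)
    (hv : IsLocallyGenerated v)
    (h : ∀ (i j : I) (A : SuperAlg k) (φ : B i ⟶ A) (ψ : B j ⟶ A),
      F.map φ (u i) = F.map ψ (u j) ↔ G.map φ (v i) = G.map ψ (v j)) : Nonempty (F ≅ G) := by
  choose α hα hα' using fun (A : SuperAlg k) (a : F.obj A) =>
    existsUnique_match hu hG (fun i j A φ ψ => (h i j A φ ψ).1) a
  choose β hβ hβ' using fun (A : SuperAlg k) (b : G.obj A) =>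
    existsUnique_match hv hF (fun i j A φ ψ => (h i j A φ ψ).2) b
  refine ⟨NatIso.ofComponents (fun A => Equiv.toIso ⟨α A, β A, fun a => ?_, fun b => ?_⟩)
    fun {A R} φ => ?_⟩
  -- Where `a` is `ψ(u i)`, its image under `α` is `ψ(v i)`, which `β` sends back to `ψ(u i)`.
  · obtain ⟨J, f, hf, hJ⟩ := hu A a
    refine hF.ext f hf fun j => ?_
    obtain ⟨i, ψ, e⟩ := hJ j
    rw [hβ A (α A a) _ _ i ψ (hα A a _ _ i ψ e), e]
  · obtain ⟨J, f, hf, hJ⟩ := hv A b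
    refine hG.ext f hf fun j => ?_
    obtain ⟨i, ψ, e⟩ := hJ j
    rw [hα A (β A b) _ _ i ψ (hβ A b _ _ i ψ e), e]
  · ext a
    -- Naturality is uniqueness: the image of `α a` under `φ` has the property that characterizes
    -- `α` of the image of `a`.
    refine (hα' R (F.map φ a) (G.map φ (α A a)) fun S χ i ψ e => ?_).symm
    rw [← Functor.map_comp_apply] at e ⊢
    exact hα A a S _ i ψ e

end SuperFunctor

/-! ### Functors of points are local -/

namespace SuperAlg

variable {k : Type u} [CommRing k] {A B : SuperAlg k}

section

variable {X : PresheafedSpace.{u, u + 1, u} (SuperAlg k)} (b : PrimeSpectrum.Top A.Even ⟶ X.carrier)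
  (v : ∀ (U : Opens X) (p : PrimeSpectrum A.Even), b p ∈ U → (X.presheaf.obj (op U) ⟶ A.atPrime p))
  (hres : ∀ (U V : Opens X) (i : U ⟶ V) (p : PrimeSpectrum A.Even) (hp : b p ∈ U)
    (s : X.presheaf.obj (op V)), v U p hp (X.presheaf.map i.op s) = v V p (i.le hp) s)
  (hfrac : ∀ (U : Opens X) (s : X.presheaf.obj (op U)) (p : PrimeSpectrum A.Even) (_ : b p ∈ U),
    ∃ (V : Opens (PrimeSpectrum.Top A.Even)) (_ : p ∈ V) (hV : ∀ q ∈ V, b q ∈ U) (a : A)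
      (f : A.Even), ∀ q (hq : q ∈ V), ∃ hf : f ∈ A.compl q, v U q (hV q hq) s = frac a ⟨f, hf⟩)

/-- The map on sections with given values. -/
def sectionsOfVal (U : Opens X) :
    X.presheaf.obj (op U) ⟶ A.sectionsAlg ((Opens.map b).obj U) :=
  homMk (B := A.sectionsAlg _)
    { toFun := fun s => ⟨fun p => v U p.1 p.2 s, fun p => by
        obtain ⟨V, hp, hV, a, f, h⟩ := hfrac U s p.1 p.2
        exact ⟨V, hp, fun q hq => hV q hq, a, f, fun q => h q.1 q.2⟩⟩
      map_one' := Subtype.ext (funext fun p => map_one (v U p.1 p.2).toGradedAlgHom)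
      map_mul' := fun s t => Subtype.ext (funext fun p => map_mul (v U p.1 p.2).toGradedAlgHom s t)
      map_zero' := Subtype.ext (funext fun p => map_zero (v U p.1 p.2).toGradedAlgHom)
      map_add' := fun s t => Subtype.ext (funext fun p => map_add (v U p.1 p.2).toGradedAlgHom s t)
      commutes' := fun r => Subtype.ext (funext fun p => (v U p.1 p.2).toGradedAlgHom.commutes r) }
    (fun _ _ hs p => map_part (v U p.1 p.2) hs)

/-- The morphism from a spectrum given by a continuous map and the values of the pullbacks of
sections. -/
def presheafedHomOfVal : A.spec.toPresheafedSpace ⟶ X where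
  base := b
  c :=
    { app := fun U => sectionsOfVal b v hfrac U.unop
      naturality := fun U V i => by
        refine hom_ext fun s => sections_ext fun p hp => ?_
        exact hres V.unop U.unop i.unop p hp s }

end

theorem isLocalHom_evenStalkMap_of_val {X : PresheafedSpace.{u, u + 1, u} (SuperAlg k)}
    (h : A.spec.toPresheafedSpace ⟶ X) (p : PrimeSpectrum.Top A.Even)
    (H : ∀ (U : Opens X) (hp : h.base p ∈ U) (s : (X.presheaf.obj (op U)).Even),
      IsUnit (evenMap (val h p hp) s) → IsUnit (SuperStalk.evenGerm X.presheaf (h.base p) U hp s)) :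
    IsLocalHom (evenStalkMap h p) := by
  refine ⟨fun a ha => ?_⟩
  obtain ⟨U, hx, t, rfl⟩ := SuperStalk.exists_evenGerm _ _ a
  refine H U hx t ?_
  exact (isUnit_evenGerm_iff_eval (A := A) (U := (Opens.map h.base).obj U) p hx
    (evenMap (h.c.app (op U)) t)).1 (evenStalkMap_germ h p U hx t ▸ ha)

theorem val_specMap_comp {X : SuperSpace k} (φ : A ⟶ B) (g : A.spec ⟶ X) {U : Opens X}
    {p : PrimeSpectrum A.Even} {q : PrimeSpectrum B.Even} (h : comap φ q = p)
    (hp : g.base p ∈ U) (hq : (specMap φ ≫ g).base q ∈ U) (s : X.presheaf.obj (op U)) :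
    val (specMap φ ≫ g).toHom q hq s = locMap φ h (val g.toHom p hp s) := by
  subst h
  rfl

theorem exists_notMem_of_span_eq_top {R : Type*} [CommRing R] {I : Type*} {f : I → R}
    (hf : Ideal.span (Set.range f) = ⊤) (p : PrimeSpectrum R) : ∃ i, f i ∉ p.asIdeal := by
  by_contra! h
  refine p.2.ne_top (top_le_iff.1 (hf ▸ Ideal.span_le.2 ?_))
  rintro _ ⟨i, rfl⟩
  exact h i

theorem locMap_congr {φ ψ : A ⟶ B} (e : φ = ψ) {p : PrimeSpectrum A.Even}
    {q : PrimeSpectrum B.Even} (h : comap φ q = p) (h' : comap ψ q = p) (x : A.atPrime p) :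
    locMap φ h x = locMap ψ h' x := by
  subst e
  rfl

theorem comap_comp_eq {C : SuperAlg k} {φ : A ⟶ B} {ψ : B ⟶ C} {χ : A ⟶ C} (h : φ ≫ ψ = χ)
    (r : PrimeSpectrum C.Even) : comap φ (comap ψ r) = comap χ r := by
  subst h
  rfl

/-- The common image in `Spec A₀` avoids `f` and `g`, hence `f g` because it is prime; its lift to
`D(f g)` maps to the two given points by injectivity of the embeddings of `D(f)` and `D(g)`. -/
theorem exists_comap_awayMap {f g : A.Even} {q : PrimeSpectrum (A.away f).Even}
    {q' : PrimeSpectrum (A.away g).Even} (h : comap (A.toAway f) q = comap (A.toAway g) q') :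
    ∃ r, comap (awayMap (dvd_mul_right f g)) r = q ∧ comap (awayMap (dvd_mul_left g f)) r = q' := by
  obtain ⟨r, hr⟩ := exists_comap_toAway (f := f * g) (p := comap (A.toAway f) q) (fun hm =>
    ((comap (A.toAway f) q).2.mem_or_mem hm).elim (notMem_comap_toAway q)
      (h ▸ notMem_comap_toAway q'))
  refine ⟨r, (isOpenEmbedding_comap_toAway f).injective ?_,
    (isOpenEmbedding_comap_toAway g).injective ?_⟩
  · exact (comap_comp_eq (toAway_awayMap _) r).trans hr
  · exact ((comap_comp_eq (toAway_awayMap _) r).trans hr).trans h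

section

variable {X : SuperSpace k} {I : Type u} {f : I → A.Even} {g : ∀ i, (A.away (f i)).spec ⟶ X}

/-- Both points are the image of one point of `D(f_i f_j)` under the common restriction of `g i` and
`g j`. -/
theorem base_eq_of_compatible
    (hg : ∀ i j, specMap (awayMap (dvd_mul_right (f i) (f j))) ≫ g i =
      specMap (awayMap (dvd_mul_left (f j) (f i))) ≫ g j) {i j : I}
    {q : PrimeSpectrum (A.away (f i)).Even} {q' : PrimeSpectrum (A.away (f j)).Even}
    (h : comap (A.toAway (f i)) q = comap (A.toAway (f j)) q') :
    (g i).base q = (g j).base q' := by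
  obtain ⟨r, rfl, rfl⟩ := exists_comap_awayMap h
  have := congrArg (fun t : (A.away (f i * f j)).spec ⟶ X => t.base r) (hg i j)
  exact this

/-- The values are compared at a point of `D(f_i f_j)`, where the two restricted morphisms coincide.
-/
theorem val_eq_of_compatible
    (hg : ∀ i j, specMap (awayMap (dvd_mul_right (f i) (f j))) ≫ g i =
      specMap (awayMap (dvd_mul_left (f j) (f i))) ≫ g j) {i j : I} {p : PrimeSpectrum A.Even}
    {q : PrimeSpectrum (A.away (f i)).Even} {q' : PrimeSpectrum (A.away (f j)).Even}
    (h : comap (A.toAway (f i)) q = p) (h' : comap (A.toAway (f j)) q' = p)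
    {U : Opens X} (hq : (g i).base q ∈ U) (hq' : (g j).base q' ∈ U) (s : X.presheaf.obj (op U))
    (x : A.atPrime p) (hx : locMap (A.toAway (f i)) h x = val (g i).toHom q hq s) :
    locMap (A.toAway (f j)) h' x = val (g j).toHom q' hq' s := by
  obtain ⟨r, hr, hr'⟩ := exists_comap_awayMap (h.trans h'.symm)
  have hr1 : comap (A.toAway (f i) ≫ awayMap (dvd_mul_right (f i) (f j))) r = p :=
    (congrArg (comap _) hr).trans h
  have hr2 : comap (A.toAway (f j) ≫ awayMap (dvd_mul_left (f j) (f i))) r = p :=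
    (congrArg (comap _) hr').trans h'
  have hr3 : comap (A.toAway (f i * f j)) r = p := by
    rwa [toAway_awayMap] at hr1
  -- Source and target are both identified with `A_𝔭`, so nothing is lost by passing to the overlap.
  have inj : Function.Injective (locMap (awayMap (dvd_mul_left (f j) (f i))) hr') := by
    intro y z hyz
    obtain ⟨y, rfl⟩ := (locMap_toLoc_bijective h').2 y
    obtain ⟨z, rfl⟩ := (locMap_toLoc_bijective h').2 z
    have e (y : A.atPrime p) : locMap (A.toAway (f i * f j)) hr3 y =
        locMap (awayMap (dvd_mul_left (f j) (f i))) hr' (locMap (A.toAway (f j)) h' y) := by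
      rw [← locMap_comp _ _ h' hr' hr2]
      exact locMap_congr (toAway_awayMap _).symm _ _ y
    exact congrArg _ ((locMap_toLoc_bijective hr3).1 ((e y).trans (hyz.trans (e z).symm)))
  apply inj
  have hm : (specMap (awayMap (dvd_mul_right (f i) (f j))) ≫ g i).base r ∈ U := by
    subst hr
    exact hq
  have hm' : (specMap (awayMap (dvd_mul_left (f j) (f i))) ≫ g j).base r ∈ U := by
    subst hr'
    exact hq'
  refine Eq.trans ?_ (val_specMap_comp _ (g j) hr' hq' hm' s)
  refine Eq.trans ?_ (val_congr (congrArg SuperSpace.Hom.toHom (hg i j)) r hm hm' s)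
  refine Eq.trans ?_ (val_specMap_comp _ (g i) hr hq hm s).symm
  rw [← hx, ← locMap_comp _ _ h' hr' hr2, ← locMap_comp _ _ h hr hr1]
  exact locMap_congr ((toAway_awayMap _).trans (toAway_awayMap _).symm) _ _ x

end

end SuperAlg

namespace SuperSpace

open SuperAlg

variable {k : Type u} [CommRing k]

/-- Functors of points are sheaves for the Zariski topology. -/
theorem isLocal_functorOfPoints (X : SuperSpace k) : SuperFunctor.IsLocal X.functorOfPoints := by
  intro A I f hf g hg
  replace hg : ∀ i j, specMap (awayMap (dvd_mul_right (f i) (f j))) ≫ (g i : _ ⟶ X) =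
      specMap (awayMap (dvd_mul_left (f j) (f i))) ≫ (g j : _ ⟶ X) := hg
  let g' (i : I) : (A.away (f i)).spec ⟶ X := g i
  -- Each point is lifted to one chosen `Spec A_{f_i}`. Compatibility makes the resulting map and
  -- values independent of the choice (`hb₀`, `hv`).
  choose i hi using exists_notMem_of_span_eq_top hf
  choose q hq using fun p => exists_comap_toAway (hi p)
  let b₀ (p : PrimeSpectrum A.Even) : X := (g' (i p)).base (q p)
  have hb₀ {j : I} (r : PrimeSpectrum (A.away (f j)).Even) :
      b₀ (comap (A.toAway (f j)) r) = (g' j).base r := base_eq_of_compatible hg (hq _)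
  -- Continuity at a point may be tested after an open embedding, and on the chosen `D(f_i)` the map
  -- is `g i`.
  have hcont : Continuous b₀ := by
    refine continuous_iff_continuousAt.2 fun p => ?_
    have := (isOpenEmbedding_comap_toAway (f (i p))).continuousAt_iff (g := b₀) (x := q p)
    rw [hq] at this
    refine this.1 ?_
    have e : b₀ ∘ comap (A.toAway (f (i p))) = fun r => (g' (i p)).base r := funext hb₀
    rw [e]
    exact (g' (i p)).base.hom.continuous.continuousAt
  let b : PrimeSpectrum.Top A.Even ⟶ X.carrier := TopCat.ofHom ⟨b₀, hcont⟩
  have hiso (p) : IsIso (locMap (A.toAway (f (i p))) (hq p)) :=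
    isIso_of_bijective _ (locMap_toLoc_bijective (hq p))
  let v (U : Opens X) (p : PrimeSpectrum A.Even) (hp : b p ∈ U) :
      X.presheaf.obj (op U) ⟶ A.atPrime p :=
    val (g' (i p)).toHom (q p) hp ≫ inv (locMap (A.toAway (f (i p))) (hq p))
  have hv₀ (U : Opens X) (p : PrimeSpectrum A.Even) (hp : b p ∈ U) (s : X.presheaf.obj (op U)) :
      locMap (A.toAway (f (i p))) (hq p) (v U p hp s) = val (g' (i p)).toHom (q p) hp s :=
    ConcreteCategory.congr_hom (show v U p hp ≫ locMap (A.toAway (f (i p))) (hq p) =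
      val (g' (i p)).toHom (q p) hp by simp [v]) s
  have hv (U : Opens X) (p : PrimeSpectrum A.Even) (hp : b p ∈ U) (s : X.presheaf.obj (op U))
      (j : I) (r : PrimeSpectrum (A.away (f j)).Even) (hr : comap (A.toAway (f j)) r = p)
      (hr' : (g' j).base r ∈ U) :
      locMap (A.toAway (f j)) hr (v U p hp s) = val (g' j).toHom r hr' s :=
    val_eq_of_compatible hg (hq p) hr hp hr' s _ (hv₀ U p hp s)
  have hres (U V : Opens X) (l : U ⟶ V) (p : PrimeSpectrum A.Even) (hp : b p ∈ U)
      (s : X.presheaf.obj (op V)) : v U p hp (X.presheaf.map l.op s) = v V p (l.le hp) s :=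
    congrArg (inv (locMap (A.toAway (f (i p))) (hq p))) (val_res (g' (i p)).toHom l (q p) hp s)
  -- A section over `Spec A_{f_i}` is locally a fraction of elements of `A` itself, by
  -- `exists_frac_of_loc`.
  have hfrac (U : Opens X) (s : X.presheaf.obj (op U)) (p : PrimeSpectrum A.Even) (hp : b p ∈ U) :
      ∃ (V : Opens (PrimeSpectrum.Top A.Even)) (_ : p ∈ V) (hV : ∀ q ∈ V, b q ∈ U) (a : A)
        (f : A.Even), ∀ q (hq : q ∈ V), ∃ hf : f ∈ A.compl q,
          v U q (hV q hq) s = frac a ⟨f, hf⟩ := by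
    let t : (A.away (f (i p))).sections ((Opens.map (g' (i p)).base).obj U) :=
      (g' (i p)).c.app (op U) s
    obtain ⟨W, hW, hWV, a, d, h⟩ := exists_frac_of_loc t.2 ⟨q p, hp⟩
    have emb := isOpenEmbedding_comap_toAway (f (i p))
    refine ⟨⟨comap (A.toAway (f (i p))) '' W.1, emb.isOpenMap _ W.2⟩, ⟨q p, hW, hq p⟩, ?_, a, d, ?_⟩
    · rintro _ ⟨r, hr, rfl⟩
      exact Set.mem_of_eq_of_mem (hb₀ r) (hWV hr)
    · rintro _ ⟨r, hr, rfl⟩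
      obtain ⟨hd, e⟩ := h ⟨r, hr⟩
      exact ⟨hd, locMap_toLoc_injective rfl ((hv U _ _ s _ r rfl (hWV hr)).trans e)⟩
  let α₀ : A.spec.toPresheafedSpace ⟶ X.toPresheafedSpace := presheafedHomOfVal b v hres hfrac
  -- Locality at `p` is inherited from `g (i p)` at `q p`, since the value there is the image of the
  -- value of `α₀`.
  let α : A.spec ⟶ X := homOfEven α₀ fun p => by
    refine isLocalHom_evenStalkMap_of_val α₀ p fun U hp s hs => ?_
    refine (isUnit_evenGerm_iff_val (g' (i p)) (q p) hp s).2 ?_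
    have := hs.map (evenMap (locMap (A.toAway (f (i p))) (hq p)))
    have e : evenMap (locMap (A.toAway (f (i p))) (hq p)) (evenMap (val α₀ p hp) s) =
      evenMap (val (g' (i p)).toHom (q p) hp) s := Subtype.ext (hv₀ U p hp s.1)
    exact e ▸ this
  refine ⟨α, fun j => ?_, fun β hβ => ?_⟩
  · change specMap (A.toAway (f j)) ≫ α = g' j
    refine val_ext (fun r => hb₀ r) fun U s r hr hr' => ?_
    exact hv U _ hr s j r rfl hr'
  · replace hβ (j) : specMap (A.toAway (f j)) ≫ (β : A.spec ⟶ X) = g' j := hβ j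
    let β' : A.spec ⟶ X := β
    have hbase (p : PrimeSpectrum A.Even) : β'.base p = b p := by
      have := congrArg (fun t : (A.away (f (i p))).spec ⟶ X => t.base (q p)) (hβ (i p))
      refine Eq.trans ?_ this
      change _ = β'.base (comap _ (q p))
      rw [hq]
    refine val_ext hbase fun U s p hp hp' => ?_
    apply locMap_toLoc_injective (hq p)
    refine Eq.trans ?_ (hv₀ U p hp' s).symm
    have hr : (specMap (A.toAway (f (i p))) ≫ (β : A.spec ⟶ X)).base (q p) ∈ U := by
      rw [hβ]
      exact hp'
    refine (val_specMap_comp (A.toAway (f (i p))) β (hq p) hp hr s).symm.trans ?_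
    exact val_congr (congrArg SuperSpace.Hom.toHom (hβ (i p))) (q p) hr hp' s

end SuperSpace

/-! ### A criterion for open immersions of spectra -/

section

variable {k : Type u} [CommRing k] {X : PresheafedSpace.{u, u + 1, u} (SuperAlg k)}

/-- The sheaf of types underlying a sheaf of superalgebras. -/
def typeSheaf (X : PresheafedSpace.{u, u + 1, u} (SuperAlg k))
    (hX : TopCat.Presheaf.IsSheaf (X.presheaf ⋙ forget (SuperAlg k))) :
    TopCat.Sheaf (Type u) X.carrier :=
  ⟨X.presheaf ⋙ forget (SuperAlg k), hX⟩

theorem section_ext_of_locally (hX : TopCat.Presheaf.IsSheaf (X.presheaf ⋙ forget (SuperAlg k)))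
    {U : Opens X} {s t : X.presheaf.obj (op U)}
    (h : ∀ x ∈ U, ∃ (V : Opens X) (i : V ⟶ U), x ∈ V ∧
      X.presheaf.map i.op s = X.presheaf.map i.op t) : s = t := by
  choose V i hV e using h
  refine (typeSheaf X hX).eq_of_locally_eq' (
    fun x : U => V x.1 x.2) U (fun x => i x.1 x.2) ?_ s t fun x => e x.1 x.2
  intro x hx
  exact Opens.mem_iSup.2 ⟨⟨x, hx⟩, hV x hx⟩

theorem exists_gluing (hX : TopCat.Presheaf.IsSheaf (X.presheaf ⋙ forget (SuperAlg k)))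
    {I : Type u} (V : I → Opens X) {U : Opens X} (iV : ∀ j, V j ⟶ U)
    (hU : U ≤ iSup V) (s : ∀ j, X.presheaf.obj (op (V j)))
    (hs : ∀ j l, X.presheaf.map (Opens.infLELeft (V j) (V l)).op (s j) =
      X.presheaf.map (Opens.infLERight (V j) (V l)).op (s l)) :
    ∃ t : X.presheaf.obj (op U), ∀ j, X.presheaf.map (iV j).op t = s j := by
  obtain ⟨t, ht, -⟩ := (typeSheaf X hX).existsUnique_gluing' V U iV hU (fun j => s j)
    (fun j l => hs j l)
  exact ⟨t, ht⟩

end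

namespace SuperAlg

variable {k : Type u} [CommRing k] {A : SuperAlg k}

/-- Equality of two fractions at `p` is witnessed by a multiplier `v ∉ p`, which works on all of
`D(v)`. -/
theorem exists_eval_eq {U : Opens (PrimeSpectrum.Top A.Even)} (s t : A.sectionsAlg U)
    (p : PrimeSpectrum A.Even) (hp : p ∈ U) (h : A.eval p hp s = A.eval p hp t) :
    ∃ (V : Opens (PrimeSpectrum.Top A.Even)) (_ : p ∈ V) (hV : V ≤ U),
      ∀ q (hq : q ∈ V), A.eval q (hV hq) s = A.eval q (hV hq) t := by
  obtain ⟨V, mV, iV, a, f, hV⟩ := s.2 ⟨p, hp⟩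
  obtain ⟨W, mW, iW, b, g, hW⟩ := t.2 ⟨p, hp⟩
  obtain ⟨hf, e1⟩ := hV ⟨p, mV⟩
  obtain ⟨hg, e2⟩ := hW ⟨p, mW⟩
  obtain ⟨v, hv⟩ := frac_eq_iff.1 (e1.symm.trans (Eq.trans h e2))
  refine ⟨V ⊓ W ⊓ PrimeSpectrum.basicOpen v.1, ⟨⟨mV, mW⟩, v.2⟩,
    inf_le_left.trans (inf_le_left.trans iV), fun q hq => ?_⟩
  obtain ⟨hf, e1⟩ := hV ⟨q, hq.1.1⟩
  obtain ⟨hg, e2⟩ := hW ⟨q, hq.1.2⟩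
  have e : frac a (⟨f, hf⟩ : A.compl q) = frac b ⟨g, hg⟩ :=
    frac_eq_iff.2 ⟨(⟨v.1, hq.2⟩ : A.compl q), hv⟩
  exact e1.trans (e.trans e2.symm)

variable {X : PresheafedSpace.{u, u + 1, u} (SuperAlg k)}

/-- A morphism from a spectrum is an open immersion if it is an open embedding of spaces which
induces bijections on stalks. -/
theorem isOpenImmersion_of_val (h : A.spec.toPresheafedSpace ⟶ X)
    (hX : TopCat.Presheaf.IsSheaf (X.presheaf ⋙ forget (SuperAlg k)))
    (hb : Topology.IsOpenEmbedding h.base)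
    (hinj : ∀ (U : Opens X) (s : X.presheaf.obj (op U)) (p : PrimeSpectrum A.Even)
      (hp : h.base p ∈ U), val h p hp s = 0 →
        ∃ (V : Opens X) (i : V ⟶ U), h.base p ∈ V ∧ X.presheaf.map i.op s = 0)
    (hsurj : ∀ (p : PrimeSpectrum A.Even) (x : A.atPrime p),
      ∃ (U : Opens X) (hp : h.base p ∈ U) (s : X.presheaf.obj (op U)), val h p hp s = x) :
    PresheafedSpace.IsOpenImmersion h where
  base_open := hb
  c_iso V := by
    -- Sections over open subsets of the image are determined by their values: the difference of two
    -- such sections vanishes near every point by `hinj`.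
    have inj (U : Opens X) (hU : U ≤ hb.functor.obj V) (s t : X.presheaf.obj (op U))
        (e : ∀ p hp, val h p hp s = val h p hp t) : s = t := by
      rw [← sub_eq_zero]
      refine section_ext_of_locally hX fun x hx => ?_
      obtain ⟨p, -, rfl⟩ := hU hx
      obtain ⟨W, i, hW, e0⟩ := hinj U (s - t) p hx (by rw [map_sub, e p hx, sub_self])
      exact ⟨W, i, hW, e0.trans (map_zero _).symm⟩
    refine isIso_of_bijective _ ⟨fun s t e => inj _ le_rfl s t fun p hp => ?_, fun t => ?_⟩
    · exact congrArg (A.eval (U := (Opens.map h.base).obj (hb.functor.obj V)) p hp) e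
    · let V' : Opens (PrimeSpectrum.Top A.Even) :=
        (Opens.map h.base).obj (hb.functor.obj V)
      let t' : A.sectionsAlg V' := t
      -- `hsurj` realizes the value of `t` at `p` by a section on `X`; the two sections then agree
      -- in a neighbourhood, whose image is open in `X`.
      have loc (p : PrimeSpectrum.Top A.Even) (hp : p ∈ V) : ∃ (W : Opens X)
          (i : W ⟶ hb.functor.obj V) (s : X.presheaf.obj (op W)), h.base p ∈ W ∧
            ∀ q (hq : h.base q ∈ W), val h q hq s = A.eval (U := V') q (i.le hq) t' := by
        have hp' : p ∈ V' := ⟨p, hp, rfl⟩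
        obtain ⟨U, hU, s, e⟩ := hsurj p (A.eval p hp' t')
        let U' : Opens (PrimeSpectrum.Top A.Even) := (Opens.map h.base).obj U
        let s' : A.sectionsAlg U' := h.c.app (op U) s
        obtain ⟨W, hW, hWU, eW⟩ := exists_eval_eq
          (A.structurePresheaf.map (U'.infLELeft V').op s')
          (A.structurePresheaf.map (U'.infLERight V').op t') p ⟨hU, hp'⟩ e
        have hWU' : hb.functor.obj W ≤ U := by
          rintro _ ⟨q, hq, rfl⟩
          exact (hWU hq).1
        have hWV' : hb.functor.obj W ≤ hb.functor.obj V := by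
          rintro _ ⟨q, hq, rfl⟩
          exact (hWU hq).2
        refine ⟨hb.functor.obj W, homOfLE hWV', X.presheaf.map (homOfLE hWU').op s,
          ⟨p, hW, rfl⟩, fun q hq => ?_⟩
        obtain ⟨q', hq', e'⟩ := id hq
        obtain rfl := hb.injective e'
        exact (val_res h (homOfLE hWU') q' hq s).trans (eW q' hq')
      choose W i s hW e using loc
      -- The local preimages of `t` have equal values on overlaps, hence agree there by `inj`.
      obtain ⟨u, hu⟩ := exists_gluing hX (fun p : V => W p.1 p.2) (U := hb.functor.obj V)
        (fun p => i p.1 p.2) (by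
          rintro _ ⟨p, hp, rfl⟩
          exact Opens.mem_iSup.2 ⟨⟨p, hp⟩, hW p hp⟩) (fun p => s p.1 p.2) (by
          intro p q
          refine inj _ (inf_le_left.trans (i p.1 p.2).le) _ _ fun r hr => ?_
          refine (val_res h _ r hr _).trans (Eq.trans ?_ (val_res h _ r hr _).symm)
          exact (e p.1 p.2 r hr.1).trans (e q.1 q.2 r hr.2).symm)
      refine ⟨u, sections_ext fun p hp => ?_⟩
      obtain ⟨q, hq, e'⟩ := id hp
      obtain rfl := hb.injective e'
      refine Eq.trans ?_ (e q hq q (hW q hq))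
      rw [← hu ⟨q, hq⟩]
      exact (val_res h (i q hq) q (hW q hq) u).symm

end SuperAlg

/-! ### Quasi-coherent modules on affine open subsets -/

namespace AlgebraicGeometry.Scheme.Modules

open Limits

/-- Transport of presentations along isomorphisms. -/
def presentationCongr {Y : Scheme.{u}} {M N : Y.Modules} (e : M ≅ N) (P : M.Presentation) :
    N.Presentation :=
  let M' : SheafOfModules.{u} Y.ringCatSheaf := M
  let N' : SheafOfModules.{u} Y.ringCatSheaf := N
  let f : M' ⟶ N' := e.hom
  have : IsIso f := ⟨(e.inv : N' ⟶ M'), e.hom_inv_id, e.inv_hom_id⟩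
  SheafOfModules.Presentation.ofIsIso f P

/-- A presentation of the restriction to an open subset, as a presentation over the slice site. -/
def presentationOver {Y : Scheme.{u}} (M : Y.Modules) (U : Y.Opens)
    (P : (M.restrict U.ι).Presentation) : (SheafOfModules.over M U).Presentation := by
  let E : SheafOfModules.{u} (Y.ringCatSheaf.over U) ≌
    SheafOfModules.{u} (U : Scheme.{u}).ringCatSheaf := overEquiv U
  have : PreservesColimitsOfSize.{u, u} E.inverse :=
    E.symm.toAdjunction.leftAdjoint_preservesColimits
  let u0 : SheafOfModules.{u} Y.ringCatSheaf := SheafOfModules.unit Y.ringCatSheaf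
  let o : SheafOfModules.{u} Y.ringCatSheaf ⥤ SheafOfModules.{u} (U : Scheme.{u}).ringCatSheaf :=
    restrictFunctor U.ι
  let a : SheafOfModules.overFunctor Y.ringCatSheaf U ⋙ E.functor ≅ o := overFunctorEquiv U
  let e1 : E.functor.obj (SheafOfModules.unit (Y.ringCatSheaf.over U)) ≅
      SheafOfModules.unit (U : Scheme.{u}).ringCatSheaf :=
    a.app u0 ≪≫ (restrictUnitIso U.ι)
  let η : E.inverse.obj (SheafOfModules.unit (U : Scheme.{u}).ringCatSheaf) ≅
      SheafOfModules.unit (Y.ringCatSheaf.over U) :=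
    E.inverse.mapIso e1.symm ≪≫ (E.unitIso.app _).symm
  let M' : SheafOfModules.{u} Y.ringCatSheaf := M
  let e2 : E.inverse.obj (o.obj M') ≅ SheafOfModules.over M' U :=
    E.inverse.mapIso (a.app M').symm ≪≫ (E.unitIso.app _).symm
  let P' : (o.obj M').Presentation := P
  exact SheafOfModules.Presentation.ofIsIso e2.hom (P'.map E.inverse η.symm)

/-- Quasi-coherence is defined by presentations over slice sites; modules over the slice site at `U`
are equivalent to modules on the open subscheme `U`. -/
theorem isQuasicoherent_of_presentation_restrict {Y : Scheme.{u}} (M : Y.Modules) {I : Type u}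
    (U : I → Y.Opens)
    (hU : ⨆ i, U i = ⊤) (P : ∀ i, (M.restrict (U i).ι).Presentation) : M.IsQuasicoherent := by
  let M' : SheafOfModules.{u} Y.ringCatSheaf := M
  let q : SheafOfModules.QuasicoherentData.{u, u, u, u} M' :=
    { I := I
      X := U
      coversTop := (Opens.coversTop_iff (T := Y) U).2 hU
      presentation := fun i => presentationOver M (U i) (P i) }
  exact q.isQuasicoherent

/-- A presentation of the sheaf associated with a module. -/
def tildePresentation {R : CommRingCat.{u}} (M : ModuleCat.{u} R) : (tilde M).Presentation :=
  presentationTilde M Set.univ Submodule.span_univ _ (Submodule.span_eq _)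

/-- A module which is localizing on the affine opens of a covering is quasi-coherent. -/
theorem isQuasicoherent_of_isLocalizing {Y : Scheme.{u}} (M : Y.Modules) {I : Type u}
    (R : I → CommRingCat.{u}) (j : ∀ i, Spec (R i) ⟶ Y) [∀ i, IsOpenImmersion (j i)]
    (hj : ∀ y : Y, ∃ i x, (j i) x = y)
    (h : ∀ i, IsLocalizing (modulesSpecToSheaf.obj (M.restrict (j i)))) : M.IsQuasicoherent := by
  -- A localizing module on `Spec (R i)` is the sheaf associated with its global sections, hence
  -- presented; the presentation is carried to the image of `j i` along the isomorphism with `Spec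
  -- (R i)`.
  have P (i : I) : (M.restrict (j i).opensRange.ι).Presentation := by
    have : IsIso (M.restrict (j i)).fromTildeΓ :=
      (isIso_fromTildeΓ_iff_isLocalizing _).2 (h i)
    let P1 : (M.restrict (j i)).Presentation :=
      presentationCongr (asIso (M.restrict (j i)).fromTildeΓ)
        (tildePresentation _)
    let e : (j i).opensRange.toScheme ⟶ Spec (R i) := (j i).isoOpensRange.inv
    let iso : restrictFunctor (j i) ⋙ restrictFunctor e ≅ restrictFunctor (j i).opensRange.ι :=
      (restrictFunctorComp e (j i)).symm ≪≫ restrictFunctorCongr (by simp [e])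
    exact presentationCongr (iso.app M) (presentationRestrict e P1)
  refine isQuasicoherent_of_presentation_restrict M (fun i => (j i).opensRange) ?_ P
  refine top_le_iff.1 fun y _ => ?_
  obtain ⟨i, x, hx⟩ := hj y
  exact Opens.mem_iSup.2 ⟨i, x, hx⟩

/-! ### Sections of quasi-coherent modules over basic open sets -/

section

variable {R : CommRingCat.{u}}

/-- The open set `D(f)`, as an open subset of the scheme `Spec R`. -/
def specBasicOpen (f : R) : (Spec R).Opens := PrimeSpectrum.basicOpen f

/-- Of the three conditions for a localization at `f`, invertibility of `f` on sections over `D(f)`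
holds for every module; the other two remain. -/
theorem isLocalizing_iff_exists (N : (Spec R).Modules) :
    IsLocalizing (modulesSpecToSheaf.obj N) ↔ ∀ f : R,
      (∀ t : Γ(N, specBasicOpen f), ∃ (n : ℕ) (a : Γ(N, ⊤)),
        N.presheaf.map (specBasicOpen f).leTop.op a = f ^ n • t) ∧
      ∀ a : Γ(N, ⊤), N.presheaf.map (specBasicOpen f).leTop.op a = 0 →
        ∃ n : ℕ, f ^ n • a = 0 := by
  let φ (f : R) := ((modulesSpecToSheaf.obj N).obj.map (PrimeSpectrum.basicOpen f).leTop.op).hom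
  refine ⟨fun h f => ?_, fun h f => IsLocalizedModule.Away.mk_of_addCommGroup ?_ ?_ ?_⟩
  · have hf : IsLocalizedModule.Away f (φ f) := h f
    refine ⟨fun s => ?_, fun s hs => ?_⟩
    · obtain ⟨n, y, hy⟩ := hf.surj _ _ s
      exact ⟨n, y, hy.symm⟩
    · obtain ⟨⟨_, n, rfl⟩, hn⟩ := (IsLocalizedModule.eq_zero_iff (.powers f) (φ f)).mp hs
      exact ⟨n, hn⟩
  · exact isUnit_algebraMap_end_of_le_basicOpen f le_rfl
  · intro x
    obtain ⟨n, t, ht⟩ := (h f).1 x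
    exact ⟨n, t, ht.symm⟩
  · intro x hx
    exact (h f).2 x hx

variable {Y : Scheme.{u}} {M : Y.Modules}

/-- `Γ(Y, U)` acts on the module restricted along `fromSpec` through `appIso`. This identifies that
action with multiplication by the restriction of `f`. -/
theorem fromSpec_appIso_inv {U : Y.Opens} (hU : IsAffineOpen U) (V : (Spec Γ(Y, U)).Opens)
    (hV : hU.fromSpec ''ᵁ V ≤ U) (f : Γ(Y, U)) :
    (hU.fromSpec.appIso V).inv ((Spec Γ(Y, U)).presheaf.map V.leTop.op
      ((Scheme.ΓSpecIso Γ(Y, U)).inv f)) = Y.presheaf.map (homOfLE hV).op f := by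
  have h : Y.presheaf.map (homOfLE hV).op ≫ (hU.fromSpec.appIso V).hom =
      (Scheme.ΓSpecIso Γ(Y, U)).inv ≫ (Spec Γ(Y, U)).presheaf.map V.leTop.op := by
    rw [Scheme.Hom.appIso_hom', Scheme.Hom.map_appLE, Scheme.Hom.appLE, hU.fromSpec_app_self,
      Category.assoc, ← Functor.map_comp]
    rfl
  have h' := ConcreteCategory.congr_hom h f
  simp only [ConcreteCategory.comp_apply] at h'
  rw [← h']
  exact ConcreteCategory.congr_hom (hU.fromSpec.appIso V).hom_inv_id _

theorem map_map_apply {U V W : Y.Opens} (h : V ≤ U) (h' : W ≤ V) (x : Γ(M, U)) :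
    M.presheaf.map (homOfLE h').op (M.presheaf.map (homOfLE h).op x) =
      M.presheaf.map (homOfLE (h'.trans h)).op x := by
  rw [← ConcreteCategory.comp_apply, ← Functor.map_comp]
  rfl

theorem map_self_apply {U : Y.Opens} (h : U ≤ U) (x : Γ(M, U)) :
    M.presheaf.map (homOfLE h).op x = x :=
  ConcreteCategory.congr_hom (M.presheaf.map_id (op U)) x

/-- The criterion is applied to the pullback of `M` to `Spec Γ(Y, U)`; what remains is to undo the
equalities between images under `fromSpec` and open subsets of `Y`. -/
theorem exists_map_eq_pow_smul [M.IsQuasicoherent] {U : Y.Opens} (hU : IsAffineOpen U)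
    (f : Γ(Y, U)) (t : Γ(M, Y.basicOpen f)) : ∃ (n : ℕ) (a : Γ(M, U)),
      M.presheaf.map (homOfLE (Y.basicOpen_le f)).op a =
        Y.presheaf.map (homOfLE (Y.basicOpen_le f)).op (f ^ n) • t := by
  have h := ((isLocalizing_iff_exists (M.restrict hU.fromSpec)).1
    ((isIso_fromTildeΓ_iff_isLocalizing _).1 inferInstance) f).1
  have h1 : hU.fromSpec ''ᵁ specBasicOpen f = Y.basicOpen f := hU.fromSpec_image_basicOpen f
  have h0 : hU.fromSpec ''ᵁ ⊤ = U := by simp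
  obtain ⟨n, a, ha⟩ := h (M.presheaf.map (homOfLE h1.le).op t)
  let a' : Γ(M, hU.fromSpec ''ᵁ ⊤) := a
  have hle : hU.fromSpec ''ᵁ specBasicOpen f ≤ hU.fromSpec ''ᵁ ⊤ :=
    Scheme.Hom.image_mono _ le_top
  refine ⟨n, M.presheaf.map (homOfLE h0.ge).op a', ?_⟩
  have ha' : M.presheaf.map (homOfLE hle).op a' =
      (hU.fromSpec.appIso _).inv ((Spec Γ(Y, U)).presheaf.map (specBasicOpen f).leTop.op
      ((Scheme.ΓSpecIso Γ(Y, U)).inv (f ^ n))) • M.presheaf.map (homOfLE h1.le).op t := ha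
  rw [fromSpec_appIso_inv hU _ (h1.le.trans (Y.basicOpen_le f))] at ha'
  have := congrArg (M.presheaf.map (homOfLE h1.ge).op) ha'
  rw [map_smul, map_map_apply, map_map_apply, map_self_apply] at this
  rw [map_map_apply]
  refine this.trans ?_
  congr 1
  rw [← ConcreteCategory.comp_apply, ← Functor.map_comp]
  rfl

theorem exists_pow_smul_eq_zero [M.IsQuasicoherent] {U : Y.Opens} (hU : IsAffineOpen U)
    (f : Γ(Y, U)) (a : Γ(M, U)) (ha : M.presheaf.map (homOfLE (Y.basicOpen_le f)).op a = 0) :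
    ∃ n : ℕ, f ^ n • a = 0 := by
  have h := ((isLocalizing_iff_exists (M.restrict hU.fromSpec)).1
    ((isIso_fromTildeΓ_iff_isLocalizing _).1 inferInstance) f).2
  have h1 : hU.fromSpec ''ᵁ specBasicOpen f = Y.basicOpen f := hU.fromSpec_image_basicOpen f
  have h0 : hU.fromSpec ''ᵁ ⊤ = U := by simp
  obtain ⟨n, hn⟩ := h (M.presheaf.map (homOfLE h0.le).op a) (by
    refine (map_map_apply h0.le (Set.image_mono le_top) a).trans ?_
    rw [← map_map_apply (Y.basicOpen_le f) h1.le, ha, map_zero]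
    rfl)
  refine ⟨n, ?_⟩
  have hn' : (hU.fromSpec.appIso _).inv ((Spec Γ(Y, U)).presheaf.map (⊤ : Opens _).leTop.op
      ((Scheme.ΓSpecIso Γ(Y, U)).inv (f ^ n))) • M.presheaf.map (homOfLE h0.le).op a = 0 := hn
  rw [fromSpec_appIso_inv hU _ h0.le, ← map_smul] at hn'
  have := congrArg (M.presheaf.map (homOfLE h0.ge).op) hn'
  rwa [map_map_apply, map_self_apply, map_zero] at this

end

end AlgebraicGeometry.Scheme.Modules

/-! ### Affine charts of superschemes -/

namespace AlgebraicGeometry.IsAffineOpen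

variable {Y : Scheme.{u}} {U : Y.Opens}

theorem exists_map_eq_pow_mul (hU : IsAffineOpen U) (f : Γ(Y, U)) (t : Γ(Y, Y.basicOpen f)) :
    ∃ (n : ℕ) (a : Γ(Y, U)), Y.presheaf.map (homOfLE (Y.basicOpen_le f)).op a =
      Y.presheaf.map (homOfLE (Y.basicOpen_le f)).op (f ^ n) * t := by
  have := hU.isLocalization_basicOpen f
  obtain ⟨n, a, ha⟩ := IsLocalization.Away.surj f t
  refine ⟨n, a, ha.symm.trans ?_⟩
  rw [mul_comm, map_pow]
  rfl

theorem exists_pow_mul_eq_zero (hU : IsAffineOpen U) (f a : Γ(Y, U))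
    (h : Y.presheaf.map (homOfLE (Y.basicOpen_le f)).op a = 0) : ∃ n : ℕ, f ^ n * a = 0 := by
  have := hU.isLocalization_basicOpen f
  obtain ⟨⟨_, n, rfl⟩, hc⟩ :=
    (IsLocalization.map_eq_zero_iff (Submonoid.powers f) Γ(Y, Y.basicOpen f) a).1 h
  exact ⟨n, hc⟩

theorem isOpenEmbedding_fromSpec (hU : IsAffineOpen U) :
    Topology.IsOpenEmbedding hU.fromSpec.base :=
  hU.fromSpec.isOpenEmbedding

theorem exists_basicOpen_le_of_fromSpec_mem (hU : IsAffineOpen U) {W : Y.Opens}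
    (p : PrimeSpectrum Γ(Y, U)) (hp : hU.fromSpec.base p ∈ W) :
    ∃ f : Γ(Y, U), f ∉ p.asIdeal ∧ Y.basicOpen f ≤ W := by
  let V : Opens (PrimeSpectrum Γ(Y, U)) := hU.fromSpec ⁻¹ᵁ W
  obtain ⟨_, ⟨_, ⟨f, rfl⟩, rfl⟩, hf, hfW⟩ :=
    PrimeSpectrum.isBasis_basic_opens.exists_subset_of_mem_open (show p ∈ (V : Set _) from hp) V.2
  refine ⟨f, hf, ?_⟩
  rw [← hU.fromSpec_image_basicOpen f]
  rintro _ ⟨q, hq, rfl⟩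
  exact hfW hq

end AlgebraicGeometry.IsAffineOpen

namespace SuperAlg

variable {k : Type u} [CommRing k] {A B : SuperAlg k} {S : Submonoid A.Even}

/-- The multiplied-out form of `locLift_frac`, free of the chosen inverse. -/
theorem mul_locLift_frac (f : A ⟶ B) (hf : ∀ s : S, IsUnit (evenMap f s)) (a : A) (s : S) :
    f s * locLift f hf (frac a s) = f a := by
  have h (x : A) : locLift f hf (frac x 1) = f x :=
    ConcreteCategory.congr_hom (locLift_toLoc f hf) x
  rw [← h, ← h, ← map_mul, frac_mul_frac, one_mul]
  congr 1
  exact A.frac_congr (by simp)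

theorem eq_frac_of_mul_eq {p : PrimeSpectrum A.Even} {x : A.atPrime p} {a : A} {f : A.Even}
    (hf : f ∈ A.compl p) (h : toLoc (A.compl p) f * x = toLoc (A.compl p) a) :
    x = frac a ⟨f, hf⟩ := by
  have hu : IsUnit (toLoc (A.compl p) f) :=
    (isUnit_toLoc (⟨f, hf⟩ : A.compl p)).map (A.atPrime p).evenSub.val
  refine hu.mul_left_cancel (h.trans ?_)
  rw [toLoc_apply, toLoc_apply, frac_mul_frac, one_mul]
  exact A.frac_congr (by simp)

end SuperAlg

namespace SuperSpace

variable {k : Type u} [CommRing k] (X : SuperSpace k)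

/-- Restriction of sections. -/
def res {U V : Opens X} (h : V ≤ U) : X.presheaf.obj (op U) ⟶ X.presheaf.obj (op V) :=
  X.presheaf.map (homOfLE h).op

variable {X}

theorem res_res {U V W : Opens X} (h : V ≤ U) (h' : W ≤ V) (s : X.presheaf.obj (op U)) :
    X.res h' (X.res h s) = X.res (h'.trans h) s := by
  unfold res
  rw [← ConcreteCategory.comp_apply, ← Functor.map_comp]
  rfl

theorem res_self {U : Opens X} (h : U ≤ U) (s : X.presheaf.obj (op U)) : X.res h s = s :=
  ConcreteCategory.congr_hom (X.presheaf.map_id (op U)) s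

end SuperSpace

namespace SuperSpace

open SuperAlg Scheme.Modules

variable {k : Type u} [CommRing k] {X : SuperSpace k} {hE : X.EvenIsScheme} {U : Opens X}

/-- The open subset `D(f)` for an even section `f` over `U`. -/
def basicOpen (hE : X.EvenIsScheme) (f : (X.presheaf.obj (op U)).Even) : Opens X :=
  (evenScheme hE).basicOpen (U := U) f

theorem basicOpen_le (f : (X.presheaf.obj (op U)).Even) : basicOpen hE f ≤ U :=
  (evenScheme hE).basicOpen_le (U := U) f

theorem isUnit_res_basicOpen (f : (X.presheaf.obj (op U)).Even) :
    IsUnit (evenMap (X.res (basicOpen_le (hE := hE) f)) f) :=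
  RingedSpace.isUnit_res_basicOpen X.even.toRingedSpace (U := U) f

/-- The even component is cleared by some `f ^ n` because `U` is affine in the even scheme, the odd
one by some `f ^ m` because the odd part is quasi-coherent. Cross-multiplication gives the common
exponent `n + m`. -/
theorem exists_res_eq_mul (hQ : (oddModules hE).IsQuasicoherent)
    (hU : IsAffineOpen (X := evenScheme hE) U)
    (f : (X.presheaf.obj (op U)).Even) (t : X.presheaf.obj (op (basicOpen hE f))) :
    ∃ (n : ℕ) (a : X.presheaf.obj (op U)), X.res (basicOpen_le (hE := hE) f) a =
      X.res (basicOpen_le (hE := hE) f) (f ^ n : (X.presheaf.obj (op U)).Even) * t := by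
  let r := X.res (basicOpen_le (hE := hE) f)
  let t0 : (X.presheaf.obj (op (basicOpen hE f))).Even := evenPart _ t
  let t1 : (X.presheaf.obj (op (basicOpen hE f))).part 1 := ⟨_, proj_mem _ 1 t⟩
  obtain ⟨n, a, ha⟩ : ∃ (n : ℕ) (a : (X.presheaf.obj (op U)).Even),
      evenMap r a = evenMap r (f ^ n) * t0 :=
    hU.exists_map_eq_pow_mul f t0
  obtain ⟨m, b, hb⟩ := exists_map_eq_pow_smul (M := oddModules hE) hU f t1
  let b' : (X.presheaf.obj (op U)).part 1 := b
  have ha' : r (a : X.presheaf.obj (op U)) =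
      r (f ^ n : (X.presheaf.obj (op U)).Even) * proj _ 0 t :=
    congrArg Subtype.val ha
  have hb' : r (b' : X.presheaf.obj (op U)) =
      r (f ^ m : (X.presheaf.obj (op U)).Even) * proj _ 1 t :=
    congrArg Subtype.val hb
  refine ⟨n + m, (f ^ m : (X.presheaf.obj (op U)).Even) * a +
    (f ^ n : (X.presheaf.obj (op U)).Even) * b', ?_⟩
  change r _ = r _ * t
  conv_rhs => rw [← proj_add_proj _ t]
  rw [map_add, map_mul, map_mul, ha', hb', mul_add, ← mul_assoc, ← mul_assoc, ← map_mul, ← map_mul]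
  have e1 : ((f ^ m : (X.presheaf.obj (op U)).Even) : X.presheaf.obj (op U)) *
      (f ^ n : (X.presheaf.obj (op U)).Even) = (f ^ (n + m) : (X.presheaf.obj (op U)).Even) :=
    congrArg Subtype.val (show f ^ m * f ^ n = f ^ (n + m) by ring)
  have e2 : ((f ^ n : (X.presheaf.obj (op U)).Even) : X.presheaf.obj (op U)) *
      (f ^ m : (X.presheaf.obj (op U)).Even) = (f ^ (n + m) : (X.presheaf.obj (op U)).Even) :=
    congrArg Subtype.val (pow_add f n m).symm
  rw [e1, e2]

/-- Restriction respects the grading, so both components of `a` vanish on `D(f)`; each is killed by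
a power of `f`. -/
theorem exists_pow_mul_eq_zero (hQ : (oddModules hE).IsQuasicoherent)
    (hU : IsAffineOpen (X := evenScheme hE) U) (f : (X.presheaf.obj (op U)).Even)
    (a : X.presheaf.obj (op U)) (ha : X.res (basicOpen_le (hE := hE) f) a = 0) :
    ∃ n : ℕ, (f ^ n : (X.presheaf.obj (op U)).Even) * a = 0 := by
  let r := X.res (basicOpen_le (hE := hE) f)
  let a0 : (X.presheaf.obj (op U)).Even := evenPart _ a
  let a1 : (X.presheaf.obj (op U)).part 1 := ⟨_, proj_mem _ 1 a⟩
  have h (i : ZMod 2) : r (proj _ i a) = 0 := by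
    rw [map_proj]
    exact (congrArg _ ha).trans (map_zero _)
  obtain ⟨n, hn⟩ : ∃ n : ℕ, f ^ n * a0 = 0 :=
    hU.exists_pow_mul_eq_zero f a0 (Subtype.ext (h 0))
  obtain ⟨m, hm⟩ := exists_pow_smul_eq_zero (M := oddModules hE) hU f a1 (Subtype.ext (h 1))
  have hn' : ((f ^ n : (X.presheaf.obj (op U)).Even) : X.presheaf.obj (op U)) * proj _ 0 a = 0 :=
    congrArg Subtype.val hn
  have hm' : ((f ^ m : (X.presheaf.obj (op U)).Even) : X.presheaf.obj (op U)) * proj _ 1 a = 0 :=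
    congrArg Subtype.val hm
  have e1 : ((f ^ m : (X.presheaf.obj (op U)).Even) : X.presheaf.obj (op U)) *
      (f ^ n : (X.presheaf.obj (op U)).Even) = (f ^ (n + m) : (X.presheaf.obj (op U)).Even) :=
    congrArg Subtype.val (show f ^ m * f ^ n = f ^ (n + m) by ring)
  have e2 : ((f ^ n : (X.presheaf.obj (op U)).Even) : X.presheaf.obj (op U)) *
      (f ^ m : (X.presheaf.obj (op U)).Even) = (f ^ (n + m) : (X.presheaf.obj (op U)).Even) :=
    congrArg Subtype.val (pow_add f n m).symm
  refine ⟨n + m, ?_⟩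
  rw [← proj_add_proj _ a, mul_add, ← e1, mul_assoc, hn', e1, ← e2, mul_assoc, hm']
  simp

/-! The chart of an affine open subset. -/

/-- The continuous map `Spec 𝒪(U)₀ → X` of an affine open subset `U`. -/
def chartBase (hU : IsAffineOpen (X := evenScheme hE) U) :
    PrimeSpectrum.Top (X.presheaf.obj (op U)).Even ⟶ X.carrier :=
  hU.fromSpec.base

section

variable (hU : IsAffineOpen (X := evenScheme hE) U)

theorem isOpenEmbedding_chartBase : Topology.IsOpenEmbedding (chartBase hU) :=
  hU.isOpenEmbedding_fromSpec

theorem range_chartBase : Set.range (chartBase hU) = U := hU.range_fromSpec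

theorem chartBase_mem_basicOpen_iff (f : (X.presheaf.obj (op U)).Even)
    (p : PrimeSpectrum (X.presheaf.obj (op U)).Even) :
    chartBase hU p ∈ basicOpen hE f ↔ f ∉ p.asIdeal := by
  have := congrArg (fun V : (Spec Γ(evenScheme hE, U)).Opens => p ∈ V)
    (hU.fromSpec_preimage_basicOpen f)
  exact iff_of_eq this

theorem exists_basicOpen_le {W : Opens X} (p : PrimeSpectrum (X.presheaf.obj (op U)).Even)
    (hp : chartBase hU p ∈ W) :
    ∃ f : (X.presheaf.obj (op U)).Even, f ∉ p.asIdeal ∧ basicOpen hE f ≤ W :=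
  hU.exists_basicOpen_le_of_fromSpec_mem p hp

end

end SuperSpace

/-! ### The charts of a superscheme are open immersions of spectra -/

namespace SuperSpace

open SuperAlg

variable {k : Type u} [CommRing k] {X : SuperSpace k} {hE : X.EvenIsScheme} {U : Opens X}

theorem isUnit_awayRes (f : (X.presheaf.obj (op U)).Even) {V : Opens X}
    (hV : V ≤ basicOpen hE f) :
    IsUnit (evenMap (X.res (hV.trans (basicOpen_le f))) f) := by
  have h := (isUnit_res_basicOpen (hE := hE) f).map (evenMap (X.res hV))
  have e : evenMap (X.res hV) (evenMap (X.res (basicOpen_le (hE := hE) f)) f) =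
      evenMap (X.res (hV.trans (basicOpen_le f))) f := Subtype.ext (res_res _ hV f.1)
  exact e ▸ h

theorem isUnit_res_coe {f : (X.presheaf.obj (op U)).Even} {V : Opens X}
    (hV : V ≤ basicOpen hE f) :
    IsUnit (X.res (hV.trans (basicOpen_le f)) (f : X.presheaf.obj (op U))) :=
  (isUnit_awayRes f hV).map (X.presheaf.obj (op V)).evenSub.val

/-- The morphism `𝒪(U)_f ⟶ 𝒪(D(f))`. -/
def awayRes (hE : X.EvenIsScheme) (f : (X.presheaf.obj (op U)).Even) :
    (X.presheaf.obj (op U)).away f ⟶ X.presheaf.obj (op (basicOpen hE f)) :=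
  awayLift (X.res (basicOpen_le f)) (isUnit_res_basicOpen f)

theorem mul_awayRes_frac (f : (X.presheaf.obj (op U)).Even) (a : X.presheaf.obj (op U))
    (s : Submonoid.powers f) :
    X.res (basicOpen_le (hE := hE) f) (s : X.presheaf.obj (op U)) * awayRes hE f (frac a s) =
      X.res (basicOpen_le (hE := hE) f) a :=
  mul_locLift_frac _ _ a s

theorem isUnit_res_powers (f : (X.presheaf.obj (op U)).Even) (s : Submonoid.powers f)
    {V : Opens X} (hV : V ≤ basicOpen hE f) :
    IsUnit (X.res (hV.trans (basicOpen_le f)) (s : X.presheaf.obj (op U))) := by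
  obtain ⟨_, n, rfl⟩ := s
  have := ((isUnit_awayRes f hV).pow n).map (X.presheaf.obj (op V)).evenSub.val
  rw [← map_pow] at this
  exact this

/-- Injectivity is `exists_pow_mul_eq_zero` and surjectivity is `exists_res_eq_mul`, after
cancelling the denominator, which is a unit on `D(f)`. -/
theorem awayRes_bijective (hQ : (oddModules hE).IsQuasicoherent)
    (hU : IsAffineOpen (X := evenScheme hE) U) (f : (X.presheaf.obj (op U)).Even) :
    Function.Bijective (awayRes hE f) := by
  constructor
  · rw [injective_iff_map_eq_zero]
    intro x hx
    obtain ⟨a, s, rfl⟩ := frac_surj x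
    have h := mul_awayRes_frac (hE := hE) f a s
    rw [hx, mul_zero] at h
    obtain ⟨n, hn⟩ := exists_pow_mul_eq_zero hQ hU f a h.symm
    exact frac_eq_zero_iff.2 ⟨⟨f ^ n, n, rfl⟩, hn⟩
  · intro t
    obtain ⟨n, a, ha⟩ := exists_res_eq_mul hQ hU f t
    let s : Submonoid.powers f := ⟨f ^ n, n, rfl⟩
    refine ⟨frac a s, (isUnit_res_powers f s le_rfl).mul_left_cancel ?_⟩
    exact (mul_awayRes_frac f a s).trans ha

/-- The difference `g a - f b` vanishes on `D(d)`, so some power of `d` kills it, and this power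
lies outside `𝔭`. -/
theorem frac_eq_of_res_eq (hQ : (oddModules hE).IsQuasicoherent)
    (hU : IsAffineOpen (X := evenScheme hE) U) {p : PrimeSpectrum (X.presheaf.obj (op U)).Even}
    {a b : X.presheaf.obj (op U)} {f g d : (X.presheaf.obj (op U)).Even}
    (hf : f ∈ (X.presheaf.obj (op U)).compl p) (hg : g ∈ (X.presheaf.obj (op U)).compl p)
    (hd : d ∉ p.asIdeal)
    (h : X.res (basicOpen_le (hE := hE) d) ((g : X.presheaf.obj (op U)) * a) =
      X.res (basicOpen_le (hE := hE) d) ((f : X.presheaf.obj (op U)) * b)) :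
    (frac a ⟨f, hf⟩ : (X.presheaf.obj (op U)).atPrime p) = frac b ⟨g, hg⟩ := by
  obtain ⟨n, hn⟩ := exists_pow_mul_eq_zero hQ hU d _
    ((map_sub (X.res (basicOpen_le (hE := hE) d)).toGradedAlgHom _ _).trans (sub_eq_zero.2 h))
  rw [mul_sub, sub_eq_zero] at hn
  exact frac_eq_iff.2 ⟨⟨d ^ n, pow_mem (S := (X.presheaf.obj (op U)).compl p) hd n⟩, hn⟩

/-- `s` is the fraction `a / f` on `D(d)`. -/
def IsFracOn (hE : X.EvenIsScheme) {W : Opens X} (s : X.presheaf.obj (op W))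
    (a : X.presheaf.obj (op U)) (f d : (X.presheaf.obj (op U)).Even) : Prop :=
  ∃ h : basicOpen hE d ≤ W, X.res (basicOpen_le d) (f : X.presheaf.obj (op U)) * X.res h s =
    X.res (basicOpen_le d) a

/-- On a basic neighbourhood of the point inside `V`, `D(d)` and `D(e)`, both `g a` and `f b` equal
`f g` times the common restriction of the two sections. -/
theorem IsFracOn.frac_eq (hQ : (oddModules hE).IsQuasicoherent)
    (hU : IsAffineOpen (X := evenScheme hE) U) {p : PrimeSpectrum (X.presheaf.obj (op U)).Even}
    {W W' V : Opens X} {s : X.presheaf.obj (op W)} {s' : X.presheaf.obj (op W')}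
    {a b : X.presheaf.obj (op U)} {f g d e : (X.presheaf.obj (op U)).Even}
    (hs : IsFracOn hE s a f d) (hs' : IsFracOn hE s' b g e) (hV : V ≤ W) (hV' : V ≤ W')
    (hss' : X.res hV s = X.res hV' s') (hpV : chartBase hU p ∈ V)
    (hf : f ∈ (X.presheaf.obj (op U)).compl p) (hg : g ∈ (X.presheaf.obj (op U)).compl p)
    (hd : d ∉ p.asIdeal) (he : e ∉ p.asIdeal) :
    (frac a ⟨f, hf⟩ : (X.presheaf.obj (op U)).atPrime p) = frac b ⟨g, hg⟩ := by
  obtain ⟨hdW, h⟩ := hs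
  obtain ⟨heW, h'⟩ := hs'
  obtain ⟨c, hc, hcV⟩ := exists_basicOpen_le hU (W := V ⊓ (basicOpen hE d ⊓ basicOpen hE e)) p
    ⟨hpV, (chartBase_mem_basicOpen_iff hU d p).2 hd, (chartBase_mem_basicOpen_iff hU e p).2 he⟩
  have i1 : basicOpen hE c ≤ V := hcV.trans inf_le_left
  have i2 : basicOpen hE c ≤ basicOpen hE d := (hcV.trans inf_le_right).trans inf_le_left
  have i3 : basicOpen hE c ≤ basicOpen hE e := (hcV.trans inf_le_right).trans inf_le_right
  refine frac_eq_of_res_eq hQ hU hf hg hc ?_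
  have e1 := congrArg (X.res i2) h
  have e2 := congrArg (X.res i3) h'
  have e3 := congrArg (X.res i1) hss'
  rw [map_mul, res_res, res_res, res_res] at e1 e2
  rw [res_res, res_res] at e3
  rw [map_mul, map_mul, ← e1, ← e2, ← e3, ← mul_assoc, ← mul_assoc]
  congr 1
  exact (X.presheaf.obj _).even_mul_comm (map_part _ g.2)

/-- On any `D(d)` inside `W` the section has the form `a / d ^ n`. -/
theorem exists_isFracOn (hQ : (oddModules hE).IsQuasicoherent)
    (hU : IsAffineOpen (X := evenScheme hE) U) (p : PrimeSpectrum (X.presheaf.obj (op U)).Even)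
    {W : Opens X} (hp : chartBase hU p ∈ W) (s : X.presheaf.obj (op W)) :
    ∃ (a : X.presheaf.obj (op U)) (f d : (X.presheaf.obj (op U)).Even),
      d ∉ p.asIdeal ∧ f ∉ p.asIdeal ∧ IsFracOn hE s a f d := by
  obtain ⟨d, hd, hdW⟩ := exists_basicOpen_le hU p hp
  obtain ⟨n, a, ha⟩ := exists_res_eq_mul hQ hU d (X.res hdW s)
  exact ⟨a, d ^ n, d, hd, fun h => hd (p.2.mem_of_pow_mem n h), hdW, ha.symm⟩

/-- The value at a point of an affine chart of a section. -/
def chartVal (hQ : (oddModules hE).IsQuasicoherent) (hU : IsAffineOpen (X := evenScheme hE) U)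
    (W : Opens X) (p : PrimeSpectrum (X.presheaf.obj (op U)).Even) (hp : chartBase hU p ∈ W) :
    X.presheaf.obj (op W) ⟶ (X.presheaf.obj (op U)).atPrime p :=
  let d := (exists_basicOpen_le hU p hp).choose
  have hd := (exists_basicOpen_le hU p hp).choose_spec
  have := isIso_of_bijective _ (awayRes_bijective hQ hU d)
  X.res hd.2 ≫ inv (awayRes hE d) ≫
    awayLift (toLoc _) (isUnit_toLoc (⟨d, hd.1⟩ : (X.presheaf.obj (op U)).compl p))

/-- This frees `chartVal` from the basic open set chosen in its definition: that choice also
represents `s` as a fraction, and two representations agree at `𝔭` by `IsFracOn.frac_eq`. -/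
theorem chartVal_eq (hQ : (oddModules hE).IsQuasicoherent)
    (hU : IsAffineOpen (X := evenScheme hE) U) {W : Opens X}
    {p : PrimeSpectrum (X.presheaf.obj (op U)).Even} (hp : chartBase hU p ∈ W)
    {s : X.presheaf.obj (op W)} {a : X.presheaf.obj (op U)}
    {f d : (X.presheaf.obj (op U)).Even} (hf : f ∈ (X.presheaf.obj (op U)).compl p)
    (hd : d ∉ p.asIdeal) (h : IsFracOn hE s a f d) :
    chartVal hQ hU W p hp s = frac a ⟨f, hf⟩ := by
  let e := (exists_basicOpen_le hU p hp).choose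
  have he := (exists_basicOpen_le hU p hp).choose_spec
  have := isIso_of_bijective _ (awayRes_bijective hQ hU e)
  obtain ⟨b, t, hbt⟩ := frac_surj (inv (awayRes hE e) (X.res he.2 s))
  have hb : awayRes hE e (frac b t) = X.res he.2 s := by
    rw [hbt]
    exact ConcreteCategory.congr_hom (IsIso.inv_hom_id (awayRes hE e)) _
  have ht : (t : (X.presheaf.obj (op U)).Even) ∈ (X.presheaf.obj (op U)).compl p := by
    obtain ⟨_, n, rfl⟩ := t
    exact pow_mem (S := (X.presheaf.obj (op U)).compl p) he.1 n
  have h1 : chartVal hQ hU W p hp s = frac b ⟨t, ht⟩ := by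
    refine eq_frac_of_mul_eq ht ?_
    have e0 : chartVal hQ hU W p hp s = awayLift (toLoc _)
        (isUnit_toLoc (⟨e, he.1⟩ : (X.presheaf.obj (op U)).compl p)) (frac b t) :=
      congrArg (awayLift (toLoc _)
        (isUnit_toLoc (⟨e, he.1⟩ : (X.presheaf.obj (op U)).compl p))) hbt.symm
    rw [e0]
    exact mul_locLift_frac _ _ b t
  rw [h1]
  refine IsFracOn.frac_eq hQ hU (s := s) (s' := s) ⟨he.2, ?_⟩ h le_rfl le_rfl rfl hp ht hf he.1 hd
  rw [← hb]
  exact mul_awayRes_frac e b t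

theorem chartVal_res (hQ : (oddModules hE).IsQuasicoherent)
    (hU : IsAffineOpen (X := evenScheme hE) U) (V W : Opens X) (i : V ⟶ W)
    (p : PrimeSpectrum (X.presheaf.obj (op U)).Even) (hp : chartBase hU p ∈ V)
    (s : X.presheaf.obj (op W)) :
    chartVal hQ hU V p hp (X.presheaf.map i.op s) = chartVal hQ hU W p (i.le hp) s := by
  obtain ⟨a, f, d, hd, hf, h⟩ := exists_isFracOn hQ hU p hp (X.presheaf.map i.op s)
  refine (chartVal_eq hQ hU hp hf hd h).trans (chartVal_eq hQ hU _ hf hd ?_).symm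
  obtain ⟨h1, h2⟩ := h
  refine ⟨h1.trans i.le, ?_⟩
  rw [← h2, ← res_res i.le h1]
  rfl

theorem chartVal_isLocallyFrac (hQ : (oddModules hE).IsQuasicoherent)
    (hU : IsAffineOpen (X := evenScheme hE) U) (W : Opens X) (s : X.presheaf.obj (op W))
    (p : PrimeSpectrum (X.presheaf.obj (op U)).Even) (hp : chartBase hU p ∈ W) :
    ∃ (V : Opens (PrimeSpectrum.Top (X.presheaf.obj (op U)).Even)) (_ : p ∈ V)
      (hV : ∀ q ∈ V, chartBase hU q ∈ W) (a : X.presheaf.obj (op U))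
      (f : (X.presheaf.obj (op U)).Even), ∀ q (hq : q ∈ V),
        ∃ hf : f ∈ (X.presheaf.obj (op U)).compl q,
          chartVal hQ hU W q (hV q hq) s = frac a ⟨f, hf⟩ := by
  obtain ⟨a, f, d, hd, hf, h⟩ := exists_isFracOn hQ hU p hp s
  refine ⟨PrimeSpectrum.basicOpen d ⊓ PrimeSpectrum.basicOpen f, ⟨hd, hf⟩, fun q hq => ?_, a, f,
    fun q hq => ⟨hq.2, chartVal_eq hQ hU _ hq.2 hq.1 h⟩⟩
  exact h.1 ((chartBase_mem_basicOpen_iff hU d q).2 hq.1)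

/-- The morphism `Spec 𝒪(U) → X` of an affine open subset `U`. -/
def chartAux (hQ : (oddModules hE).IsQuasicoherent) (hU : IsAffineOpen (X := evenScheme hE) U) :
    (X.presheaf.obj (op U)).spec.toPresheafedSpace ⟶ X.toPresheafedSpace :=
  presheafedHomOfVal (chartBase hU) (chartVal hQ hU) (chartVal_res hQ hU)
    (chartVal_isLocallyFrac hQ hU)

/-- The stalk criterion applies. If `f s = a` near the point and `v a = 0` with `v ∉ 𝔭`, then `s =
0` where `f` and `v` are invertible; conversely `a / f` is the value of the section `f⁻¹ a` over
`D(f)`. -/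
theorem isOpenImmersion_chartAux (hQ : (oddModules hE).IsQuasicoherent)
    (hU : IsAffineOpen (X := evenScheme hE) U) :
    PresheafedSpace.IsOpenImmersion (chartAux hQ hU) := by
  refine isOpenImmersion_of_val _ X.isSheaf (isOpenEmbedding_chartBase hU) (fun W s p hp h0 => ?_)
    fun p x => ?_
  · replace h0 : chartVal hQ hU W p hp s = 0 := h0
    replace hp : chartBase hU p ∈ W := hp
    obtain ⟨a, f, d, hd, hf, h⟩ := exists_isFracOn hQ hU p hp s
    rw [chartVal_eq hQ hU hp hf hd h, frac_eq_zero_iff] at h0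
    obtain ⟨v, hv⟩ := h0
    obtain ⟨hdW, e⟩ := h
    obtain ⟨c, hc, hcV⟩ := exists_basicOpen_le hU
      (W := basicOpen hE d ⊓ (basicOpen hE f ⊓ basicOpen hE v.1)) p
      ⟨(chartBase_mem_basicOpen_iff hU d p).2 hd, (chartBase_mem_basicOpen_iff hU f p).2 hf,
        (chartBase_mem_basicOpen_iff hU v.1 p).2 v.2⟩
    have i1 : basicOpen hE c ≤ basicOpen hE d := hcV.trans inf_le_left
    have i2 : basicOpen hE c ≤ basicOpen hE f := (hcV.trans inf_le_right).trans inf_le_left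
    have i3 : basicOpen hE c ≤ basicOpen hE v.1 := (hcV.trans inf_le_right).trans inf_le_right
    refine ⟨basicOpen hE c, homOfLE (i1.trans hdW), (chartBase_mem_basicOpen_iff hU c p).2 hc, ?_⟩
    have e1 := congrArg (X.res i1) e
    rw [map_mul, res_res, res_res, res_res] at e1
    have e2 := congrArg (X.res (i3.trans (basicOpen_le v.1))) hv
    rw [map_mul, map_zero] at e2
    have e3 := (isUnit_res_coe i3).mul_left_cancel (e2.trans (mul_zero _).symm)
    exact (isUnit_res_coe i2).mul_left_cancel ((e1.trans e3).trans (mul_zero _).symm)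
  · obtain ⟨a, f, hf, rfl⟩ := atPrime_surj x
    have hu := isUnit_res_coe (hE := hE) (f := f) le_rfl
    have hp : chartBase hU p ∈ basicOpen hE f := (chartBase_mem_basicOpen_iff hU f p).2 hf
    refine ⟨basicOpen hE f, hp, (hu.unit⁻¹ : (X.presheaf.obj (op (basicOpen hE f)))ˣ).1 *
      X.res (basicOpen_le f) a, ?_⟩
    refine chartVal_eq hQ hU hp hf hf ⟨le_rfl, ?_⟩
    rw [res_self, ← mul_assoc]
    exact (congrArg (· * _) hu.mul_val_inv).trans (one_mul _)

/-- The open immersion `Spec 𝒪(U) → X` of an affine open subset `U`. -/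
def chart (hQ : (oddModules hE).IsQuasicoherent) (hU : IsAffineOpen (X := evenScheme hE) U) :
    (X.presheaf.obj (op U)).spec ⟶ X :=
  have := isOpenImmersion_chartAux hQ hU
  homOfOpenImmersion (chartAux hQ hU)

theorem range_chart (hQ : (oddModules hE).IsQuasicoherent)
    (hU : IsAffineOpen (X := evenScheme hE) U) : Set.range (chart hQ hU).base = U :=
  range_chartBase hU

end SuperSpace

/-! ### Functors of points of superschemes -/

namespace SuperFunctor

open SuperAlg

variable {k : Type u} [CommRing k] {F G : SuperAlg.{u} k ⥤ Type u}

theorem hom_inv_app_apply (e : F ≅ G) {A : SuperAlg k} (a : F.obj A) :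
    e.inv.app A (e.hom.app A a) = a :=
  ConcreteCategory.congr_hom (e.hom_inv_id_app A) a

theorem inv_hom_app_apply (e : F ≅ G) {A : SuperAlg k} (b : G.obj A) :
    e.hom.app A (e.inv.app A b) = b :=
  ConcreteCategory.congr_hom (e.inv_hom_id_app A) b

theorem IsLocal.of_iso (e : F ≅ G) (hG : IsLocal G) : IsLocal F := by
  intro A I f hf α hα
  obtain ⟨b, hb, hu⟩ := hG A I f hf (fun i => e.hom.app _ (α i)) fun i j => by
    rw [← NatTrans.naturality_apply, ← NatTrans.naturality_apply, hα]
  refine ⟨e.inv.app A b, fun i => ?_, fun a ha => ?_⟩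
  · rw [← NatTrans.naturality_apply, hb, hom_inv_app_apply]
  · rw [← hu (e.hom.app A a) fun i => ?_, hom_inv_app_apply]
    rw [← NatTrans.naturality_apply, ha]

variable {X : SuperSpace k}

/-- The morphism which corresponds to an element of `F(A)`. -/
def toSpecHom (e : F ≅ X.functorOfPoints) {A : SuperAlg k} (a : F.obj A) : A.spec ⟶ X :=
  e.hom.app A a

theorem toSpecHom_map (e : F ≅ X.functorOfPoints) {A B : SuperAlg k} (φ : A ⟶ B) (a : F.obj A) :
    toSpecHom e (F.map φ a) = specMap φ ≫ toSpecHom e a :=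
  NatTrans.naturality_apply e.hom φ a

/-- The element of `F(A)` which corresponds to a morphism. -/
def ofSpecPoint (e : F ≅ X.functorOfPoints) {A : SuperAlg k} (g : A.spec ⟶ X) : F.obj A :=
  e.inv.app A g

theorem map_ofSpecPoint (e : F ≅ X.functorOfPoints) {A B : SuperAlg k} (φ : A ⟶ B)
    (g : A.spec ⟶ X) : F.map φ (ofSpecPoint e g) = ofSpecPoint e (specMap φ ≫ g) :=
  (NatTrans.naturality_apply e.inv φ g).symm

theorem toSpecHom_ofSpecPoint (e : F ≅ X.functorOfPoints) {A : SuperAlg k} (g : A.spec ⟶ X) :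
    toSpecHom e (ofSpecPoint e g) = g := inv_hom_app_apply e _

theorem ofSpecPoint_toSpecHom (e : F ≅ X.functorOfPoints) {A : SuperAlg k} (a : F.obj A) :
    ofSpecPoint e (toSpecHom e a) = a := hom_inv_app_apply e a

/-- The subfunctor of the elements which correspond to morphisms into an open subset. -/
def subfunctorOfOpen (e : F ≅ X.functorOfPoints) (V : Opens X) : Subfunctor F where
  obj R := {a | ∀ q, (toSpecHom e a).base q ∈ V}
  map {R S} φ a ha q := by
    rw [toSpecHom_map]
    exact ha (comap φ q)

theorem isLocus_subfunctorOfOpen (e : F ≅ X.functorOfPoints) (V : Opens X) {A : SuperAlg k}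
    (a : F.obj A) :
    IsLocus (subfunctorOfOpen e V) a ((Opens.map (toSpecHom e a).base).obj V) := by
  intro R φ
  change (∀ q, (toSpecHom e (F.map φ a)).base q ∈ V) ↔ _
  rw [toSpecHom_map]
  rfl

/-- The universal element is the one corresponding to `g`: a morphism from `Spec R` into `V` lifts
uniquely through the open immersion `g`, and the lift is `specMap φ` for a unique `φ`. -/
theorem isOpenAffine_subfunctorOfOpen (e : F ≅ X.functorOfPoints) (V : Opens X) {B : SuperAlg k}
    (g : B.spec ⟶ X) [SuperSpace.IsOpenImmersion g] (hg : Set.range g.base = V) :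
    IsOpenAffine (subfunctorOfOpen e V) := by
  refine ⟨(isOpen_iff _).2 fun A a => ⟨_, isLocus_subfunctorOfOpen e V a⟩,
    (isCorepresentable_iff _).2 ⟨B, ofSpecPoint e g, ?_, fun R y hy => ?_⟩⟩
  · change ∀ q, (toSpecHom e (ofSpecPoint e g)).base q ∈ V
    rw [toSpecHom_ofSpecPoint]
    exact fun q => hg.le ⟨q, rfl⟩
  · obtain ⟨l, hl⟩ := SuperSpace.exists_lift g (toSpecHom e y) fun q => hg.ge (hy q)
    refine ⟨ofSpecHom l, ?_, fun φ hφ => ?_⟩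
    · change F.map (ofSpecHom l) _ = y
      rw [map_ofSpecPoint, specMap_ofSpecHom, hl, ofSpecPoint_toSpecHom]
    · have h1 : specMap φ ≫ g = toSpecHom e y := by
        rw [← hφ, map_ofSpecPoint, toSpecHom_ofSpecPoint]
      rw [← SuperSpace.cancel_openImmersion g (h1.trans hl.symm), ofSpecHom_specMap]

theorem exists_isOpenAffine_cover (X : SuperScheme k)
    (e : F ≅ X.toSuperSpace.functorOfPoints) :
    ∃ (I : Type u) (U : I → Subfunctor F), (∀ i, IsOpenAffine (U i)) ∧ IsOpenCover U := by
  let Y : Scheme.{u} := SuperSpace.evenScheme X.evenIsScheme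
  choose V hV hxV _ using fun y : Y =>
    exists_isAffineOpen_mem_and_subset (X := Y) (x := y) (U := ⊤) trivial
  let V' (x : X.toSuperSpace) : Opens X.toSuperSpace := V x
  -- The cover is indexed by the points of `X`, with one affine open neighbourhood for each; this
  -- keeps the index set in the universe `u`.
  refine ⟨X.toSuperSpace, fun x => subfunctorOfOpen e (V' x), fun x => ?_, ?_⟩
  · let g := SuperSpace.chart (U := V' x) X.quasicoherent (hV x)
    have : SuperSpace.IsOpenImmersion g := SuperSpace.isOpenImmersion_chartAux _ _
    exact isOpenAffine_subfunctorOfOpen e (V' x) g (SuperSpace.range_chart _ _)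
  · refine (isOpenCover_iff _).2 fun A a => ⟨_, fun x => isLocus_subfunctorOfOpen e (V' x) a, ?_⟩
    exact top_le_iff.1 fun p _ => Opens.mem_iSup.2 ⟨_, hxV _⟩

end SuperFunctor

/-! ### Affine atlases of functors -/

namespace SuperAlg

variable {k : Type u} [CommRing k] {A B C : SuperAlg k}

theorem locMap_locMap {φ : A ⟶ B} {ψ : B ⟶ C} {χ : A ⟶ C} (e : φ ≫ ψ = χ)
    {p : PrimeSpectrum A.Even} {q : PrimeSpectrum B.Even} {r : PrimeSpectrum C.Even}
    (h : comap φ q = p) (h' : comap ψ r = q) (h'' : comap χ r = p) (x : A.atPrime p) :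
    locMap ψ h' (locMap φ h x) = locMap χ h'' x := by
  subst e
  exact (locMap_comp φ ψ h h' h'' x).symm

end SuperAlg

namespace SuperFunctor

open SuperAlg

variable {k : Type u} [CommRing k]

/-- A cover of a functor by open subfunctors with universal elements `gen i : F (B i)`. -/
structure Atlas (F : SuperAlg.{u} k ⥤ Type u) where
  I : Type u
  U : I → Subfunctor F
  B : I → SuperAlg k
  gen : ∀ i, F.obj (B i)
  gen_mem : ∀ i, gen i ∈ (U i).obj (B i)
  existsUnique : ∀ i (R : SuperAlg k) (y : F.obj R), y ∈ (U i).obj R →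
    ∃! φ : B i ⟶ R, F.map φ (gen i) = y
  locus : ∀ (_ : I) (A : SuperAlg k) (_ : F.obj A), Opens (PrimeSpectrum.Top A.Even)
  isLocus : ∀ i (A : SuperAlg k) (a : F.obj A), IsLocus (U i) a (locus i A a)
  iSup_locus : ∀ (A : SuperAlg k) (a : F.obj A), ⨆ i, locus i A a = ⊤

variable {F : SuperAlg.{u} k ⥤ Type u}

theorem nonempty_atlas {I : Type u} (U : I → Subfunctor F) (h : ∀ i, IsOpenAffine (U i))
    (hU : IsOpenCover U) : Nonempty (Atlas F) := by
  choose B gen gen_mem existsUnique using fun i => (isCorepresentable_iff (U i)).1 (h i).2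
  choose V hV hc using (isOpenCover_iff U).1 hU
  exact ⟨⟨I, U, B, gen, gen_mem, existsUnique, fun i A a => V A a i, fun i A a => hV A a i, hc⟩⟩

namespace Atlas

variable (T : Atlas F)

theorem hom_unique {i : T.I} {R : SuperAlg k} {φ ψ : T.B i ⟶ R}
    (h : F.map φ (T.gen i) = F.map ψ (T.gen i)) : φ = ψ :=
  (T.existsUnique i R _ ((T.U i).map ψ (T.gen_mem i))).unique h rfl

/-- Two points of the charts are related if they come from a point of an overlap. -/
def Rel {i j : T.I} (p : PrimeSpectrum (T.B i).Even) (q : PrimeSpectrum (T.B j).Even) : Prop :=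
  ∃ (A : SuperAlg k) (φ : T.B i ⟶ A) (ψ : T.B j ⟶ A) (r : PrimeSpectrum A.Even),
    F.map φ (T.gen i) = F.map ψ (T.gen j) ∧ comap φ r = p ∧ comap ψ r = q

variable {T} {i j l : T.I} {p : PrimeSpectrum (T.B i).Even} {q : PrimeSpectrum (T.B j).Even}
  {t : PrimeSpectrum (T.B l).Even}

theorem Rel.refl : T.Rel p p := ⟨_, 𝟙 _, 𝟙 _, p, rfl, rfl, rfl⟩

theorem Rel.symm (h : T.Rel p q) : T.Rel q p := by
  obtain ⟨A, φ, ψ, r, h, hφ, hψ⟩ := h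
  exact ⟨A, ψ, φ, r, h.symm, hψ, hφ⟩

/-- No two points of one chart are identified: two morphisms out of `B i` that agree on the
universal element are equal. -/
theorem Rel.eq {p p' : PrimeSpectrum (T.B i).Even} (h : T.Rel p p') : p = p' := by
  obtain ⟨A, φ, ψ, r, h, rfl, rfl⟩ := h
  rw [T.hom_unique h]

variable (T) in
/-- A transition map from a basic open subset of the `i`-th chart to the `j`-th chart. -/
structure Transition (i j : T.I) where
  g : (T.B i).Even
  hom : T.B j ⟶ (T.B i).away g
  map_hom : F.map hom (T.gen j) = F.map ((T.B i).toAway g) (T.gen i)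

/-- On a basic open set inside the locus, the restriction of `gen i` belongs to the `j`-th
subfunctor and hence comes from a morphism out of `B j`. -/
theorem exists_transition_of_mem_locus (j : T.I) (h : p ∈ T.locus j (T.B i) (T.gen i)) :
    ∃ θ : T.Transition i j, θ.g ∉ p.asIdeal := by
  obtain ⟨_, ⟨_, ⟨g, rfl⟩, rfl⟩, hp, hg⟩ :=
    PrimeSpectrum.isBasis_basic_opens.exists_subset_of_mem_open h
    (T.locus j (T.B i) (T.gen i)).2
  obtain ⟨θ, hθ, -⟩ := T.existsUnique j _ (F.map ((T.B i).toAway g) (T.gen i))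
    ((T.isLocus j _ _ _ _).2 fun q => hg (notMem_comap_toAway q))
  exact ⟨⟨g, θ, hθ⟩, hp⟩

/-- The overlap `A` itself shows that `p` is in the locus: `φ(gen i) = ψ(gen j)` lies in the `j`-th
subfunctor, so `Spec φ` lands in that locus. -/
theorem Rel.exists_transition (h : T.Rel p q) : ∃ θ : T.Transition i j, θ.g ∉ p.asIdeal := by
  obtain ⟨A, φ, ψ, r, h, rfl, rfl⟩ := h
  refine exists_transition_of_mem_locus j ((T.isLocus j _ _ A φ).1 ?_ r)
  rw [h]
  exact (T.U j).map ψ (T.gen_mem j)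

theorem Transition.rel (θ : T.Transition i j) (p' : PrimeSpectrum ((T.B i).away θ.g).Even) :
    T.Rel (comap ((T.B i).toAway θ.g) p') (comap θ.hom p') :=
  ⟨_, _, _, p', θ.map_hom.symm, rfl, rfl⟩

/-- Both sides send `gen j` to the same element of `F(A_{φ g})`. Thus every overlap factors, after
localization, through the one given by the transition map. -/
theorem Transition.hom_comp (θ : T.Transition i j) {A : SuperAlg k} {φ : T.B i ⟶ A}
    {ψ : T.B j ⟶ A} (h : F.map φ (T.gen i) = F.map ψ (T.gen j)) :
    θ.hom ≫ awayFunctoriality θ.g φ = ψ ≫ A.toAway (evenMap φ θ.g) := by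
  refine T.hom_unique ?_
  rw [Functor.map_comp_apply, θ.map_hom, ← Functor.map_comp_apply, toAway_awayFunctoriality,
    Functor.map_comp_apply, h, Functor.map_comp_apply]

theorem Transition.exists_point (θ : T.Transition i j) {A : SuperAlg k} (φ : T.B i ⟶ A)
    {r : PrimeSpectrum A.Even} {p' : PrimeSpectrum ((T.B i).away θ.g).Even}
    (h : comap φ r = comap ((T.B i).toAway θ.g) p') :
    ∃ r', comap (A.toAway (evenMap φ θ.g)) r' = r ∧ comap (awayFunctoriality θ.g φ) r' = p' := by
  obtain ⟨r', rfl⟩ := exists_comap_toAway (A := A) (f := evenMap φ θ.g) (p := r) (fun hm =>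
    notMem_comap_toAway p' (h ▸ hm))
  refine ⟨r', rfl, (isOpenEmbedding_comap_toAway θ.g).injective (Eq.trans ?_ h)⟩
  exact congrArg (fun χ => comap χ r') (toAway_awayFunctoriality (f := θ.g) φ)

/-- The point `r` of the overlap lifts to the localized overlap, where `ψ` factors through the
transition map. So the transition map computes the only point of the `j`-th chart related to `p`. -/
theorem Transition.comap_eq (θ : T.Transition i j)
    {p' : PrimeSpectrum ((T.B i).away θ.g).Even} (hp : comap ((T.B i).toAway θ.g) p' = p)
    (h : T.Rel p q) : comap θ.hom p' = q := by
  subst hp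
  obtain ⟨A, φ, ψ, r, h, hφ, rfl⟩ := h
  obtain ⟨r', rfl, rfl⟩ := θ.exists_point φ hφ
  exact congrArg (fun χ => comap χ r') (θ.hom_comp h)

/-- No pushout of superalgebras is needed: a transition map at `q` towards the `i`-th chart, pushed
into a localization of the overlap of `q` and `t`, turns this into an overlap of `p` and `t`. -/
theorem Rel.trans (h : T.Rel p q) (h' : T.Rel q t) : T.Rel p t := by
  obtain ⟨θ, hθ⟩ := h.symm.exists_transition
  obtain ⟨q', rfl⟩ := exists_comap_toAway hθ
  obtain rfl := θ.comap_eq rfl h.symm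
  obtain ⟨A, φ, ψ, r, e, hφ, rfl⟩ := h'
  obtain ⟨r', rfl, rfl⟩ := θ.exists_point φ hφ
  refine ⟨_, θ.hom ≫ awayFunctoriality θ.g φ, ψ ≫ A.toAway _, r', ?_, rfl, rfl⟩
  rw [Functor.map_comp_apply, θ.map_hom, ← Functor.map_comp_apply, toAway_awayFunctoriality,
    Functor.map_comp_apply, e, Functor.map_comp_apply]

/-- Elements of the stalks of two charts which have the same image in all overlaps. -/
def Compat (x : (T.B i).atPrime p) (y : (T.B j).atPrime q) : Prop :=
  ∀ (A : SuperAlg k) (φ : T.B i ⟶ A) (ψ : T.B j ⟶ A) (r : PrimeSpectrum A.Even)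
    (hφ : comap φ r = p) (hψ : comap ψ r = q), F.map φ (T.gen i) = F.map ψ (T.gen j) →
      locMap φ hφ x = locMap ψ hψ y

theorem Compat.symm {x : (T.B i).atPrime p} {y : (T.B j).atPrime q} (h : Compat x y) :
    Compat y x := fun A φ ψ r hφ hψ e => (h A ψ φ r hψ hφ e.symm).symm

theorem Compat.eq {x y : (T.B i).atPrime p} (h : Compat x y) : x = y := by
  exact (locMap_id rfl x).symm.trans ((h _ (𝟙 _) (𝟙 _) p rfl rfl rfl).trans (locMap_id rfl y))

/-- Compatibility can be checked on the overlap given by a transition map. -/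
theorem Transition.compat (θ : T.Transition i j)
    {p' : PrimeSpectrum ((T.B i).away θ.g).Even} (hp : comap ((T.B i).toAway θ.g) p' = p)
    (hq : comap θ.hom p' = q) {x : (T.B i).atPrime p} {y : (T.B j).atPrime q}
    (h : locMap ((T.B i).toAway θ.g) hp x = locMap θ.hom hq y) : Compat x y := by
  subst hp hq
  intro A φ ψ r hφ hψ e
  obtain ⟨r', rfl, hr'⟩ := θ.exists_point φ hφ
  refine locMap_toLoc_injective (S := Submonoid.powers (evenMap φ θ.g)) (q := r') rfl ?_
  have e1 := toAway_awayFunctoriality (f := θ.g) φ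
  have e2 := θ.hom_comp e
  have h1 : locMap (A.toAway (evenMap φ θ.g)) rfl (locMap φ hφ x) =
      locMap (awayFunctoriality θ.g φ) hr' (locMap ((T.B i).toAway θ.g) rfl x) :=
    (locMap_locMap rfl hφ rfl hφ x).trans (locMap_locMap e1 rfl hr' hφ x).symm
  have h2 : locMap (A.toAway (evenMap φ θ.g)) rfl (locMap ψ hψ y) =
      locMap (awayFunctoriality θ.g φ) hr' (locMap θ.hom rfl y) :=
    (locMap_locMap rfl hψ rfl hψ y).trans (locMap_locMap e2 rfl hr' hψ y).symm
  exact h1.trans ((congrArg _ h).trans h2.symm)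

/-- The transition map sends `y` into the stalk of a localization of `B i`, which is the stalk of `B
i`. -/
theorem Rel.exists_compat (h : T.Rel p q) (y : (T.B j).atPrime q) :
    ∃ x : (T.B i).atPrime p, Compat x y := by
  obtain ⟨θ, hθ⟩ := h.exists_transition
  obtain ⟨p', hp⟩ := exists_comap_toAway hθ
  have hq := θ.comap_eq hp h
  obtain ⟨x, hx⟩ := (locMap_toLoc_bijective hp).2 (locMap θ.hom hq y)
  exact ⟨x, θ.compat hp hq hx⟩

/-- A test overlap of the charts `i` and `l` is localized so that a transition map to the chart `j`
becomes available; the localization is injective on stalks. The hypothesis `hr` is needed because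
`Compat` is vacuous for unrelated points. -/
theorem Compat.trans {x : (T.B i).atPrime p} {y : (T.B j).atPrime q} {z : (T.B l).atPrime t}
    (h : Compat x y) (h' : Compat y z) (hr : T.Rel p q) : Compat x z := by
  obtain ⟨θ, hθ⟩ := hr.exists_transition
  obtain ⟨p', rfl⟩ := exists_comap_toAway hθ
  have hq := θ.comap_eq rfl hr
  intro A φ ψ r hφ hψ e
  obtain ⟨r', rfl, hr'⟩ := θ.exists_point φ hφ
  have e1 : F.map (φ ≫ A.toAway (evenMap φ θ.g)) (T.gen i) =
      F.map (θ.hom ≫ awayFunctoriality θ.g φ) (T.gen j) := by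
    rw [← toAway_awayFunctoriality, Functor.map_comp_apply, ← θ.map_hom, Functor.map_comp_apply]
  have e2 : F.map (φ ≫ A.toAway (evenMap φ θ.g)) (T.gen i) =
      F.map (ψ ≫ A.toAway (evenMap φ θ.g)) (T.gen l) := by
    rw [Functor.map_comp_apply, e, Functor.map_comp_apply]
  have hq' : comap (θ.hom ≫ awayFunctoriality θ.g φ) r' = q :=
    (congrArg (comap θ.hom) hr').trans hq
  have h1 := (h _ _ _ r' hφ hq' e1).trans (h' _ _ _ r' hq' hψ (e1.symm.trans e2))
  refine locMap_toLoc_injective (S := Submonoid.powers (evenMap φ θ.g)) (q := r') rfl ?_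
  exact (locMap_locMap rfl hφ rfl hφ x).trans (h1.trans (locMap_locMap rfl hψ rfl hψ z).symm)

end Atlas

end SuperFunctor

/-! ### Gluing the charts of an atlas -/

namespace SuperFunctor.Atlas

open SuperAlg

variable {k : Type u} [CommRing k] {F : SuperAlg.{u} k ⥤ Type u} (T : Atlas F)

/-- The equivalence relation on the disjoint union of the charts. -/
def setoid : Setoid (Σ i, PrimeSpectrum (T.B i).Even) where
  r x y := T.Rel x.2 y.2
  iseqv := ⟨fun _ => Rel.refl, Rel.symm, Rel.trans⟩

/-- The space obtained by gluing the charts. -/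
def space : TopCat.{u} := TopCat.of (Quotient T.setoid)

/-- The map from a chart to the glued space. -/
def toSpace (i : T.I) : PrimeSpectrum.Top (T.B i).Even ⟶ T.space :=
  TopCat.ofHom ⟨fun p => Quotient.mk T.setoid ⟨i, p⟩,
    continuous_quotient_mk'.comp continuous_sigmaMk⟩

variable {T} {i j : T.I} {p : PrimeSpectrum (T.B i).Even} {q : PrimeSpectrum (T.B j).Even}

theorem exists_toSpace_eq (x : T.space) : ∃ i p, T.toSpace i p = x := by
  obtain ⟨⟨i, p⟩, rfl⟩ := Quotient.exists_rep x
  exact ⟨i, p, rfl⟩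

theorem toSpace_eq_iff : T.toSpace i p = T.toSpace j q ↔ T.Rel p q := Quotient.eq

theorem isOpen_space_iff {W : Set T.space} :
    _root_.IsOpen W ↔ ∀ i, _root_.IsOpen (T.toSpace i ⁻¹' W) :=
  isOpen_coinduced.trans isOpen_sigma_iff

/-- Injectivity is `Rel.eq`. For openness, seen in the chart `j` the image of `V` contains, near
each of its points, the open set which a transition map carries into `V`. -/
theorem isOpenEmbedding_toSpace (i : T.I) : Topology.IsOpenEmbedding (T.toSpace i) := by
  refine .of_continuous_injective_isOpenMap (T.toSpace i).hom.continuous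
    (fun p q h => (toSpace_eq_iff.1 h).eq) fun V hV => isOpen_space_iff.2 fun j => ?_
  rw [isOpen_iff_mem_nhds]
  rintro q ⟨p, hp, e⟩
  have hr := (toSpace_eq_iff.1 e).symm
  obtain ⟨θ, hθ⟩ := hr.exists_transition
  obtain ⟨q', rfl⟩ := exists_comap_toAway hθ
  obtain rfl := θ.comap_eq rfl hr
  refine Filter.mem_of_superset (((isOpenEmbedding_comap_toAway θ.g).isOpenMap _
    (hV.preimage (PrimeSpectrum.continuous_comap (evenMap θ.hom)))).mem_nhds ⟨q', hp, rfl⟩) ?_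
  rintro _ ⟨r, hr, rfl⟩
  exact ⟨comap θ.hom r, hr, toSpace_eq_iff.2 (θ.rel r).symm⟩

variable (T) in
/-- The sections over `W` of the glued sheaf: compatible families of sections over the charts. -/
def sections (W : Opens T.space) :
    Subalgebra k (∀ i, (T.B i).sections ((Opens.map (T.toSpace i)).obj W)) where
  carrier := {s | ∀ (i j : T.I) (p : PrimeSpectrum (T.B i).Even) (q : PrimeSpectrum (T.B j).Even)
    (hp : T.toSpace i p ∈ W) (hq : T.toSpace j q ∈ W), Compat ((s i).1 ⟨p, hp⟩) ((s j).1 ⟨q, hq⟩)}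
  mul_mem' hs ht i j p q hp hq A φ ψ r hφ hψ e :=
    (map_mul (locMap φ hφ).toGradedAlgHom _ _).trans
      ((congrArg₂ (· * ·) (hs i j p q hp hq A φ ψ r hφ hψ e)
        (ht i j p q hp hq A φ ψ r hφ hψ e)).trans
        (map_mul (locMap ψ hψ).toGradedAlgHom _ _).symm)
  add_mem' hs ht i j p q hp hq A φ ψ r hφ hψ e :=
    (map_add (locMap φ hφ).toGradedAlgHom _ _).trans
      ((congrArg₂ (· + ·) (hs i j p q hp hq A φ ψ r hφ hψ e)
        (ht i j p q hp hq A φ ψ r hφ hψ e)).trans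
        (map_add (locMap ψ hψ).toGradedAlgHom _ _).symm)
  algebraMap_mem' a _ _ _ _ _ _ _ φ ψ _ hφ hψ _ :=
    ((locMap φ hφ).toGradedAlgHom.commutes a).trans ((locMap ψ hψ).toGradedAlgHom.commutes a).symm

variable (T) in
/-- The homogeneous sections of degree `n` of the glued sheaf. -/
def sectionsPart (W : Opens T.space) (n : ZMod 2) : Submodule k (T.sections W) where
  carrier := {s | ∀ i, s.1 i ∈ (T.B i).sectionsPart _ n}
  zero_mem' _ := zero_mem _
  add_mem' hs ht i := add_mem (hs i) (ht i)
  smul_mem' r _ hs i := Submodule.smul_mem _ r (hs i)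

/-- The homogeneous component of degree `n` of a section of the glued sheaf. -/
def sectionsProj {W : Opens T.space} (n : ZMod 2) (s : T.sections W) : T.sections W :=
  ⟨fun i => (T.B i).sectionsProj n (s.1 i), fun i j p q hp hq A φ ψ r hφ hψ e =>
    (map_proj (locMap φ hφ) n _).trans ((congrArg _ (s.2 i j p q hp hq A φ ψ r hφ hψ e)).trans
      (map_proj (locMap ψ hψ) n _).symm)⟩

variable (T) in
/-- The superalgebra of sections of the glued sheaf. -/
def sectionsAlg (W : Opens T.space) : SuperAlg k :=
  mk' (T.sections W) (T.sectionsPart W)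
    (by exact fun i p => ((T.B i).atPrime p.1).evenSub.one_mem)
    (by exact fun m n a b ha hb i p => SetLike.mul_mem_graded (ha i p) (hb i p))
    (by
      constructor
      · rw [Submodule.disjoint_def]
        intro s h0 h1
        refine Subtype.ext (funext fun i => ?_)
        exact ((proj_of_mem ((T.B i).sectionsAlg _) (h0 i)).symm.trans
          (proj_of_mem_ne ((T.B i).sectionsAlg _) (h1 i) (by decide)))
      · rw [codisjoint_iff, eq_top_iff]
        rintro s -
        refine Submodule.mem_sup.2 ⟨sectionsProj 0 s, fun i p => proj_mem _ 0 _,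
          sectionsProj 1 s, fun i p => proj_mem _ 1 _,
          Subtype.ext (funext fun i => Subtype.ext (funext fun p => ?_))⟩
        exact proj_add_proj ((T.B i).atPrime p.1) ((s.1 i).1 p))
    (by
      refine fun m n a b ha hb => Subtype.ext (funext fun i => Subtype.ext (funext fun p => ?_))
      refine (((T.B i).atPrime p.1).supercomm m n _ _ (ha i p) (hb i p)).trans ?_
      simp)

/-- The value of a section of the glued sheaf at a point of a chart. -/
def eval (i : T.I) {W : Opens T.space} (p : PrimeSpectrum (T.B i).Even) (hp : T.toSpace i p ∈ W) :
    T.sectionsAlg W ⟶ (T.B i).atPrime p :=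
  homMk (A := T.sectionsAlg W)
    { toFun := fun s => (s.1 i).1 ⟨p, hp⟩
      map_one' := rfl
      map_mul' := fun _ _ => rfl
      map_zero' := rfl
      map_add' := fun _ _ => rfl
      commutes' := fun _ => rfl }
    (fun _ _ hs => hs i ⟨p, hp⟩)

theorem sectionsAlg_ext {W : Opens T.space} {s t : T.sectionsAlg W}
    (h : ∀ i p (hp : T.toSpace i p ∈ W), eval i p hp s = eval i p hp t) : s = t :=
  Subtype.ext (funext fun i => Subtype.ext (funext fun p => h i p.1 p.2))

theorem eval_compat {W : Opens T.space} (s : T.sectionsAlg W) (hp : T.toSpace i p ∈ W)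
    (hq : T.toSpace j q ∈ W) : Compat (eval i p hp s) (eval j q hq s) := s.2 i j p q hp hq

variable (T) in
/-- The glued sheaf, as a presheaf. -/
def presheaf : T.space.Presheaf (SuperAlg k) where
  obj W := T.sectionsAlg W.unop
  map {W W'} f := homMk (A := T.sectionsAlg _) (B := T.sectionsAlg _)
    { toFun := fun s => ⟨fun i => (T.B i).sectionsRes
          (V := (Opens.map (T.toSpace i)).obj W'.unop) (fun _ h => f.unop.le h) (s.1 i),
        fun i j p q hp hq => s.2 i j p q (f.unop.le hp) (f.unop.le hq)⟩
      map_one' := rfl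
      map_mul' := fun _ _ => rfl
      map_zero' := rfl
      map_add' := fun _ _ => rfl
      commutes' := fun _ => rfl }
    (fun _ _ hs i p => hs i ⟨p.1, f.unop.le p.2⟩)

variable (T) in
-- Sections are functions to stalks subject to local conditions, so gluing selects at each point one
-- of the given sections; `key` shows that the selection does not matter.
theorem isSheaf_presheaf : TopCat.Presheaf.IsSheaf (T.presheaf ⋙ forget (SuperAlg k)) := by
  refine TopCat.Presheaf.isSheaf_of_isSheafUniqueGluing_types _ fun J W s hs => ?_
  let s' (a : J) : T.sectionsAlg (W a) := s a
  have key (a b : J) (i : T.I) (p : PrimeSpectrum (T.B i).Even) (ha : T.toSpace i p ∈ W a)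
      (hb : T.toSpace i p ∈ W b) : eval i p ha (s' a) = eval i p hb (s' b) :=
    congrArg (fun t : T.sectionsAlg (W a ⊓ W b) =>
      eval i p (show T.toSpace i p ∈ W a ⊓ W b from ⟨ha, hb⟩) t) (hs a b)
  choose a ha using fun x : (iSup W : Opens T.space) => Opens.mem_iSup.1 x.2
  let t : T.sectionsAlg (iSup W) :=
    ⟨fun i => ⟨fun p => eval i p.1 (ha ⟨_, p.2⟩) (s' (a ⟨_, p.2⟩)), fun p => by
        obtain ⟨V, hV, hVW, b, f, e⟩ := ((s' (a ⟨_, p.2⟩)).1 i).2 ⟨p.1, ha ⟨_, p.2⟩⟩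
        refine ⟨V, hV, fun r hr => Opens.mem_iSup.2 ⟨_, hVW hr⟩, b, f, fun r => ?_⟩
        obtain ⟨hf, e'⟩ := e r
        exact ⟨hf, (key _ _ i r.1 _ (hVW r.2)).trans e'⟩⟩,
      fun i j p q hp hq A φ ψ r hφ hψ e => by
        have hpq : T.toSpace i p = T.toSpace j q := toSpace_eq_iff.2 ⟨A, φ, ψ, r, e, hφ, hψ⟩
        -- Related points are one point of the glued space, so the section selected at `p` is also
        -- defined at `q` and provides the compatibility.
        have hq' : T.toSpace j q ∈ W (a ⟨_, hp⟩) := hpq ▸ ha ⟨_, hp⟩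
        refine (eval_compat (s' (a ⟨_, hp⟩)) (ha ⟨_, hp⟩) hq' A φ ψ r hφ hψ e).trans ?_
        exact congrArg _ (key _ _ j q _ _)⟩
  refine ⟨t, fun b => ?_, fun t' ht' => ?_⟩
  · exact sectionsAlg_ext fun i p hp => key _ _ i p _ _
  · refine sectionsAlg_ext fun i p hp => ?_
    have := congrArg (fun z : T.sectionsAlg (W (a ⟨_, hp⟩)) => eval i p (ha ⟨_, hp⟩) z)
      (ht' (a ⟨_, hp⟩))
    exact this

end SuperFunctor.Atlas

/-! ### The superspace of an atlas -/

namespace SuperFunctor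

open SuperAlg

variable {k : Type u} [CommRing k] {F : SuperAlg.{u} k ⥤ Type u}

namespace Atlas

variable {T : Atlas F} {i j : T.I} {p : PrimeSpectrum (T.B i).Even} {q : PrimeSpectrum (T.B j).Even}

theorem compat_zero : Compat (0 : (T.B i).atPrime p) (0 : (T.B j).atPrime q) :=
  fun _ φ ψ _ hφ hψ _ => (map_zero (locMap φ hφ).toGradedAlgHom).trans
    (map_zero (locMap ψ hψ).toGradedAlgHom).symm

theorem Compat.unique {x x' : (T.B i).atPrime p} {y : (T.B j).atPrime q} (h : Compat x y)
    (h' : Compat x' y) (hr : T.Rel p q) : x = x' := (h.trans h'.symm hr).eq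

/-- The elements of the stalks which are compatible with a fraction on one chart are locally
fractions on the other charts. -/
theorem isLocallyFrac_of_compat {W : Opens T.space} (a : T.B i) (f : (T.B i).Even)
    (hW : ∀ p, f ∉ p.asIdeal → T.toSpace i p ∈ W)
    (y : ∀ q : (Opens.map (T.toSpace j)).obj W, (T.B j).atPrime q.1)
    (hy : ∀ q, ∃ (p : PrimeSpectrum (T.B i).Even) (hf : f ∈ (T.B i).compl p), T.Rel q.1 p ∧
      Compat (y q) (frac a ⟨f, hf⟩)) : (T.B j).IsLocallyFrac y := by
  rintro ⟨q₀, hq₀⟩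
  obtain ⟨p₀, hf₀, hr₀, -⟩ := hy ⟨q₀, hq₀⟩
  obtain ⟨θ, hθ⟩ := hr₀.exists_transition
  obtain ⟨q', rfl⟩ := exists_comap_toAway hθ
  let V : Opens (PrimeSpectrum.Top ((T.B j).away θ.g).Even) :=
    PrimeSpectrum.basicOpen (evenMap θ.hom f)
  -- The transition map turns `a / f` into a section over part of the spectrum of `(B j)_g`, which
  -- is locally a fraction of elements of `B j`.
  obtain ⟨N, hN, hNV, b, g, e⟩ := exists_frac_of_loc
    (t := fun r : V => frac (θ.hom a) (⟨evenMap θ.hom f, r.2⟩ : ((T.B j).away θ.g).compl r.1))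
    (fun r => ⟨V, r.2, le_rfl, _, _, fun r => ⟨r.2, rfl⟩⟩)
    ⟨q', (by
      have h := hf₀
      rw [← θ.comap_eq rfl hr₀] at h
      exact h)⟩
  have hr (r : PrimeSpectrum ((T.B j).away θ.g).Even) (h : r ∈ N) :
      T.toSpace j (comap ((T.B j).toAway θ.g) r) ∈ W := by
    rw [toSpace_eq_iff.2 (θ.rel r)]
    exact hW _ (hNV h)
  refine ⟨⟨comap ((T.B j).toAway θ.g) '' N.1, (isOpenEmbedding_comap_toAway θ.g).isOpenMap _ N.2⟩,
    ⟨q', hN, rfl⟩, ?_, b, g, ?_⟩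
  · rintro _ ⟨r, h, rfl⟩
    exact hr r h
  · rintro ⟨_, r, h, rfl⟩
    obtain ⟨hg, e⟩ := e ⟨r, h⟩
    refine ⟨hg, locMap_toLoc_injective (q := r) rfl (Eq.trans ?_ e)⟩
    obtain ⟨p, hf, hqp, hc⟩ := hy ⟨comap ((T.B j).toAway θ.g) r, hr r h⟩
    refine (hc _ _ _ r rfl (θ.comap_eq rfl hqp) θ.map_hom.symm).trans ?_
    exact locMap_frac _ _ a f hf _

/-- Write `x = a / f` and extend it over the image of `D(f)`: at a point of any chart lying there,
take the stalk element compatible with `a / f`. These elements are compatible among themselves by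
transitivity. -/
theorem exists_eval_eq (x : (T.B i).atPrime p) :
    ∃ (W : Opens T.space) (hp : T.toSpace i p ∈ W) (s : T.sectionsAlg W), eval i p hp s = x := by
  obtain ⟨a, f, hf, rfl⟩ := atPrime_surj x
  let W : Opens T.space := ⟨T.toSpace i '' (PrimeSpectrum.basicOpen f : Set (PrimeSpectrum _)),
    (isOpenEmbedding_toSpace i).isOpenMap _ (PrimeSpectrum.basicOpen f).2⟩
  have hW (p : PrimeSpectrum (T.B i).Even) (h : f ∉ p.asIdeal) : T.toSpace i p ∈ W := ⟨p, h, rfl⟩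
  have key (j : T.I) (q : PrimeSpectrum (T.B j).Even) (hq : T.toSpace j q ∈ W) :
      ∃ (y : (T.B j).atPrime q) (p : PrimeSpectrum (T.B i).Even) (hf : f ∈ (T.B i).compl p),
        T.Rel q p ∧ Compat y (frac a ⟨f, hf⟩) := by
    obtain ⟨p, hf, e⟩ := hq
    have hr := (toSpace_eq_iff.1 e).symm
    obtain ⟨y, hy⟩ := hr.exists_compat (frac a ⟨f, hf⟩)
    exact ⟨y, p, hf, hr, hy⟩
  choose y P hf' hr hc using key
  refine ⟨W, hW p hf, ⟨fun j => ⟨fun q => y j q.1 q.2, isLocallyFrac_of_compat a f hW _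
    fun q => ⟨_, _, hr _ _ _, hc _ _ _⟩⟩, fun j l q t hq ht A φ ψ r hφ hψ e => ?_⟩, ?_⟩
  · have h1 : T.Rel q t := ⟨A, φ, ψ, r, e, hφ, hψ⟩
    have h2 : P j q hq = P l t ht := ((hr j q hq).symm.trans (h1.trans (hr l t ht))).eq
    have h3 := hc j q hq
    have h4 := (hc l t ht).symm
    -- The two points of the chart `i` are equal but not definitionally so; the fraction is
    -- transported along their equality.
    have h5 (p' : PrimeSpectrum (T.B i).Even) (h : P l t ht = p') (hf : f ∈ (T.B i).compl p')
        (z) (hz : Compat (frac a ⟨f, hf' l t ht⟩) z) : Compat (frac a ⟨f, hf⟩) z (q := t) := by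
      subst h
      exact hz
    exact h3.trans (h5 _ h2.symm _ _ h4) (hr j q hq) A φ ψ r hφ hψ e
  · have h2 : P i p (hW p hf) = p := (hr i p (hW p hf)).symm.eq
    have h5 (p' : PrimeSpectrum (T.B i).Even) (h : p' = p) (hf' : f ∈ (T.B i).compl p')
        (z : (T.B i).atPrime p) (hz : Compat z (frac a ⟨f, hf'⟩)) : z = frac a ⟨f, hf⟩ := by
      subst h
      exact hz.eq
    exact h5 _ h2 _ _ (hc i p (hW p hf))

/-- Vanishing at `p` spreads to a neighbourhood in the chart `i`, and from there to the other charts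
by uniqueness of compatible elements. -/
theorem exists_res_eq_zero {U : Opens T.space} (s : T.sectionsAlg U) (hp : T.toSpace i p ∈ U)
    (h : eval i p hp s = 0) : ∃ (V : Opens T.space) (f : V ⟶ U), T.toSpace i p ∈ V ∧
      T.presheaf.map f.op s = 0 := by
  obtain ⟨V, hV, hVU, e⟩ := SuperAlg.exists_eval_eq (A := T.B i)
    (U := (Opens.map (T.toSpace i)).obj U) (s.1 i) 0 p hp h
  have hU (q) (hq : q ∈ T.toSpace i '' V) : q ∈ U := by
    obtain ⟨r, hr, rfl⟩ := hq
    exact hVU hr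
  refine ⟨⟨T.toSpace i '' V, (isOpenEmbedding_toSpace i).isOpenMap _ V.2⟩, homOfLE hU, ⟨p, hV, rfl⟩,
    sectionsAlg_ext fun j q hq => ?_⟩
  obtain ⟨r, hr, e'⟩ := id hq
  have h0 : eval i r (hVU hr) s = 0 := e r hr
  have hc := eval_compat s (hU _ hq) (hVU hr)
  rw [h0] at hc
  exact hc.unique compat_zero (toSpace_eq_iff.1 e').symm

variable (T) in
/-- The glued space with its sheaf of superalgebras. -/
def presheafedSpace : PresheafedSpace.{u, u + 1, u} (SuperAlg k) where
  carrier := T.space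
  presheaf := T.presheaf

variable (T) in
/-- The map from a chart to the glued superspace, as a morphism of presheafed spaces. -/
def chartAux (i : T.I) : (T.B i).spec.toPresheafedSpace ⟶ T.presheafedSpace :=
  presheafedHomOfVal (X := T.presheafedSpace) (T.toSpace i) (fun _ p hp => eval i p hp)
    (fun _ _ _ _ _ _ => rfl) (fun U s p hp => by
      let t : T.sectionsAlg U := s
      obtain ⟨V, hV, hVU, a, f, e⟩ := (t.1 i).2 ⟨p, hp⟩
      exact ⟨V, hV, fun q hq => hVU hq, a, f, fun q hq => e ⟨q, hq⟩⟩)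

instance (i : T.I) : PresheafedSpace.IsOpenImmersion (T.chartAux i) :=
  isOpenImmersion_of_val (T.chartAux i) T.isSheaf_presheaf (isOpenEmbedding_toSpace i)
    (fun _ s _ hp h => exists_res_eq_zero s hp h) (fun _ x => exists_eval_eq x)

variable (T) in
/-- The superspace obtained by gluing the spectra of an atlas. -/
def superSpace : SuperSpace k where
  toPresheafedSpace := T.presheafedSpace
  isSheaf := T.isSheaf_presheaf
  isLocal x := by
    obtain ⟨i, p, rfl⟩ := exists_toSpace_eq x
    refine (SuperStalk.isLocal_superStalk_iff (X := T.space) T.presheaf _).2 ?_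
    have : IsLocalRing (SuperStalk.evenStalk (T.B i).spec.presheaf p) :=
      (SuperStalk.isLocal_superStalk_iff _ _).1 ((T.B i).spec.isLocal p)
    exact (RingEquiv.ofBijective _
      (SuperSpace.evenStalkMap_bijective (T.chartAux i) p)).symm.isLocalRing

variable (T) in
/-- The chart of the glued superspace. -/
def chart (i : T.I) : (T.B i).spec ⟶ T.superSpace :=
  have : PresheafedSpace.IsOpenImmersion (Y := T.superSpace.toPresheafedSpace) (T.chartAux i) :=
    inferInstanceAs (PresheafedSpace.IsOpenImmersion (T.chartAux i))
  SuperSpace.homOfOpenImmersion (T.chartAux i)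

instance (i : T.I) : SuperSpace.IsOpenImmersion (T.chart i) :=
  inferInstanceAs (PresheafedSpace.IsOpenImmersion (T.chartAux i))

/-- The data `A`, `φ`, `ψ` form an overlap, so the images of each point are identified by `Rel` and
the values of each section agree by `Compat`. -/
theorem specMap_comp_chart {A : SuperAlg k} {φ : T.B i ⟶ A} {ψ : T.B j ⟶ A}
    (h : F.map φ (T.gen i) = F.map ψ (T.gen j)) :
    specMap φ ≫ T.chart i = specMap ψ ≫ T.chart j := by
  refine val_ext (fun r => toSpace_eq_iff.2 ⟨A, φ, ψ, r, h, rfl, rfl⟩) fun U s r hφ hψ => ?_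
  refine (val_specMap_comp φ (T.chart i) rfl hφ hφ s).trans (Eq.trans ?_
    (val_specMap_comp ψ (T.chart j) rfl hψ hψ s).symm)
  exact eval_compat (T := T) s hφ hψ A φ ψ r rfl rfl h

theorem span_range_eq_top {R : Type u} [CommRing R] (f : PrimeSpectrum R → R)
    (hf : ∀ p, f p ∉ p.asIdeal) : Ideal.span (Set.range f) = ⊤ := by
  by_contra h
  obtain ⟨m, hm, hle⟩ := Ideal.exists_le_maximal _ h
  exact hf ⟨m, hm.isPrime⟩ (hle (Ideal.subset_span ⟨_, rfl⟩))

/-- As `F` is local, it suffices to argue near each point of `Spec A₀`. There a transition map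
exists, and since the chart `j` is a monomorphism, its composite with the localized `φ` is the
localized `ψ`; the equation `map_hom` concludes. -/
theorem map_gen_eq_of_specMap_comp_chart (hF : IsLocal F) {A : SuperAlg k} {φ : T.B i ⟶ A}
    {ψ : T.B j ⟶ A} (h : specMap φ ≫ T.chart i = specMap ψ ≫ T.chart j) :
    F.map φ (T.gen i) = F.map ψ (T.gen j) := by
  have hr (r : PrimeSpectrum A.Even) : T.Rel (comap φ r) (comap ψ r) :=
    toSpace_eq_iff.1 (congrArg (fun g : A.spec ⟶ T.superSpace => g.base r) h)
  choose θ hθ using fun r => (hr r).exists_transition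
  refine hF.ext (fun r => evenMap φ (θ r).g) (span_range_eq_top _ hθ) fun r => ?_
  have e : (θ r).hom ≫ awayFunctoriality (θ r).g φ = ψ ≫ A.toAway (evenMap φ (θ r).g) := by
    refine specMap_injective (SuperSpace.cancel_openImmersion (T.chart j) ?_)
    rw [specMap_comp, Category.assoc, specMap_comp_chart (θ r).map_hom, ← Category.assoc,
      ← specMap_comp, toAway_awayFunctoriality, specMap_comp, Category.assoc, h, specMap_comp,
      Category.assoc]
  rw [← Functor.map_comp_apply, ← Functor.map_comp_apply, ← e, ← toAway_awayFunctoriality,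
    Functor.map_comp_apply, Functor.map_comp_apply, (θ r).map_hom]

theorem exists_notMem_of_mem {A : SuperAlg k} {V : Opens (PrimeSpectrum.Top A.Even)}
    {r : PrimeSpectrum A.Even} (h : r ∈ V) :
    ∃ f : A.Even, f ∉ r.asIdeal ∧ ∀ q, comap (A.toAway f) q ∈ V := by
  obtain ⟨_, ⟨_, ⟨g, rfl⟩, rfl⟩, hp, hg⟩ :=
    PrimeSpectrum.isBasis_basic_opens.exists_subset_of_mem_open h V.2
  exact ⟨g, hp, fun q => hg (notMem_comap_toAway q)⟩

variable (T) in
-- Each point of `Spec A₀` lies in some locus of `a`; on a basic neighbourhood inside it `a` belongs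
-- to that subfunctor and comes from its universal element.
theorem isLocallyGenerated_gen : IsLocallyGenerated T.gen := by
  intro A a
  have key (r : PrimeSpectrum A.Even) : ∃ f : A.Even, f ∉ r.asIdeal ∧ ∃ i,
      ∀ q, comap (A.toAway f) q ∈ T.locus i A a := by
    obtain ⟨i, hi⟩ := Opens.mem_iSup.1 ((T.iSup_locus A a).ge (Opens.mem_top r))
    obtain ⟨f, hf, h⟩ := exists_notMem_of_mem hi
    exact ⟨f, hf, i, h⟩
  choose f hf i h using key
  refine ⟨_, f, span_range_eq_top f hf, fun r => ⟨i r, ?_⟩⟩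
  obtain ⟨ψ, hψ, -⟩ := T.existsUnique (i r) _ _ ((T.isLocus (i r) A a _ _).2 (h r))
  exact ⟨ψ, hψ.symm⟩

variable (T) in
-- Near each point the morphism has image in one chart, through which it lifts; full faithfulness
-- makes the lift a morphism of superalgebras.
theorem isLocallyGenerated_chart :
    IsLocallyGenerated (F := T.superSpace.functorOfPoints) (fun i => T.chart i) := by
  intro A a
  let a' : A.spec ⟶ T.superSpace := a
  have key (r : PrimeSpectrum A.Even) : ∃ f : A.Even, f ∉ r.asIdeal ∧ ∃ i,
      ∀ q, a'.base (comap (A.toAway f) q) ∈ Set.range (T.toSpace i) := by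
    obtain ⟨i, p, hp⟩ := exists_toSpace_eq (a'.base r)
    obtain ⟨f, hf, h⟩ := exists_notMem_of_mem (V := (Opens.map a'.base).obj
      ⟨Set.range (T.toSpace i), (isOpenEmbedding_toSpace i).isOpen_range⟩) ⟨p, hp⟩
    exact ⟨f, hf, i, h⟩
  choose f hf i h using key
  refine ⟨_, f, span_range_eq_top f hf, fun r => ⟨i r, ?_⟩⟩
  obtain ⟨l, hl⟩ := SuperSpace.exists_lift (T.chart (i r)) (specMap (A.toAway (f r)) ≫ a') (h r)
  refine ⟨ofSpecHom l, ?_⟩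
  change specMap (A.toAway (f r)) ≫ a' = specMap (ofSpecHom l) ≫ T.chart (i r)
  rw [specMap_ofSpecHom, hl]

variable (T) in
theorem nonempty_iso_functorOfPoints (hF : IsLocal F) :
    Nonempty (F ≅ T.superSpace.functorOfPoints) :=
  nonempty_iso hF (SuperSpace.isLocal_functorOfPoints _) T.isLocallyGenerated_gen
    T.isLocallyGenerated_chart fun _ _ _ _ _ =>
      ⟨specMap_comp_chart, map_gen_eq_of_specMap_comp_chart hF⟩

end Atlas

end SuperFunctor

/-! ### The even part of the spectrum -/

namespace SuperAlg

variable {k : Type u} [CommRing k] (A : SuperAlg k)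

/-- The even fractions `a / s`, as elements of the even part of the localization. -/
def evenFracFun (S : Submonoid A.Even) (x : LocalizedModule S A.Even) : (A.loc S).Even :=
  LocalizedModule.liftOn x (fun a => ⟨frac (a.1 : A) a.2, A.frac_mem a.1.2 _⟩) (by
    rintro ⟨a, s⟩ ⟨b, t⟩ ⟨v, hv⟩
    exact Subtype.ext (frac_eq_iff.2 ⟨v, congrArg Subtype.val hv⟩))

theorem evenFracFun_injective (S : Submonoid A.Even) : Function.Injective (A.evenFracFun S) := by
  intro x y h
  induction x using LocalizedModule.induction_on with | _ a s
  induction y using LocalizedModule.induction_on with | _ b t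
  obtain ⟨v, hv⟩ := frac_eq_iff.1 (congrArg Subtype.val h : frac (a : A) s = frac (b : A) t)
  exact LocalizedModule.mk_eq.2 ⟨v, Subtype.ext hv⟩

theorem evenFracFun_one (S : Submonoid A.Even) : A.evenFracFun S 1 = 1 := by
  have h : (1 : LocalizedModule S A.Even) = LocalizedModule.mk 1 1 := OreLocalization.one_def
  rw [h]
  exact Subtype.ext frac_one

theorem evenFracFun_zero (S : Submonoid A.Even) : A.evenFracFun S 0 = 0 := by
  rw [← LocalizedModule.zero_mk 1]
  exact Subtype.ext (frac_zero 1)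

theorem evenFracFun_mul (S : Submonoid A.Even) (x y : LocalizedModule S A.Even) :
    A.evenFracFun S (x * y) = A.evenFracFun S x * A.evenFracFun S y := by
  induction x using LocalizedModule.induction_on with | _ a s
  induction y using LocalizedModule.induction_on with | _ b t
  have h : LocalizedModule.mk a s * LocalizedModule.mk b t = LocalizedModule.mk (a * b) (s * t) :=
    LocalizedModule.mk_mul_mk
  refine (congrArg (A.evenFracFun S) h).trans ?_
  exact Subtype.ext (frac_mul_frac (a : A) b s t).symm

theorem evenFracFun_add (S : Submonoid A.Even) (x y : LocalizedModule S A.Even) :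
    A.evenFracFun S (x + y) = A.evenFracFun S x + A.evenFracFun S y := by
  induction x using LocalizedModule.induction_on with | _ a s
  induction y using LocalizedModule.induction_on with | _ b t
  rw [LocalizedModule.mk_add_mk]
  exact Subtype.ext (frac_add_frac (a : A) b s t).symm

/-- The map from the sections of the structure sheaf of `A₀` to the even sections of the structure
sheaf of `A`. -/
def evenSectionsMap (U : Opens (PrimeSpectrum.Top A.Even)) :
    (StructureSheaf.sectionsSubalgebra A.Even U) →+* (A.sectionsAlg U).Even where
  toFun s := ⟨⟨fun p => A.evenFracFun (A.compl p.1) (s.1 p), fun p => by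
      obtain ⟨V, hV, i, a, f, e⟩ := s.2 p
      refine ⟨V, hV, i.le, a, f, fun q => ?_⟩
      obtain ⟨hf, e⟩ := e q
      exact ⟨hf, congrArg (fun x => (A.evenFracFun (A.compl q.1) x : A.atPrime q.1)) e⟩⟩,
    fun p => (A.evenFracFun (A.compl p.1) (s.1 p)).2⟩
  map_one' := Subtype.ext (Subtype.ext (funext fun p =>
    congrArg Subtype.val (A.evenFracFun_one (A.compl p.1))))
  map_zero' := Subtype.ext (Subtype.ext (funext fun p =>
    congrArg Subtype.val (A.evenFracFun_zero (A.compl p.1))))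
  map_mul' s t := Subtype.ext (Subtype.ext (funext fun p =>
    congrArg Subtype.val (A.evenFracFun_mul (A.compl p.1) (s.1 p) (t.1 p))))
  map_add' s t := Subtype.ext (Subtype.ext (funext fun p =>
    congrArg Subtype.val (A.evenFracFun_add (A.compl p.1) (s.1 p) (t.1 p))))

/-- Preimages exist and are unique at each point. They form a section because an even section is
locally a fraction with even numerator (`even_section_eq`). -/
theorem evenSectionsMap_bijective (U : Opens (PrimeSpectrum.Top A.Even)) :
    Function.Bijective (A.evenSectionsMap U) := by
  refine ⟨fun s t h => Subtype.ext (funext fun p => A.evenFracFun_injective _ (Subtype.ext ?_)),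
    fun s => ?_⟩
  · exact congrArg (fun x : (A.sectionsAlg U).Even => A.eval p.1 p.2 x.1) h
  · have key (p : U) := A.even_section_eq s.1 s.2 p
    have h (p : U) : ∃ x, (A.evenFracFun (A.compl p.1) x : A.atPrime p.1) = s.1.1 p := by
      obtain ⟨V, hV, i, a, f, e⟩ := key p
      obtain ⟨hf, e⟩ := e ⟨p.1, hV⟩
      exact ⟨LocalizedModule.mk a ⟨f, hf⟩, e.symm⟩
    choose x hx using h
    refine ⟨⟨x, fun p => ?_⟩, Subtype.ext (Subtype.ext (funext hx))⟩
    obtain ⟨V, hV, i, a, f, e⟩ := key p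
    refine ⟨V, hV, homOfLE i, a, f, fun q => ?_⟩
    obtain ⟨hf, e⟩ := e q
    exact ⟨hf, A.evenFracFun_injective _ (Subtype.ext ((hx _).trans e))⟩

/-- The map from the structure sheaf of `A₀` to the even part of the structure sheaf of `A`. -/
def evenStructureMap :
    (Spec.structureSheaf A.Even).obj ⟶ A.structurePresheaf ⋙ evenFunctor where
  app U := CommRingCat.ofHom (A.evenSectionsMap U.unop)
  naturality _ _ _ := rfl

instance : IsIso A.evenStructureMap := by
  have (U : (Opens (PrimeSpectrum.Top A.Even))ᵒᵖ) : IsIso (A.evenStructureMap.app U) :=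
    (ConcreteCategory.isIso_iff_bijective _).2 (A.evenSectionsMap_bijective U.unop)
  exact NatIso.isIso_of_isIso_app _

end SuperAlg

namespace SuperSpace

open SuperAlg

variable {k : Type u} [CommRing k] {X : SuperSpace k} {A : SuperAlg k} (g : A.spec ⟶ X)

/-- The morphism of presheafed spaces from the spectrum of `A₀` to the even part of `X` which is
induced by a morphism `Spec A ⟶ X`. -/
def evenChartAux : (Spec.toLocallyRingedSpace.obj (op (.of A.Even))).toPresheafedSpace ⟶
    X.even.toPresheafedSpace where
  base := g.base
  c :=
    { app U := evenFunctor.map (g.c.app U) ≫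
        (inv A.evenStructureMap).app (op ((Opens.map g.base).obj U.unop))
      naturality U V i := by
        have h1 := congrArg evenFunctor.map (g.c.naturality i)
        rw [Functor.map_comp, Functor.map_comp] at h1
        have h2 := (inv A.evenStructureMap).naturality ((Opens.map g.base).map i.unop).op
        refine ((Category.assoc _ _ _).symm.trans (congrArg (· ≫ _) h1)).trans ?_
        exact (Category.assoc _ _ _).trans
          ((congrArg (_ ≫ ·) h2).trans (Category.assoc _ _ _).symm) }

variable [IsOpenImmersion g]

instance : PresheafedSpace.IsOpenImmersion (evenChartAux g) where
  base_open := PresheafedSpace.IsOpenImmersion.base_open (f := g.toHom)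
  c_iso V := by
    let W := (PresheafedSpace.IsOpenImmersion.base_open (f := g.toHom)).functor.obj V
    let c := g.c.app (op W)
    have : IsIso c := PresheafedSpace.IsOpenImmersion.c_iso (f := g.toHom) V
    have h : IsIso (evenFunctor.map c) := inferInstance
    let d := (inv A.evenStructureMap).app (op ((Opens.map g.base).obj W))
    have h' : IsIso d := inferInstance
    exact @IsIso.comp_isIso _ _ _ _ _ (evenFunctor.map c) d h h'

/-- The morphism from the spectrum of `A₀` to the even part of `X` which is induced by an open
immersion `Spec A ⟶ X`. -/
def evenChartHom : Spec.toLocallyRingedSpace.obj (op (.of A.Even)) ⟶ X.even :=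
  ⟨evenChartAux g, fun x => by
    have := PresheafedSpace.IsOpenImmersion.stalk_iso (evenChartAux g) x
    exact isLocalHom_of_isIso ((evenChartAux g).stalkMap x)⟩

instance : LocallyRingedSpace.IsOpenImmersion (evenChartHom g) :=
  inferInstanceAs (PresheafedSpace.IsOpenImmersion (evenChartAux g))

/-- The spectrum of `A₀` is the even part of `Spec A`, so the even part of `X` is covered by open
immersions from affine schemes. -/
theorem evenIsScheme_of_charts {I : Type u} {A : I → SuperAlg k} (g : ∀ i, (A i).spec ⟶ X)
    [∀ i, IsOpenImmersion (g i)] (hg : ∀ x : X, ∃ i p, (g i).base p = x) : X.EvenIsScheme :=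
  (LocallyRingedSpace.IsOpenImmersion.scheme X.even fun x => by
    obtain ⟨i, p, hp⟩ := hg x
    exact ⟨.of (A i).Even, evenChartHom (g i), ⟨p, hp⟩, inferInstance⟩).local_affine

end SuperSpace

/-! ### Quasi-coherence of the odd part -/

namespace SuperAlg

variable {k : Type u} [CommRing k] {A : SuperAlg k}

/-- The sections over `D(f)` of the sheaf of the `A₀`-module `A` form its localization at `f`; the
equation is stated through values in the stalks. -/
theorem exists_frac_mul_eval_eq (f : A.Even)
    (s : A.sectionsAlg (PrimeSpectrum.basicOpen f : Opens (PrimeSpectrum.Top A.Even))) :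
    ∃ (n : ℕ) (a : A), ∀ (p : PrimeSpectrum A.Even) (hp : f ∉ p.asIdeal),
      frac ((f ^ n : A.Even) : A) (1 : A.compl p) * A.eval p hp s = frac a 1 := by
  obtain ⟨⟨a, ⟨_, n, rfl⟩⟩, h⟩ := IsLocalizedModule.surj (.powers f)
    (StructureSheaf.toOpenₗ A.Even A (PrimeSpectrum.basicOpen f)) (toInType s)
  refine ⟨n, a, fun p hp => ?_⟩
  let x : LocalizedModule (A.compl p) A := A.eval p hp s
  have h' : (f ^ n) • x = frac a (1 : A.compl p) := congrArg (fun t => t.1 ⟨p, hp⟩) h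
  refine Eq.trans ?_ h'
  obtain ⟨b, t, ht⟩ := frac_surj (A.eval p hp s)
  have hx : x = LocalizedModule.mk b t := ht.symm
  rw [hx, ← ht, frac_mul_frac, one_mul]
  exact (LocalizedModule.smul'_mk (f ^ n) b t).symm

theorem exists_pow_mul_eq_zero_of_frac (f : A.Even) (a : A)
    (h : ∀ p : PrimeSpectrum A.Even, f ∉ p.asIdeal → frac a (1 : A.compl p) = 0) :
    ∃ n : ℕ, ((f ^ n : A.Even) : A) * a = 0 := by
  have h0 : StructureSheaf.toOpenₗ A.Even A (PrimeSpectrum.basicOpen f) a = 0 :=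
    Subtype.ext (funext fun p => h p.1 p.2)
  obtain ⟨⟨_, n, rfl⟩, hn⟩ := (IsLocalizedModule.eq_zero_iff (.powers f) _).1 h0
  exact ⟨n, hn⟩

end SuperAlg

namespace SuperSpace

open SuperAlg

variable {k : Type u} [CommRing k] {X : SuperSpace k} {A : SuperAlg k} (g : A.spec ⟶ X)
  [IsOpenImmersion g]

/-- The image of an open subset under an open immersion. -/
abbrev image (V : Opens (PrimeSpectrum.Top A.Even)) : Opens X :=
  (PresheafedSpace.IsOpenImmersion.base_open (f := g.toHom)).functor.obj V

theorem image_le_image_top (V : Opens (PrimeSpectrum.Top A.Even)) : image g V ≤ image g ⊤ :=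
  Set.image_mono le_top

theorem ext_of_val {V : Opens (PrimeSpectrum.Top A.Even)} {s t : X.presheaf.obj (op (image g V))}
    (h : ∀ (p : PrimeSpectrum A.Even) (hp : p ∈ V),
      val g.toHom (U := image g V) p ⟨p, hp, rfl⟩ s =
        val g.toHom (U := image g V) p ⟨p, hp, rfl⟩ t) :
    s = t := by
  have := PresheafedSpace.IsOpenImmersion.c_iso (f := g.toHom) V
  refine (bijective_of_isIso (g.c.app (op (image g V)))).1 (sections_ext (A := A) fun p hp => ?_)
  obtain ⟨q, hq, e⟩ := id hp
  obtain rfl := (PresheafedSpace.IsOpenImmersion.base_open (f := g.toHom)).injective e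
  exact h q hq

theorem exists_val_eq {V : Opens (PrimeSpectrum.Top A.Even)} (t : A.sectionsAlg V) :
    ∃ s : X.presheaf.obj (op (image g V)), ∀ (p : PrimeSpectrum A.Even) (hp : p ∈ V),
      val g.toHom (U := image g V) p ⟨p, hp, rfl⟩ s = A.eval p hp t := by
  have hb := PresheafedSpace.IsOpenImmersion.base_open (f := g.toHom)
  have hle : (Opens.map g.base).obj (image g V) ≤ V := by
    rintro p ⟨q, hq, e⟩
    obtain rfl := hb.injective e
    exact hq
  have := PresheafedSpace.IsOpenImmersion.c_iso (f := g.toHom) V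
  obtain ⟨s, hs⟩ := (bijective_of_isIso (g.c.app (op (image g V)))).2
    (A.structurePresheaf.map (homOfLE hle).op t)
  exact ⟨s, fun p hp => congrArg
    (A.eval (U := (Opens.map g.base).obj (image g V)) p ⟨p, hp, rfl⟩) hs⟩

/-- The morphism of schemes from the spectrum of `A₀` to the even part of `X` which is induced by
an open immersion `Spec A ⟶ X`. -/
def evenChart (h : X.EvenIsScheme) : Spec (.of A.Even) ⟶ evenScheme h := ⟨evenChartHom g⟩

instance (h : X.EvenIsScheme) : AlgebraicGeometry.IsOpenImmersion (evenChart g h) :=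
  inferInstanceAs (LocallyRingedSpace.IsOpenImmersion (evenChartHom g))

/-- The function on the image of an open subset under `evenChart` given by an element of `A₀`. -/
def chartScalar (h : X.EvenIsScheme) (V : Opens (PrimeSpectrum.Top A.Even)) (f : A.Even) :
    (X.presheaf.obj (op (image g V))).Even :=
  ((evenChart g h).appIso V).inv ((Spec (.of A.Even)).presheaf.map V.leTop.op
    ((Scheme.ΓSpecIso (.of A.Even)).inv f))

/-- `A₀` acts on the odd sections over an image by multiplication with `chartScalar`. Its pullback
to the spectrum of `A₀` is the section `f / 1`, which `evenStructureMap` matches with the pullback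
to `Spec A`. -/
theorem val_chartScalar (h : X.EvenIsScheme) (V : (Spec (.of A.Even)).Opens) (f : A.Even)
    (p : PrimeSpectrum A.Even) (hp : p ∈ V) :
    val g.toHom (U := image g V) p ⟨p, hp, rfl⟩ (chartScalar g h V f) = frac (f : A) 1 := by
  let y : (evenScheme h).presheaf.obj (op (evenChart g h ''ᵁ V)) := chartScalar g h V f
  have h1 : ((evenChart g h).appIso V).hom y = (Spec (.of A.Even)).presheaf.map V.leTop.op
    ((Scheme.ΓSpecIso (.of A.Even)).inv f) :=
    ConcreteCategory.congr_hom ((evenChart g h).appIso V).inv_hom_id _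
  rw [Scheme.Hom.appIso_hom', Scheme.Hom.appLE] at h1
  let z : StructureSheaf.sectionsSubalgebra A.Even ((Opens.map g.base).obj (image g V)) :=
    (evenChart g h).app (evenChart g h ''ᵁ V) y
  have h2 : z.1 ⟨p, ⟨p, hp, rfl⟩⟩ = LocalizedModule.mk f 1 :=
    congrArg (fun s : StructureSheaf.sectionsSubalgebra A.Even V => s.1 ⟨p, hp⟩) h1
  have h3 : A.evenSectionsMap _ z = evenMap (g.c.app (op (image g V))) (chartScalar g h V f) :=
    ConcreteCategory.congr_hom (NatTrans.congr_app (IsIso.inv_hom_id A.evenStructureMap)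
      (op ((Opens.map g.base).obj (image g V)))) (evenMap (g.c.app (op (image g V)))
        (chartScalar g h V f))
  have h4 := congrArg (fun s : (A.sectionsAlg ((Opens.map g.base).obj (image g V))).Even =>
    A.eval (U := (Opens.map g.base).obj (image g V)) p ⟨p, hp, rfl⟩ s.1) h3
  refine h4.symm.trans ?_
  exact congrArg (fun x => (A.evenFracFun (A.compl p) x : A.atPrime p)) h2

end SuperSpace

namespace SuperSpace

open SuperAlg AlgebraicGeometry.Scheme.Modules

variable {k : Type u} [CommRing k] {X : SuperSpace k} {A : SuperAlg k} (g : A.spec ⟶ X)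
  [IsOpenImmersion g]

/-- Pulled back to `Spec A`, the section satisfies `f ^ n t = a` on `D(f)` for some `a` in `A`, and
elements of `A` are global. -/
theorem exists_odd_res_eq_mul (h : X.EvenIsScheme) (f : A.Even)
    (t : X.presheaf.obj (op (image g (PrimeSpectrum.basicOpen f))))
    (ht : t ∈ (X.presheaf.obj _).part 1) :
    ∃ (n : ℕ) (a : X.presheaf.obj (op (image g ⊤))), a ∈ (X.presheaf.obj _).part 1 ∧
      X.presheaf.map (homOfLE (image_le_image_top g _)).op a =
        (chartScalar g h (PrimeSpectrum.basicOpen f) (f ^ n) : X.presheaf.obj _) * t := by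
  let U : Opens (PrimeSpectrum.Top A.Even) := PrimeSpectrum.basicOpen f
  let c := A.structurePresheaf.map
    (homOfLE (Set.subset_preimage_image _ _) : U ⟶ (Opens.map g.base).obj (image g U)).op
  obtain ⟨n, a, ha⟩ := exists_frac_mul_eval_eq f (c (g.c.app _ t))
  have ha' (p : PrimeSpectrum A.Even) (hp : f ∉ p.asIdeal) :
      frac ((f ^ n : A.Even) : A) (1 : A.compl p) * val g.toHom (U := image g U) p ⟨p, hp, rfl⟩ t =
        frac a 1 := ha p hp
  -- As `f ^ n t` is odd, `a` may be replaced by its odd component.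
  obtain ⟨s, hs⟩ := exists_val_eq g (A.toSections ⊤ (A.proj 1 a))
  have hs1 : (X.presheaf.obj _).proj 1 s = s := by
    refine ext_of_val g fun p hp => ?_
    rw [map_proj, hs p hp, ← map_proj, ← map_proj, proj_of_mem A (A.proj_mem 1 a)]
  refine ⟨n, s, hs1 ▸ proj_mem _ 1 s, ext_of_val g fun p hp => ?_⟩
  refine (val_res g.toHom _ p _ s).trans ((hs p trivial).trans ?_)
  refine (A.proj_frac 1 a (1 : A.compl p)).symm.trans ?_
  refine Eq.trans ?_ (map_mul (val g.toHom (U := image g U) p ⟨p, hp, rfl⟩).toGradedAlgHom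
    (chartScalar g h U (f ^ n) : X.presheaf.obj _) t).symm
  have e1 : (val g.toHom (U := image g U) p ⟨p, hp, rfl⟩).toGradedAlgHom
      (chartScalar g h U (f ^ n)) = frac ((f ^ n : A.Even) : A) 1 :=
    val_chartScalar g h U (f ^ n) p hp
  have e2 : (val g.toHom (U := image g U) p ⟨p, hp, rfl⟩).toGradedAlgHom t ∈
      (A.atPrime p).part 1 := map_part (val g.toHom (U := image g U) p ⟨p, hp, rfl⟩) ht
  rw [e1, ← ha' p hp]
  have e3 := SetLike.mul_mem_graded (A.frac_mem (f ^ n : A.Even).2 (1 : A.compl p)) e2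
  rw [zero_add] at e3
  exact proj_of_mem _ e3

/-- Over the whole chart the section is an element `b` of `A`; its vanishing on `D(f)` means that a
power of `f` kills `b`. -/
theorem exists_chartScalar_mul_eq_zero (h : X.EvenIsScheme) (f : A.Even)
    (a : X.presheaf.obj (op (image g ⊤)))
    (ha : X.presheaf.map (homOfLE (image_le_image_top g (PrimeSpectrum.basicOpen f))).op a = 0) :
    ∃ n : ℕ, (chartScalar g h ⊤ (f ^ n)).1 * a = 0 := by
  let c := A.structurePresheaf.map
    (homOfLE (Set.subset_preimage_image _ _) : ⊤ ⟶ (Opens.map g.base).obj (image g ⊤)).op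
  obtain ⟨b, hb⟩ := toSections_top_bijective.2 (c (g.c.app _ a))
  have hb' (p : PrimeSpectrum A.Even) :
      frac b (1 : A.compl p) = val g.toHom (U := image g ⊤) p ⟨p, trivial, rfl⟩ a :=
    congrArg (A.eval (U := ⊤) p trivial) hb
  obtain ⟨n, hn⟩ := exists_pow_mul_eq_zero_of_frac f b fun p hp => by
    rw [hb']
    refine (val_res g.toHom (homOfLE (image_le_image_top g (PrimeSpectrum.basicOpen f))) p
      ⟨p, hp, rfl⟩ a).symm.trans ?_
    rw [ha]
    exact map_zero (val g.toHom p _).toGradedAlgHom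
  refine ⟨n, ext_of_val g fun p hp => ?_⟩
  refine (map_mul (val g.toHom (U := image g ⊤) p ⟨p, hp, rfl⟩).toGradedAlgHom
    (chartScalar g h ⊤ (f ^ n)).1 a).trans ?_
  refine (congrArg₂ (· * ·) (val_chartScalar g h ⊤ (f ^ n) p hp) (hb' p).symm).trans ?_
  refine (frac_mul_frac _ _ _ _).trans ?_
  rw [hn, frac_zero]
  exact (map_zero (val g.toHom (U := image g ⊤) p ⟨p, hp, rfl⟩).toGradedAlgHom).symm

/-- On each chart the two preceding lemmas are the two halves of the localization criterion for the
odd part. -/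
theorem isQuasicoherent_oddModules_of_charts {I : Type u} {A : I → SuperAlg k}
    (g : ∀ i, (A i).spec ⟶ X) [∀ i, IsOpenImmersion (g i)]
    (hg : ∀ x : X, ∃ i p, (g i).base p = x) (h : X.EvenIsScheme) :
    (oddModules h).IsQuasicoherent := by
  refine isQuasicoherent_of_isLocalizing (oddModules h) (fun i => .of (A i).Even)
    (fun i => evenChart (g i) h) hg fun i => (isLocalizing_iff_exists _).2 fun f => ⟨fun t => ?_,
      fun a ha => ?_⟩
  · let t' : (X.presheaf.obj (op (image (g i) (PrimeSpectrum.basicOpen f)))).part 1 := t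
    obtain ⟨n, a, ha, e⟩ := exists_odd_res_eq_mul (g i) h f t'.1 t'.2
    let a' : (X.presheaf.obj (op (image (g i) ⊤))).part 1 := ⟨a, ha⟩
    exact ⟨n, a', Subtype.ext e⟩
  · let a' : (X.presheaf.obj (op (image (g i) ⊤))).part 1 := a
    obtain ⟨n, hn⟩ := exists_chartScalar_mul_eq_zero (g i) h f a'.1 (congrArg Subtype.val ha)
    exact ⟨n, Subtype.ext hn⟩

end SuperSpace

/-! ### The superscheme of an atlas -/

/-- The superscheme obtained by gluing the spectra of an atlas. -/
def SuperFunctor.Atlas.superScheme {k : Type u} [CommRing k] {F : SuperAlg.{u} k ⥤ Type u}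
    (T : SuperFunctor.Atlas F) : SuperScheme k :=
  have h : T.superSpace.EvenIsScheme :=
    SuperSpace.evenIsScheme_of_charts T.chart SuperFunctor.Atlas.exists_toSpace_eq
  { toSuperSpace := T.superSpace
    evenIsScheme := h
    quasicoherent := SuperSpace.isQuasicoherent_oddModules_of_charts T.chart
      SuperFunctor.Atlas.exists_toSpace_eq h }

end

theorem mainTheorem4 {k : Type u} [CommRing k] (F : SuperAlg.{u} k ⥤ Type u) :
    (∃ X : SuperScheme k, Nonempty (F ≅ X.toSuperSpace.functorOfPoints)) ↔
      SuperFunctor.IsLocal F ∧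
        ∃ (I : Type u) (U : I → Subfunctor F),
          (∀ i, SuperFunctor.IsOpenAffine (U i)) ∧ SuperFunctor.IsOpenCover U := by
  constructor
  · rintro ⟨X, ⟨e⟩⟩
    exact ⟨SuperFunctor.IsLocal.of_iso e (SuperSpace.isLocal_functorOfPoints X.toSuperSpace),
      SuperFunctor.exists_isOpenAffine_cover X e⟩
  · rintro ⟨hF, I, U, hU, hc⟩
    obtain ⟨T⟩ := SuperFunctor.nonempty_atlas U hU hc
    exact ⟨T.superScheme, T.nonempty_iso_functorOfPoints hF⟩
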